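/- **Theorem A.** Let $\mathfrak h$ be a finite-dimensional complex vector space and let $W\le \mathrm{GL}(\mathfrak h)$ be a complex reflection group, that is, a finite group generated by its set $\mathrm{Refl}_W$ of pseudo-reflections. For each reflection hyperplane $H$ let $W_H\le W$ be its pointwise stabiliser and $e_H=|W_H|$, let $v_H$ span the $W_H$-stable line complementary to $H$, and let $\alpha_H\in\mathfrak h^*$ be the form with kernel $H$ and $\alpha_H(v_H)=1$; for $s\in\mathrm{Refl}_W$ with hyperplane $H$ put $v_s=v_H$, $\alpha_s=\alpha_H$. Let $c:\mathrm{Refl}_W\to\mathbb C$ be constant on conjugacy classes, and let $H_c=H_c(W,\mathfrak h)$ be the rational Cherednik algebra, i.e. the quotient of $T(\mathfrak h\oplus\mathfrak h^*)\rtimes W$ by the relations $$[\xi_1,\xi_2]=0,\qquad [x_1,x_2]=0,\qquad [\xi,x]=(\xi,x)+\sum_{s\in\mathrm{Refl}_W}c(s)\,(\xi,\alpha_s)(v_s,x)\,s\qquad(\xi,\xi_i\in\mathfrak h,\ x,x_i\in\mathfrak h^*).$$ Let $S(\mathfrak h)_W$ and $S(\mathfrak h^*)_W$ be the coinvariant algebras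 (the quotients of the symmetric algebras by the ideals generated by the $W$-invariants without constant term), and let $$\Delta_c(S(\mathfrak h)_W)=H_c\otimes_{S(\mathfrak h)\rtimes W}S(\mathfrak h)_W,\qquad \nabla_c(M)=\mathrm{Hom}_{S(\mathfrak h^*)\rtimes W}(H_c,M)^{ln},\qquad M=S(\mathfrak h^*)_W\otimes\det\nolimits_{\mathfrak h}^{-1}\langle N\rangle .$$ Here $ln$ denotes the elements killed by some power of $\mathfrak h$, $W$ acts diagonally on $M$, $S(\mathfrak h^*)$ acts on the first factor, and $\langle N\rangle$, $N=|\mathrm{Refl}_W|$, is a shift of grading, which does not affect the (ungraded) homomorphisms below. Let $D:S(\mathfrak h^*)\to\mathrm{End}_{\mathbb C}(S(\mathfrak h))$ be the algebra homomorphism for which $D(x)$, $x\in\mathfrak h^*$, is the derivation with $D(x)(\xi)=(\xi,x)$ for $\xi\in\mathfrak h$, let $\langle f,g\rangle$ be the constant term of $D(f)(g)$, let $J=\prod_H v_H^{e_H-1}\in S(\mathfrak h)$, and let $\mathrm{Har}\subseteq S(\mathfrak h)$ be the orthogonal complement, with respect to $\langle-,-\rangle$, of the ideal of $S(\mathfrak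 h^*)$ generated by the $W$-invariants without constant term. Then there is a one-to-one correspondence, which is an isomorphism of complex vector spaces, $$\Phi:\ \mathrm{Hom}_{H_c}\bigl(\Delta_c(S(\mathfrak h)_W),\ \nabla_c(S(\mathfrak h^*)_W\otimes\det\nolimits_{\mathfrak h}^{-1}\langle N\rangle)\bigr)\ \xrightarrow{\ \sim\ }\ \mathrm{Hom}_{\mathbb CW}\bigl(S(\mathfrak h^*)_W,\ \mathrm{Har}^*\bigr).$$ It is given as follows: if $F$ is a homomorphism on the left, $g\in\mathrm{Har}$, and $a\in S(\mathfrak h^*)$ is such that the element $F(1\otimes 1)$ of $\mathrm{Hom}_{S(\mathfrak h^*)\rtimes W}(H_c,M)$ takes the value $\bar a\otimes 1$ at $g\in S(\mathfrak h)\to H_c$, then $$\Phi(F)(\bar b)(g)=\langle ab,J\rangle\qquad\text{for all } b\in S(\mathfrak h^*).$$ -/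

import Mathlib

namespace Cherednik

noncomputable section

/-! ### Group actions on tensor and symmetric algebras -/

section Actions

variable {h V : Type*} [AddCommGroup h] [Module ℂ h] {W : Subgroup (h ≃ₗ[ℂ] h)}
  [AddCommGroup V] [Module ℂ V] [DistribMulAction W V] [SMulCommClass W ℂ V]

/-- The linear map `v ↦ g • v`. -/
def actLin (g : W) : V →ₗ[ℂ] V := DistribSMul.toLinearMap ℂ V g

@[simp] theorem actLin_apply (g : W) (v : V) : actLin g v = g • v := rfl

/-- The algebra endomorphism of `T(V)` induced by `g`. -/
def tensorMap (g : W) : TensorAlgebra ℂ V →ₐ[ℂ] TensorAlgebra ℂ V :=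
  TensorAlgebra.lift ℂ (TensorAlgebra.ι ℂ ∘ₗ actLin g)

@[simp] theorem tensorMap_ι (g : W) (v : V) :
    tensorMap g (TensorAlgebra.ι ℂ v) = TensorAlgebra.ι ℂ (g • v) := by
  simp [tensorMap]

/-- The group `W` acts on `T(V)` by algebra automorphisms extending its action on `V`. -/
instance tensorAction : MulSemiringAction W (TensorAlgebra ℂ V) where
  smul g t := tensorMap g t
  one_smul t := by
    change tensorMap (1 : W) t = t
    have : tensorMap (1 : W) = AlgHom.id ℂ (TensorAlgebra ℂ V) := by
      ext v; simp
    rw [this]; rfl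
  mul_smul a b t := by
    change tensorMap (a * b) t = tensorMap a (tensorMap b t)
    have : tensorMap (a * b) = (tensorMap a).comp (tensorMap (V := V) b) := by
      ext v; simp [mul_smul]
    rw [this]; rfl
  smul_zero g := map_zero (tensorMap g)
  smul_add g := map_add (tensorMap g)
  smul_one g := map_one (tensorMap g)
  smul_mul g := map_mul (tensorMap g)

theorem tensor_smul_def (g : W) (t : TensorAlgebra ℂ V) : g • t = tensorMap g t := rfl

@[simp] theorem tensor_smul_ι (g : W) (v : V) :
    g • TensorAlgebra.ι ℂ v = TensorAlgebra.ι ℂ (g • v) := tensorMap_ι g v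

instance tensorActionComm : SMulCommClass W ℂ (TensorAlgebra ℂ V) where
  smul_comm g z t := map_smul (tensorMap g) z t

/-- The algebra endomorphism of `S(V)` induced by `g`. -/
def symMap (g : W) : SymmetricAlgebra ℂ V →ₐ[ℂ] SymmetricAlgebra ℂ V :=
  SymmetricAlgebra.lift (SymmetricAlgebra.ι ℂ V ∘ₗ actLin g)

@[simp] theorem symMap_ι (g : W) (v : V) :
    symMap g (SymmetricAlgebra.ι ℂ V v) = SymmetricAlgebra.ι ℂ V (g • v) := by
  simp [symMap]

/-- The group `W` acts on `S(V)` by algebra automorphisms extending its action on `V`. -/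
instance symAction : MulSemiringAction W (SymmetricAlgebra ℂ V) where
  smul g t := symMap g t
  one_smul t := by
    change symMap (1 : W) t = t
    have : symMap (1 : W) = AlgHom.id ℂ (SymmetricAlgebra ℂ V) := by
      ext v; simp
    rw [this]; rfl
  mul_smul a b t := by
    change symMap (a * b) t = symMap a (symMap b t)
    have : symMap (a * b) = (symMap a).comp (symMap (V := V) b) := by
      ext v; simp [mul_smul]
    rw [this]; rfl
  smul_zero g := map_zero (symMap g)
  smul_add g := map_add (symMap g)
  smul_one g := map_one (symMap g)
  smul_mul g := map_mul (symMap g)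

theorem sym_smul_def (g : W) (t : SymmetricAlgebra ℂ V) : g • t = symMap g t := rfl

@[simp] theorem sym_smul_ι (g : W) (v : V) :
    g • SymmetricAlgebra.ι ℂ V v = SymmetricAlgebra.ι ℂ V (g • v) := symMap_ι g v

instance symActionComm : SMulCommClass W ℂ (SymmetricAlgebra ℂ V) where
  smul_comm g z t := map_smul (symMap g) z t

end Actions

/-! ### Algebra maps from a symmetric algebra to a noncommutative algebra -/

section SymLift

variable {V B : Type*} [AddCommGroup V] [Module ℂ V] [Ring B] [Algebra ℂ B]

theorem symRingCon_le_ker {f : V →ₗ[ℂ] B} (hf : ∀ u v, f u * f v = f v * f u) :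
    TensorAlgebra.symRingCon ℂ V ≤ RingCon.ker (TensorAlgebra.lift ℂ f).toRingHom := by
  refine RingCon.ringConGen_le.2 fun x y h' => ?_
  induction h' with | mul_comm x y
  rw [RingCon.ker_apply]
  simp [hf x y]

/-- The algebra map `S(V) → B` extending a linear map `V → B` with commuting values. -/
def symLift (f : V →ₗ[ℂ] B) (hf : ∀ u v, f u * f v = f v * f u) :
    SymmetricAlgebra ℂ V →ₐ[ℂ] B :=
  RingCon.liftₐ _ (TensorAlgebra.lift ℂ f) (symRingCon_le_ker hf)

@[simp] theorem symLift_ι (f : V →ₗ[ℂ] B) (hf : ∀ u v, f u * f v = f v * f u) (v : V) :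
    symLift f hf (SymmetricAlgebra.ι ℂ V v) = f v := by
  simp [symLift, SymmetricAlgebra.ι]

end SymLift

/-! ### Skew group algebras `S(V) ⋊ W` -/

section Smash

variable {h : Type*} [AddCommGroup h] [Module ℂ h] (W : Subgroup (h ≃ₗ[ℂ] h))
  (V : Type*) [AddCommGroup V] [Module ℂ V] [DistribMulAction W V] [SMulCommClass W ℂ V]

/-- The skew group algebra `S(V) ⋊ W`, with product `(f ⊗ w)(f' ⊗ w') = f (w • f') ⊗ w w'`;
the element `f ⊗ w` is `SkewMonoidAlgebra.single w f`. -/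
abbrev Smash := SkewMonoidAlgebra (SymmetricAlgebra ℂ V) W

/-- The natural representation of `W` on `S(V)`. -/
def symRep : Representation ℂ W (SymmetricAlgebra ℂ V) :=
  Representation.ofDistribMulAction ℂ W (SymmetricAlgebra ℂ V)

@[simp] theorem symRep_apply (g : W) (f : SymmetricAlgebra ℂ V) : symRep W V g f = g • f := rfl

/-- The ideal of `S(V)` generated by the `W`-invariants with zero constant term, that is, by the
homogeneous invariants of nonzero degree. -/
def coinvIdeal : Ideal (SymmetricAlgebra ℂ V) :=
  Ideal.span {f | (∀ g : W, g • f = f) ∧ SymmetricAlgebra.algebraMapInv f = 0}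

/-- The coinvariant algebra `S(V)_G`. -/
abbrev Coinv := SymmetricAlgebra ℂ V ⧸ coinvIdeal W V

theorem smul_mem_coinvIdeal (g : W) {f : SymmetricAlgebra ℂ V} (hf : f ∈ coinvIdeal W V) :
    g • f ∈ coinvIdeal W V := by
  refine Submodule.span_induction (p := fun f _ => g • f ∈ coinvIdeal W V) ?_ ?_ ?_ ?_ hf
  · intro x hx
    rw [hx.1 g]
    exact Ideal.subset_span hx
  · rw [smul_zero]; exact Ideal.zero_mem _
  · intro x y _ _ hx hy
    rw [smul_add]; exact Ideal.add_mem _ hx hy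
  · intro a x _ hx
    rw [smul_eq_mul, smul_mul']; exact Ideal.mul_mem_left _ _ hx

/-- The representation of `W` on the coinvariant algebra. -/
def coinvRep : Representation ℂ W (Coinv W V) :=
  (symRep W V).quotient ((coinvIdeal W V).restrictScalars ℂ)
    fun g _ hf => smul_mem_coinvIdeal W V g hf

theorem coinvRep_mk (g : W) (f : SymmetricAlgebra ℂ V) :
    coinvRep W V g (Ideal.Quotient.mk (coinvIdeal W V) f)
      = Ideal.Quotient.mk (coinvIdeal W V) (g • f) := rfl

theorem coinvRep_smul (g : W) (f : SymmetricAlgebra ℂ V) (m : Coinv W V) :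
    coinvRep W V g (f • m) = (g • f) • coinvRep W V g m := by
  obtain ⟨m, rfl⟩ := Ideal.Quotient.mk_surjective m
  have h1 : f • (Ideal.Quotient.mk (coinvIdeal W V) m)
      = Ideal.Quotient.mk (coinvIdeal W V) (f * m) := rfl
  rw [h1, coinvRep_mk, coinvRep_mk, smul_mul']
  rfl

/-- The twist of a representation by a linear character: `ρ ⊗ χ`, with `M ⊗ ℂ` identified with
`M` through `m ⊗ 1 ↔ m`. -/
def twist {Γ M : Type*} [Group Γ] [AddCommGroup M] [Module ℂ M] (ρ : Representation ℂ Γ M)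
    (χ : Γ →* ℂˣ) : Representation ℂ Γ M where
  toFun g := (χ g : ℂ) • ρ g
  map_one' := by simp
  map_mul' a b := by
    ext m
    simp [mul_smul, smul_comm (χ a : ℂ)]

variable {W V}

/-- A module over `S(V) ⋊ W` (given by its structure map) from an `S(V)`-module with a compatible
`W`-action: `(f ⊗ w) . m = f . (w . m)`. -/
def smashAction {M : Type*} [AddCommGroup M] [Module ℂ M] [Module (SymmetricAlgebra ℂ V) M]
    [IsScalarTower ℂ (SymmetricAlgebra ℂ V) M] (ρ : Representation ℂ W M)
    (hρ : ∀ (g : W) (f : SymmetricAlgebra ℂ V) (m : M), ρ g (f • m) = (g • f) • ρ g m) :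
    Smash W V →ₐ[ℂ] Module.End ℂ M :=
  SkewMonoidAlgebra.liftNCAlgHom (Algebra.lsmul ℂ ℂ M) ρ (by
    intro f g
    ext m
    exact (hρ g f m).symm)

theorem smashAction_single {M : Type*} [AddCommGroup M] [Module ℂ M]
    [Module (SymmetricAlgebra ℂ V) M] [IsScalarTower ℂ (SymmetricAlgebra ℂ V) M]
    (ρ : Representation ℂ W M)
    (hρ : ∀ (g : W) (f : SymmetricAlgebra ℂ V) (m : M), ρ g (f • m) = (g • f) • ρ g m)
    (w : W) (f : SymmetricAlgebra ℂ V) (m : M) :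
    smashAction ρ hρ (SkewMonoidAlgebra.single w f) m = f • ρ w m := by
  have h1 : smashAction ρ hρ (SkewMonoidAlgebra.single w f)
      = Algebra.lsmul ℂ ℂ M f * ρ w :=
    SkewMonoidAlgebra.liftNC_single _ _ _ _
  rw [h1]
  rfl

variable (W V)

/-- The `S(V) ⋊ W`-module `S(V)_G`. -/
def coinvAction : Smash W V →ₐ[ℂ] Module.End ℂ (Coinv W V) :=
  smashAction (coinvRep W V) (coinvRep_smul W V)

/-- The `S(V) ⋊ W`-module `S(V)_G ⊗ χ`: here `S(V)` acts on the first factor only and `W` acts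
diagonally. -/
def coinvTwistAction (χ : W →* ℂˣ) : Smash W V →ₐ[ℂ] Module.End ℂ (Coinv W V) :=
  smashAction (twist (coinvRep W V) χ) (by
    intro g f m
    change (χ g : ℂ) • coinvRep W V g (f • m) = (g • f) • ((χ g : ℂ) • coinvRep W V g m)
    rw [coinvRep_smul, smul_comm])

end Smash

/-! ### Complex reflection groups -/

section Reflections

variable {h : Type*} [AddCommGroup h] [Module ℂ h]

/-- The subspace of vectors fixed by `s`. -/
def fixedSpace (s : h ≃ₗ[ℂ] h) : Submodule ℂ h :=
  LinearMap.ker ((s : h →ₗ[ℂ] h) - LinearMap.id)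

/-- A pseudo-reflection: a non-identity element of finite order that fixes a hyperplane
pointwise. -/
def IsPseudoReflection (s : h ≃ₗ[ℂ] h) : Prop :=
  s ≠ 1 ∧ IsOfFinOrder s ∧ Module.finrank ℂ (fixedSpace s) + 1 = Module.finrank ℂ h

/-- A complex reflection group: a finite group generated by pseudo-reflections. -/
def IsComplexReflectionGroup (W : Subgroup (h ≃ₗ[ℂ] h)) : Prop :=
  Finite W ∧ Subgroup.closure {s | s ∈ W ∧ IsPseudoReflection s} = W

variable (W : Subgroup (h ≃ₗ[ℂ] h))

/-- The type of pseudo-reflections in `W`. -/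
abbrev Refl := {s : W // IsPseudoReflection (s : h ≃ₗ[ℂ] h)}

/-- The type of reflection hyperplanes of `W`. -/
abbrev Hyperplane := {H : Submodule ℂ h // ∃ s : Refl W, fixedSpace (s.1 : h ≃ₗ[ℂ] h) = H}

variable {W}

/-- The hyperplane of a pseudo-reflection. -/
def Refl.hyp (s : Refl W) : Hyperplane W := ⟨fixedSpace (s.1 : h ≃ₗ[ℂ] h), s, rfl⟩

/-- The subgroup `W_H` of the elements of `W` that fix the hyperplane `H` pointwise. -/
def Hyperplane.stab (H : Hyperplane W) : Subgroup W where
  carrier := {w | ∀ y ∈ H.1, w • y = y}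
  one_mem' y _ := one_smul _ y
  mul_mem' := by
    intro a b ha hb y hy
    rw [mul_smul, hb y hy, ha y hy]
  inv_mem' := by
    intro a ha y hy
    rw [inv_smul_eq_iff, ha y hy]

/-- The order `e_H` of `W_H`. -/
def Hyperplane.order (H : Hyperplane W) : ℕ := Nat.card H.stab

variable (W)

/-- A choice, for every reflection hyperplane `H`, of a vector `v_H` spanning the `W_H`-stable
line complementary to `H`, and of the linear form `α_H` with kernel `H` and `α_H (v_H) = 1`.
(The line and, given `v_H`, the form `α_H` are unique.) -/
structure Roots where
  v : Hyperplane W → h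
  α : Hyperplane W → Module.Dual ℂ h
  smul_v : ∀ (H : Hyperplane W), ∀ w ∈ H.stab, w • v H ∈ Submodule.span ℂ {v H}
  ker_α : ∀ H : Hyperplane W, LinearMap.ker (α H) = H.1
  α_v : ∀ H : Hyperplane W, α H (v H) = 1

/-- The contragredient action of `W` on the dual space: `(w • x)(y) = x (w⁻¹ • y)`. -/
instance dualAction : DistribMulAction W (Module.Dual ℂ h) where
  smul w x := x ∘ₗ actLin w⁻¹
  one_smul x := by
    ext y
    change x ((1 : W)⁻¹ • y) = x y
    rw [inv_one, one_smul]
  mul_smul a b x := by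
    ext y
    change x ((a * b)⁻¹ • y) = x (b⁻¹ • a⁻¹ • y)
    rw [mul_inv_rev, mul_smul]
  smul_zero _ := rfl
  smul_add _ _ _ := rfl

@[simp] theorem dual_smul_apply (w : W) (x : Module.Dual ℂ h) (y : h) :
    (w • x) y = x (w⁻¹ • y) := rfl

instance dualActionComm : SMulCommClass W ℂ (Module.Dual ℂ h) where
  smul_comm _ _ _ := rfl

/-- The character `det⁻¹` of `W`, where `det w` is the determinant of `w` on `h`. -/
def detInv : W →* ℂˣ where
  toFun w := (LinearEquiv.det (w : h ≃ₗ[ℂ] h))⁻¹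
  map_one' := by simp
  map_mul' a b := by simp [mul_comm]

end Reflections

/-! ### The rational Cherednik algebra -/

section Algebra

variable {h : Type*} [AddCommGroup h] [Module ℂ h] {W : Subgroup (h ≃ₗ[ℂ] h)}

variable (W) in
/-- The algebra `T(h ⊕ h*) ⋊ W`. -/
abbrev TSmash := SkewMonoidAlgebra (TensorAlgebra ℂ (h × Module.Dual ℂ h)) W

/-- The element `ξ ∈ h` of `T(h ⊕ h*) ⋊ W`. -/
def tY (ξ : h) : TSmash W := SkewMonoidAlgebra.single 1 (TensorAlgebra.ι ℂ (ξ, 0))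

/-- The element `x ∈ h*` of `T(h ⊕ h*) ⋊ W`. -/
def tX (x : Module.Dual ℂ h) : TSmash W := SkewMonoidAlgebra.single 1 (TensorAlgebra.ι ℂ (0, x))

/-- The element `w ∈ W` of `T(h ⊕ h*) ⋊ W`. -/
def tW (w : W) : TSmash W := SkewMonoidAlgebra.single w 1

/-- The defining relations of the rational Cherednik algebra: `[ξ₁, ξ₂] = 0`, `[x₁, x₂] = 0` and
`[ξ, x] = (ξ, x) + ∑ₛ c(s) (ξ, αₛ) (vₛ, x) s`, the sum being over the pseudo-reflections of `W`. -/
inductive Rel (R : Roots W) (c : Refl W → ℂ) : TSmash W → TSmash W → Prop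
  | yy (ξ₁ ξ₂ : h) : Rel R c (tY ξ₁ * tY ξ₂ - tY ξ₂ * tY ξ₁) 0
  | xx (x₁ x₂ : Module.Dual ℂ h) : Rel R c (tX x₁ * tX x₂ - tX x₂ * tX x₁) 0
  | yx (ξ : h) (x : Module.Dual ℂ h) : Rel R c (tY ξ * tX x - tX x * tY ξ)
      (algebraMap ℂ (TSmash W) (x ξ)
        + ∑ᶠ s : Refl W, (c s * R.α s.hyp ξ * x (R.v s.hyp)) • tW s.1)

/-- The rational Cherednik algebra `H_c(W, h)`. -/
def RCA (R : Roots W) (c : Refl W → ℂ) := RingQuot (Rel R c)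

instance (R : Roots W) (c : Refl W → ℂ) : Ring (RCA R c) :=
  inferInstanceAs (Ring (RingQuot (Rel R c)))

instance (R : Roots W) (c : Refl W → ℂ) : Algebra ℂ (RCA R c) :=
  inferInstanceAs (Algebra ℂ (RingQuot (Rel R c)))

variable (R : Roots W) (c : Refl W → ℂ)

/-- The quotient map `T(h ⊕ h*) ⋊ W → H_c(W, h)`. -/
def toRCA : TSmash W →ₐ[ℂ] RCA R c := RingQuot.mkAlgHom ℂ (Rel R c)

theorem toRCA_rel {a b : TSmash W} (hab : Rel R c a b) : toRCA R c a = toRCA R c b :=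
  RingQuot.mkAlgHom_rel ℂ hab

theorem toRCA_surjective : Function.Surjective (toRCA R c) :=
  RingQuot.mkAlgHom_surjective ℂ (Rel R c)

/-- The inclusion of `h` in `T(h ⊕ h*) ⋊ W`, as a linear map. -/
def tYLin : h →ₗ[ℂ] TSmash W where
  toFun := tY
  map_add' a b := by
    simp only [tY]
    rw [← SkewMonoidAlgebra.single_add, ← map_add]; simp
  map_smul' z a := by
    simp only [tY, RingHom.id_apply]
    rw [SkewMonoidAlgebra.smul_single, ← map_smul]; simp

/-- The inclusion of `h*` in `T(h ⊕ h*) ⋊ W`, as a linear map. -/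
def tXLin : Module.Dual ℂ h →ₗ[ℂ] TSmash W where
  toFun := tX
  map_add' a b := by
    simp only [tX]
    rw [← SkewMonoidAlgebra.single_add, ← map_add]; simp
  map_smul' z a := by
    simp only [tX, RingHom.id_apply]
    rw [SkewMonoidAlgebra.smul_single, ← map_smul]; simp

/-- The map `h → H_c(W, h)`. -/
def yLin : h →ₗ[ℂ] RCA R c := (toRCA R c).toLinearMap ∘ₗ tYLin

/-- The map `h* → H_c(W, h)`. -/
def xLin : Module.Dual ℂ h →ₗ[ℂ] RCA R c := (toRCA R c).toLinearMap ∘ₗ tXLin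

/-- The map `W → H_c(W, h)`. -/
def wHom : W →* RCA R c :=
  ((toRCA R c : TSmash W →ₐ[ℂ] RCA R c) : TSmash W →* RCA R c).comp
    (SkewMonoidAlgebra.of (TensorAlgebra ℂ (h × Module.Dual ℂ h)) W)

theorem yLin_comm (a b : h) : yLin R c a * yLin R c b = yLin R c b * yLin R c a := by
  have := toRCA_rel R c (Rel.yy a b)
  rw [map_sub, map_mul, map_mul, map_zero, sub_eq_zero] at this
  exact this

theorem xLin_comm (a b : Module.Dual ℂ h) :
    xLin R c a * xLin R c b = xLin R c b * xLin R c a := by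
  have := toRCA_rel R c (Rel.xx a b)
  rw [map_sub, map_mul, map_mul, map_zero, sub_eq_zero] at this
  exact this

theorem yLin_xLin (ξ : h) (x : Module.Dual ℂ h) :
    yLin R c ξ * xLin R c x = xLin R c x * yLin R c ξ
      + toRCA R c (algebraMap ℂ (TSmash W) (x ξ)
        + ∑ᶠ s : Refl W, (c s * R.α s.hyp ξ * x (R.v s.hyp)) • tW s.1) := by
  have := toRCA_rel R c (Rel.yx ξ x)
  rw [map_sub, map_mul, map_mul, sub_eq_iff_eq_add'] at this
  exact this

theorem wHom_yLin (w : W) (ξ : h) :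
    wHom R c w * yLin R c ξ = yLin R c (w • ξ) * wHom R c w := by
  change toRCA R c (SkewMonoidAlgebra.single w 1) * toRCA R c (tY ξ)
    = toRCA R c (tY (w • ξ)) * toRCA R c (SkewMonoidAlgebra.single w 1)
  rw [← map_mul, ← map_mul, tY, tY, SkewMonoidAlgebra.single_mul_single,
    SkewMonoidAlgebra.single_mul_single]
  simp

theorem wHom_xLin (w : W) (x : Module.Dual ℂ h) :
    wHom R c w * xLin R c x = xLin R c (w • x) * wHom R c w := by
  change toRCA R c (SkewMonoidAlgebra.single w 1) * toRCA R c (tX x)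
    = toRCA R c (tX (w • x)) * toRCA R c (SkewMonoidAlgebra.single w 1)
  rw [← map_mul, ← map_mul, tX, tX, SkewMonoidAlgebra.single_mul_single,
    SkewMonoidAlgebra.single_mul_single]
  simp

/-- The algebra map `S(h) → H_c(W, h)`. -/
def symY : SymmetricAlgebra ℂ h →ₐ[ℂ] RCA R c := symLift (yLin R c) (yLin_comm R c)

/-- The algebra map `S(h*) → H_c(W, h)`. -/
def symX : SymmetricAlgebra ℂ (Module.Dual ℂ h) →ₐ[ℂ] RCA R c :=
  symLift (xLin R c) (xLin_comm R c)

theorem symY_smul (w : W) (f : SymmetricAlgebra ℂ h) :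
    symY R c (w • f) * wHom R c w = wHom R c w * symY R c f := by
  induction f using SymmetricAlgebra.induction with
  | algebraMap r =>
    rw [smul_algebraMap, AlgHom.commutes]; exact Algebra.commutes _ _
  | ι v => rw [sym_smul_ι]; simp [symY, wHom_yLin]
  | mul a b ha hb => rw [smul_mul', map_mul, mul_assoc, hb, ← mul_assoc, ha, map_mul, mul_assoc]
  | add a b ha hb => rw [smul_add, map_add, add_mul, ha, hb, map_add, mul_add]

theorem symX_smul (w : W) (f : SymmetricAlgebra ℂ (Module.Dual ℂ h)) :
    symX R c (w • f) * wHom R c w = wHom R c w * symX R c f := by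
  induction f using SymmetricAlgebra.induction with
  | algebraMap r =>
    rw [smul_algebraMap, AlgHom.commutes]; exact Algebra.commutes _ _
  | ι v => simp [symX, wHom_xLin]
  | mul a b ha hb => rw [smul_mul', map_mul, mul_assoc, hb, ← mul_assoc, ha, map_mul, mul_assoc]
  | add a b ha hb => rw [smul_add, map_add, add_mul, ha, hb, map_add, mul_add]

/-- The algebra map `S(h) ⋊ W → H_c(W, h)`, `f ⊗ w ↦ f w`. -/
def smashY : Smash W h →ₐ[ℂ] RCA R c :=
  SkewMonoidAlgebra.liftNCAlgHom (symY R c) (wHom R c) (symY_smul R c _ _)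

/-- The algebra map `S(h*) ⋊ W → H_c(W, h)`, `f ⊗ w ↦ f w`. -/
def smashX : Smash W (Module.Dual ℂ h) →ₐ[ℂ] RCA R c :=
  SkewMonoidAlgebra.liftNCAlgHom (symX R c) (wHom R c) (symX_smul R c _ _)

/-- Induction on elements of `H_c(W, h)`: it is generated by `h`, `h*` and `W`. -/
theorem RCA.induction {p : RCA R c → Prop} (scalar : ∀ z : ℂ, p (algebraMap ℂ _ z))
    (y : ∀ ξ, p (yLin R c ξ)) (x : ∀ u, p (xLin R c u)) (w : ∀ g, p (wHom R c g))
    (add : ∀ a b, p a → p b → p (a + b)) (mul : ∀ a b, p a → p b → p (a * b))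
    (a : RCA R c) : p a := by
  obtain ⟨t, rfl⟩ := toRCA_surjective R c a
  induction t using SkewMonoidAlgebra.induction_on with
  | zero => simpa using scalar 0
  | add f g hf hg => rw [map_add]; exact add _ _ hf hg
  | single g u =>
    have : (SkewMonoidAlgebra.single g u : TSmash W)
        = SkewMonoidAlgebra.single 1 u * SkewMonoidAlgebra.single g 1 := by
      rw [SkewMonoidAlgebra.single_mul_single]; simp
    rw [this, map_mul]
    refine mul _ _ ?_ (w g)
    clear this
    induction u using TensorAlgebra.induction with
    | algebraMap r =>
      convert scalar r using 1
      exact (toRCA R c).commutes r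
    | ι v =>
      have hv : toRCA R c (SkewMonoidAlgebra.single 1 (TensorAlgebra.ι ℂ v))
          = yLin R c v.1 + xLin R c v.2 := by
        change _ = toRCA R c (tY v.1) + toRCA R c (tX v.2)
        rw [← map_add, tY, tX, ← SkewMonoidAlgebra.single_add, ← map_add]
        simp
      rw [hv]
      exact add _ _ (y _) (x _)
    | mul a b ha hb =>
      have hab : (SkewMonoidAlgebra.single 1 (a * b) : TSmash W)
          = SkewMonoidAlgebra.single 1 a * SkewMonoidAlgebra.single 1 b := by
        rw [SkewMonoidAlgebra.single_mul_single]; simp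
      rw [hab, map_mul]
      exact mul _ _ ha
        hb
    | add a b ha hb =>
      rw [SkewMonoidAlgebra.single_add, map_add]
      exact add _ _ ha
        hb

end Algebra

/-! ### Standard and costandard modules -/

section Modules

open TensorProduct

variable {h : Type*} [AddCommGroup h] [Module ℂ h] {W : Subgroup (h ≃ₗ[ℂ] h)}
  (R : Roots W) (c : Refl W → ℂ)

section Std

variable {M : Type*} [AddCommGroup M] [Module ℂ M] (τ : Smash W h →ₐ[ℂ] Module.End ℂ M)

/-- The relations `a b ⊗ m = a ⊗ b m`, for `a ∈ H_c`, `b ∈ S(h) ⋊ W` and `m ∈ M`. -/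
def stdRel : Submodule (RCA R c) (RCA R c ⊗[ℂ] M) :=
  Submodule.span (RCA R c)
    {t | ∃ (a : RCA R c) (b : Smash W h) (m : M), t = (a * smashY R c b) ⊗ₜ[ℂ] m - a ⊗ₜ[ℂ] τ b m}

/-- The standard module `Δ_c(M) = H_c ⊗_{S(h) ⋊ W} M` of an `S(h) ⋊ W`-module `M`. -/
def Std := (RCA R c ⊗[ℂ] M) ⧸ stdRel R c τ

instance : AddCommGroup (Std R c τ) :=
  inferInstanceAs (AddCommGroup ((RCA R c ⊗[ℂ] M) ⧸ stdRel R c τ))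

instance : Module (RCA R c) (Std R c τ) :=
  inferInstanceAs (Module (RCA R c) ((RCA R c ⊗[ℂ] M) ⧸ stdRel R c τ))

/-- The element `a ⊗ m` of `Δ_c(M)`. -/
def Std.mk (a : RCA R c) (m : M) : Std R c τ :=
  (Submodule.Quotient.mk (a ⊗ₜ[ℂ] m) : (RCA R c ⊗[ℂ] M) ⧸ stdRel R c τ)

end Std

section LocNil

variable {N : Type*} [AddCommGroup N] [Module (RCA R c) N]

/-- The elements of an `H_c`-module that are killed by `h ^ r`. -/
def killed (N : Type*) [AddCommGroup N] [Module (RCA R c) N] (r : ℕ) : AddSubgroup N where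
  carrier := {n | ∀ l : List h, l.length = r → (l.map (yLin R c)).prod • n = 0}
  zero_mem' _ _ := smul_zero _
  add_mem' := by
    intro a b ha hb l hl
    rw [smul_add, ha l hl, hb l hl, add_zero]
  neg_mem' := by
    intro a ha l hl
    rw [smul_neg, ha l hl, neg_zero]

theorem mem_killed {r : ℕ} {n : N} : n ∈ killed R c N r ↔
    ∀ l : List h, l.length = r → (l.map (yLin R c)).prod • n = 0 := Iff.rfl

theorem mem_killed_succ {r : ℕ} {n : N} : n ∈ killed R c N (r + 1) ↔
    ∀ ξ : h, yLin R c ξ • n ∈ killed R c N r := by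
  simp only [mem_killed]
  constructor
  · intro H ξ l hl
    have := H (l ++ [ξ]) (by simp [hl])
    simpa [mul_smul] using this
  · intro H l hl
    obtain ⟨l', ξ, rfl⟩ : ∃ l' ξ, l = l' ++ [ξ] := by
      rcases List.eq_nil_or_concat l with rfl | ⟨l', ξ, rfl⟩
      · simp at hl
      · exact ⟨l', ξ, by simp⟩
    have := H ξ l' (by simpa using hl)
    simpa [mul_smul] using this

theorem killed_mono_succ (r : ℕ) : killed R c N r ≤ killed R c N (r + 1) := by
  intro n hn l hl
  match l, hl with
  | ξ :: l, hl =>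
    have := hn l (by simpa using hl)
    simp [mul_smul, this]

theorem killed_mono {r s : ℕ} (hrs : r ≤ s) : killed R c N r ≤ killed R c N s :=
  monotone_nat_of_le_succ (killed_mono_succ R c) hrs

theorem scalar_smul_killed (z : ℂ) {r : ℕ} {n : N} (hn : n ∈ killed R c N r) :
    algebraMap ℂ (RCA R c) z • n ∈ killed R c N r := by
  intro l hl
  rw [← mul_smul, ← Algebra.commutes, mul_smul, hn l hl, smul_zero]

theorem wHom_smul_killed (w : W) {r : ℕ} {n : N} (hn : n ∈ killed R c N r) :
    wHom R c w • n ∈ killed R c N r := by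
  induction r generalizing n with
  | zero =>
    have h0 : n = 0 := by simpa using hn [] rfl
    rw [h0, smul_zero]; exact zero_mem _
  | succ r ih =>
    rw [mem_killed_succ] at hn ⊢
    intro ξ
    have : yLin R c ξ * wHom R c w = wHom R c w * yLin R c (w⁻¹ • ξ) := by
      rw [wHom_yLin, smul_inv_smul]
    rw [← mul_smul, this, mul_smul]
    exact ih (hn _)

theorem xLin_smul_killed (x : Module.Dual ℂ h) {r : ℕ} {n : N} (hn : n ∈ killed R c N r) :
    xLin R c x • n ∈ killed R c N (r + 1) := by
  induction r generalizing n with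
  | zero =>
    have h0 : n = 0 := by simpa using hn [] rfl
    rw [h0, smul_zero]; exact zero_mem _
  | succ r ih =>
    rw [mem_killed_succ]
    intro ξ
    rw [← mul_smul, yLin_xLin, add_smul, mul_smul]
    refine add_mem (ih ((mem_killed_succ R c).1 hn ξ)) ?_
    rw [map_add, add_smul, AlgHom.commutes]
    refine add_mem (scalar_smul_killed R c _ hn) ?_
    refine finsum_induction (fun t => toRCA R c t • n ∈ killed R c N (r + 1)) ?_ ?_ ?_
    · rw [map_zero, zero_smul]; exact zero_mem _
    · intro a b ha hb
      rw [map_add, add_smul]; exact add_mem ha hb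
    · intro s
      rw [map_smul, Algebra.smul_def, mul_smul]
      exact scalar_smul_killed R c _ (wHom_smul_killed R c s.1 hn)

theorem smul_killed (a : RCA R c) {r : ℕ} {n : N} (hn : n ∈ killed R c N r) :
    ∃ s, a • n ∈ killed R c N s := by
  induction a using RCA.induction generalizing r n with
  | scalar z => exact ⟨r, scalar_smul_killed R c z hn⟩
  | y ξ => exact ⟨r, (mem_killed_succ R c).1 (killed_mono_succ R c r hn) ξ⟩
  | x u => exact ⟨r + 1, xLin_smul_killed R c u hn⟩
  | w g => exact ⟨r, wHom_smul_killed R c g hn⟩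
  | add a b ha hb =>
    obtain ⟨s, hs⟩ := ha hn
    obtain ⟨t, ht⟩ := hb hn
    refine ⟨max s t, ?_⟩
    rw [add_smul]
    exact add_mem (killed_mono R c (le_max_left _ _) hs) (killed_mono R c (le_max_right _ _) ht)
  | mul a b ha hb =>
    obtain ⟨s, hs⟩ := hb hn
    rw [mul_smul]
    exact ha hs

/-- The submodule of `h`-nilpotent elements of an `H_c`-module: those killed by some `h ^ r`. -/
def locNil (N : Type*) [AddCommGroup N] [Module (RCA R c) N] : Submodule (RCA R c) N where
  carrier := {n | ∃ r : ℕ, n ∈ killed R c N r}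
  zero_mem' := ⟨0, zero_mem _⟩
  add_mem' := by
    rintro a b ⟨s, hs⟩ ⟨t, ht⟩
    exact ⟨max s t,
      add_mem (killed_mono R c (le_max_left _ _) hs) (killed_mono R c (le_max_right _ _) ht)⟩
  smul_mem' := by
    rintro a n ⟨r, hr⟩
    exact smul_killed R c a hr

end LocNil

section Costd

variable {M : Type*} [AddCommGroup M] [Module ℂ M]
  (τ : Smash W (Module.Dual ℂ h) →ₐ[ℂ] Module.End ℂ M)

/-- The space `Hom_{S(h*) ⋊ W}(H_c, M)`. -/
def Coind : Submodule ℂ (RCA R c →ₗ[ℂ] M) where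
  carrier := {f | ∀ (b : Smash W (Module.Dual ℂ h)) (a : RCA R c),
    f (smashX R c b * a) = τ b (f a)}
  zero_mem' _ _ := by simp
  add_mem' := by
    intro f g hf hg b a
    rw [LinearMap.add_apply, LinearMap.add_apply, hf, hg, map_add]
  smul_mem' := by
    intro z f hf b a
    rw [LinearMap.smul_apply, LinearMap.smul_apply, hf, map_smul]

/-- `H_c` acts on `Hom_{S(h*) ⋊ W}(H_c, M)` by `(a • f)(b) = f (b a)`. -/
instance : Module (RCA R c) (Coind R c τ) where
  smul a f := ⟨f.1 ∘ₗ LinearMap.mulRight ℂ a, by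
    intro b a'
    change f.1 (smashX R c b * a' * a) = τ b (f.1 (a' * a))
    rw [mul_assoc]
    exact f.2 b (a' * a)⟩
  one_smul f := by
    apply Subtype.ext; ext a
    change f.1 (a * 1) = f.1 a
    rw [mul_one]
  mul_smul a b f := by
    apply Subtype.ext; ext a'
    change f.1 (a' * (a * b)) = f.1 (a' * a * b)
    rw [mul_assoc]
  smul_zero a := rfl
  smul_add a f g := rfl
  add_smul a b f := by
    apply Subtype.ext; ext a'
    change f.1 (a' * (a + b)) = f.1 (a' * a) + f.1 (a' * b)
    rw [mul_add, map_add]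
  zero_smul f := by
    apply Subtype.ext; ext a'
    change f.1 (a' * 0) = 0
    rw [mul_zero, map_zero]

theorem Coind.smul_apply (a : RCA R c) (f : Coind R c τ) (b : RCA R c) :
    (a • f).1 b = f.1 (b * a) := rfl

instance : IsScalarTower ℂ (RCA R c) (Coind R c τ) where
  smul_assoc z a f := by
    apply Subtype.ext; ext b
    change f.1 (b * (z • a)) = z • f.1 (b * a)
    rw [mul_smul_comm, map_smul]

instance : SMulCommClass (RCA R c) ℂ (Coind R c τ) where
  smul_comm _ _ _ := rfl

/-- The costandard module `∇_c(M)` of an `S(h*) ⋊ W`-module `M`: the `h`-nilpotent elements of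
`Hom_{S(h*) ⋊ W}(H_c, M)`. -/
abbrev Costd : Submodule (RCA R c) (Coind R c τ) := locNil R c (Coind R c τ)

end Costd

/-- The standard module `Δ_c(S(h)_W)`. -/
abbrev DeltaCoinv := Std R c (coinvAction W h)

/-- The generator `1 ⊗ 1` of `Δ_c(S(h)_W)`. -/
def DeltaCoinv.gen : DeltaCoinv R c := Std.mk R c (coinvAction W h) 1 1

/-- The costandard module `∇_c(S(h*)_W ⊗ det⁻¹)`. -/
abbrev NablaCoinv : Submodule (RCA R c) (Coind R c
    (coinvTwistAction W (Module.Dual ℂ h) (detInv W))) :=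
  Costd R c (coinvTwistAction W (Module.Dual ℂ h) (detInv W))

/-- The value at `a ∈ H_c` of an element of `∇_c(S(h*)_W ⊗ det⁻¹)`, an element of
`S(h*)_W ⊗ det⁻¹ = S(h*)_W`. -/
def NablaCoinv.eval (n : NablaCoinv R c) (a : RCA R c) : Coinv W (Module.Dual ℂ h) := n.1.1 a

end Modules

/-! ### Differential operators, harmonic polynomials and the Jacobian -/

section Harmonic

variable {h : Type*} [AddCommGroup h] [Module ℂ h]

/-- The algebra map `g ↦ g + D(x)(g) ε` from `S(h)` to its square-zero extension by itself. -/
def derivAux (x : Module.Dual ℂ h) :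
    SymmetricAlgebra ℂ h →ₐ[ℂ] TrivSqZeroExt (SymmetricAlgebra ℂ h) (SymmetricAlgebra ℂ h) :=
  SymmetricAlgebra.lift
    ((TrivSqZeroExt.inlAlgHom ℂ (SymmetricAlgebra ℂ h) (SymmetricAlgebra ℂ h)).toLinearMap ∘ₗ
        SymmetricAlgebra.ι ℂ h
      + (TrivSqZeroExt.inrHom (SymmetricAlgebra ℂ h) (SymmetricAlgebra ℂ h)).restrictScalars ℂ ∘ₗ
        Algebra.linearMap ℂ (SymmetricAlgebra ℂ h) ∘ₗ x)

theorem derivAux_ι (x : Module.Dual ℂ h) (ξ : h) :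
    derivAux x (SymmetricAlgebra.ι ℂ h ξ) = TrivSqZeroExt.inl (SymmetricAlgebra.ι ℂ h ξ)
      + TrivSqZeroExt.inr (algebraMap ℂ (SymmetricAlgebra ℂ h) (x ξ)) := by
  simp only [derivAux, SymmetricAlgebra.lift_ι_apply]
  rfl

theorem derivAux_fst (x : Module.Dual ℂ h) (g : SymmetricAlgebra ℂ h) :
    (derivAux x g).fst = g := by
  have : (TrivSqZeroExt.fstHom ℂ (SymmetricAlgebra ℂ h) (SymmetricAlgebra ℂ h)).comp (derivAux x)
      = AlgHom.id ℂ _ := by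
    ext ξ
    simp [derivAux_ι]
  exact congrArg (fun φ : SymmetricAlgebra ℂ h →ₐ[ℂ] SymmetricAlgebra ℂ h => φ g) this

/-- The directional derivative `D(x)` on `S(h)`, for `x ∈ h*`. -/
def dirDeriv (x : Module.Dual ℂ h) : Module.End ℂ (SymmetricAlgebra ℂ h) :=
  (TrivSqZeroExt.sndHom (SymmetricAlgebra ℂ h) (SymmetricAlgebra ℂ h)).restrictScalars ℂ ∘ₗ
    (derivAux x).toLinearMap

theorem dirDeriv_apply (x : Module.Dual ℂ h) (g : SymmetricAlgebra ℂ h) :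
    dirDeriv x g = (derivAux x g).snd := rfl

@[simp] theorem dirDeriv_ι (x : Module.Dual ℂ h) (ξ : h) :
    dirDeriv x (SymmetricAlgebra.ι ℂ h ξ) = algebraMap ℂ _ (x ξ) := by
  simp [dirDeriv_apply, derivAux_ι]
  exact (Algebra.algebraMap_eq_smul_one _).symm

@[simp] theorem dirDeriv_mul (x : Module.Dual ℂ h) (f g : SymmetricAlgebra ℂ h) :
    dirDeriv x (f * g) = dirDeriv x f * g + f * dirDeriv x g := by
  simp only [dirDeriv_apply, map_mul, TrivSqZeroExt.snd_mul, derivAux_fst, smul_eq_mul,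
    MulOpposite.smul_eq_mul_unop, MulOpposite.unop_op]
  ring

@[simp] theorem dirDeriv_algebraMap (x : Module.Dual ℂ h) (z : ℂ) :
    dirDeriv x (algebraMap ℂ (SymmetricAlgebra ℂ h) z) = 0 := by
  rw [dirDeriv_apply, AlgHom.commutes]
  rfl

theorem dirDeriv_comm (x y : Module.Dual ℂ h) (g : SymmetricAlgebra ℂ h) :
    dirDeriv x (dirDeriv y g) = dirDeriv y (dirDeriv x g) := by
  induction g using SymmetricAlgebra.induction with
  | algebraMap r => simp
  | ι v => simp
  | mul a b ha hb => simp only [dirDeriv_mul, map_add, ha, hb]; ring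
  | add a b ha hb => simp only [map_add, ha, hb]

/-- `x ↦ D(x)` as a linear map. -/
def derivLin : Module.Dual ℂ h →ₗ[ℂ] Module.End ℂ (SymmetricAlgebra ℂ h) where
  toFun := dirDeriv
  map_add' x y := by
    ext g
    induction g using SymmetricAlgebra.induction with
    | algebraMap r => simp
    | ι v => simp
    | mul a b ha hb =>
      simp only [LinearMap.add_apply] at ha hb
      simp only [LinearMap.add_apply, dirDeriv_mul, ha, hb]; ring
    | add a b ha hb => rw [map_add, map_add, ha, hb]
  map_smul' z x := by
    ext g
    induction g using SymmetricAlgebra.induction with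
    | algebraMap r => simp
    | ι v => simp [Algebra.smul_def]
    | mul a b ha hb =>
      simp only [LinearMap.smul_apply, RingHom.id_apply] at ha hb
      simp only [LinearMap.smul_apply, RingHom.id_apply, dirDeriv_mul, ha, hb, smul_add,
        smul_mul_assoc, mul_smul_comm]
    | add a b ha hb => rw [map_add, map_add, ha, hb]

variable (h) in
/-- The algebra map `D : S(h*) → End(S(h))` such that every `D(x)`, `x ∈ h*`, is the derivation of
`S(h)` with `D(x)(ξ) = (ξ, x)` for `ξ ∈ h`. -/
def diffOp : SymmetricAlgebra ℂ (Module.Dual ℂ h) →ₐ[ℂ] Module.End ℂ (SymmetricAlgebra ℂ h) :=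
  symLift derivLin fun x y => LinearMap.ext fun g => dirDeriv_comm x y g

@[simp] theorem diffOp_ι (x : Module.Dual ℂ h) :
    diffOp h (SymmetricAlgebra.ι ℂ _ x) = dirDeriv x := symLift_ι _ _ _

/-- The pairing `⟨f, g⟩ = D(f)(g)(0)` between `S(h*)` and `S(h)`. -/
def pairing (f : SymmetricAlgebra ℂ (Module.Dual ℂ h)) (g : SymmetricAlgebra ℂ h) : ℂ :=
  SymmetricAlgebra.algebraMapInv (diffOp h f g)

variable {W : Subgroup (h ≃ₗ[ℂ] h)}

theorem smul_dirDeriv (w : W) (x : Module.Dual ℂ h) (g : SymmetricAlgebra ℂ h) :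
    w • dirDeriv x g = dirDeriv (w • x) (w • g) := by
  induction g using SymmetricAlgebra.induction with
  | algebraMap r => rw [smul_algebraMap, dirDeriv_algebraMap, dirDeriv_algebraMap, smul_zero]
  | ι v => rw [sym_smul_ι, dirDeriv_ι, dirDeriv_ι, smul_algebraMap, dual_smul_apply, inv_smul_smul]
  | mul a b ha hb => rw [dirDeriv_mul, smul_mul', dirDeriv_mul, smul_add, smul_mul', smul_mul', ha, hb]
  | add a b ha hb => rw [map_add, smul_add, ha, hb, smul_add, map_add]

theorem smul_diffOp (w : W) (f : SymmetricAlgebra ℂ (Module.Dual ℂ h))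
    (g : SymmetricAlgebra ℂ h) : w • diffOp h f g = diffOp h (w • f) (w • g) := by
  induction f using SymmetricAlgebra.induction generalizing g with
  | algebraMap r =>
    rw [smul_algebraMap, AlgHom.commutes, Module.algebraMap_end_apply,
      Module.algebraMap_end_apply, smul_comm]
  | ι x => rw [sym_smul_ι, diffOp_ι, diffOp_ι, smul_dirDeriv]
  | mul a b ha hb => rw [map_mul, smul_mul', map_mul, Module.End.mul_apply, ha, hb]; rfl
  | add a b ha hb =>
    rw [map_add, smul_add, map_add, LinearMap.add_apply, smul_add, ha, hb]; rfl

theorem algebraMapInv_smul {V : Type*} [AddCommGroup V] [Module ℂ V] [DistribMulAction W V]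
    [SMulCommClass W ℂ V] (w : W) (g : SymmetricAlgebra ℂ V) :
    SymmetricAlgebra.algebraMapInv (w • g) = SymmetricAlgebra.algebraMapInv g := by
  have : (SymmetricAlgebra.algebraMapInv (R := ℂ) (M := V)).comp (symMap w)
      = SymmetricAlgebra.algebraMapInv := by
    ext v
    simp [SymmetricAlgebra.algebraMapInv_ι]
  exact congrArg (fun φ : SymmetricAlgebra ℂ V →ₐ[ℂ] ℂ => φ g) this

theorem pairing_smul (w : W) (f : SymmetricAlgebra ℂ (Module.Dual ℂ h))
    (g : SymmetricAlgebra ℂ h) : pairing (w • f) (w • g) = pairing f g := by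
  rw [pairing, ← smul_diffOp, algebraMapInv_smul, pairing]

variable (W)

/-- The space of harmonic polynomials: the orthogonal complement in `S(h)` of the ideal of `S(h*)`
generated by the invariants with zero constant term. -/
def Har : Submodule ℂ (SymmetricAlgebra ℂ h) where
  carrier := {g | ∀ f ∈ coinvIdeal W (Module.Dual ℂ h), pairing f g = 0}
  zero_mem' f _ := by simp [pairing]
  add_mem' := by
    intro a b ha hb f hf
    have h1 := ha f hf
    have h2 := hb f hf
    simp only [pairing] at h1 h2 ⊢
    rw [map_add, map_add, h1, h2, add_zero]
  smul_mem' := by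
    intro z a ha f hf
    have h1 := ha f hf
    simp only [pairing] at h1 ⊢
    rw [map_smul, map_smul, h1, smul_zero]

/-- The representation of `W` on the harmonic polynomials. -/
def harRep : Representation ℂ W (Har W) :=
  (symRep W h).subrepresentation (Har W) (by
    intro w g hg f hf
    have h1 := hg (w⁻¹ • f) (smul_mem_coinvIdeal W _ w⁻¹ hf)
    rw [← pairing_smul w, smul_inv_smul] at h1
    exact h1)

variable {W}

/-- The Jacobian `J = ∏_H v_H ^ (e_H - 1)`, the product being over the reflection hyperplanes. -/
def jacobian (R : Roots W) : SymmetricAlgebra ℂ h :=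
  ∏ᶠ H : Hyperplane W, SymmetricAlgebra.ι ℂ h (R.v H) ^ (H.order - 1)

end Harmonic

end

end Cherednik

namespace Cherednik

noncomputable section

set_option linter.unusedSectionVars false

/-! ### Symmetric algebras in coordinates -/

section Sym

variable {V : Type*} [AddCommGroup V] [Module ℂ V]

/-! Both sides of the correspondence are compared with the space of `W`-maps `S(h)_W → S(h*)_W ⊗
det⁻¹`.

On the Cherednik side, `Δ_c(S(h)_W)` is generated by `1 ⊗ 1`, so `F` is determined by `F(1 ⊗ 1)`.
This is an `S(h*) ⋊ W`-linear map on `H_c`, hence determined by its restriction to `S(h)`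
(`Coind.eq_zero`). The restriction `genValue F` kills the coinvariant ideal and is `W`-equivariant
up to the twist. Conversely, Dunkl operators make `S(h*) ⊗ S(h)_W` an `H_c`-module (`dunklRep`). An
equivariant `φ` extends `S(h*)`-linearly to it and yields, by the two universal properties, a
homomorphism restricting to `φ` (`genValue_ofEquivariant`). Its values are `h`-nilpotent because a
power of the augmentation ideal of `S(h)` lies in the coinvariant ideal. No PBW theorem is needed.

On the invariant-theory side, the key is Steinberg's theorem (`diffOp_jacobian_eq_zero_iff`): the
operators in `S(h*)` that kill `J` form exactly the coinvariant ideal. Hence `(a, b) ↦ ⟨ab, J⟩` is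
nondegenerate on `S(h*)_W`. Since `J` has character `det⁻¹`, this form identifies `S(h*)_W ⊗ det⁻¹`
with the dual representation of `S(h*)_W` (`coinvForm_injective`, `coinvForm_smul`). Moreover `Har ≅
S(h)_W` (`harEquiv`), so a map `Har → (S(h*)_W)*` may be flipped into a map `S(h*)_W → Har*`.

Steinberg's theorem rests on two facts. Every `det⁻¹`-semi-invariant of `S(h)` is divisible by `J`,
so an invariant operator without constant term, which lowers degrees, must kill `J`. In the other
direction, divided differences show that an element annihilated by `h*` modulo the ideal has
character `det` there, which reduces the claim to `det`-semi-invariants. Positivity of the Hermitian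
form `⟨ḡ, g⟩` supplies all the nonvanishing. -/

theorem sym_induction_mul_ι {p : SymmetricAlgebra ℂ V → Prop}
    (scalar : ∀ z : ℂ, p (algebraMap ℂ _ z)) (add : ∀ a b, p a → p b → p (a + b))
    (mul : ∀ a v, p a → p (a * SymmetricAlgebra.ι ℂ V v)) (a : SymmetricAlgebra ℂ V) : p a := by
  -- Products are handled by carrying an arbitrary left factor `c`; the scalar `z` absorbs the
  -- constants met on the way.
  suffices H : ∀ b c : SymmetricAlgebra ℂ V, (∀ z : ℂ, p (z • c)) → ∀ z : ℂ, p (z • (c * b)) by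
    simpa using H a 1 (fun z => by simpa [Algebra.algebraMap_eq_smul_one] using scalar z) 1
  intro b
  induction b using SymmetricAlgebra.induction with
  | algebraMap r =>
    intro c hc z
    rw [mul_comm, ← Algebra.smul_def, smul_smul]
    exact hc _
  | ι v => exact fun c hc z => by rw [← smul_mul_assoc]; exact mul _ v (hc z)
  | mul a b ha hb => intro c hc; rw [← mul_assoc]; exact hb _ (ha _ hc)
  | add a b ha hb =>
    intro c hc z; rw [mul_add, smul_add]; exact add _ _ (ha _ hc z) (hb _ hc z)

/-- The algebra endomorphism of `S(V)` induced by the projection `ξ ↦ ξ - α(ξ) v`. -/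
def projHom (α : Module.Dual ℂ V) (v : V) : SymmetricAlgebra ℂ V →ₐ[ℂ] SymmetricAlgebra ℂ V :=
  SymmetricAlgebra.lift (SymmetricAlgebra.ι ℂ V ∘ₗ (LinearMap.id - α.smulRight v))

theorem projHom_ι (α : Module.Dual ℂ V) (v ξ : V) :
    projHom α v (SymmetricAlgebra.ι ℂ V ξ) = SymmetricAlgebra.ι ℂ V (ξ - α ξ • v) := by
  simp [projHom]

theorem dvd_sub_projHom (α : Module.Dual ℂ V) (v : V) (f : SymmetricAlgebra ℂ V) :
    SymmetricAlgebra.ι ℂ V v ∣ f - projHom α v f := by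
  induction f using SymmetricAlgebra.induction with
  | algebraMap r => simp
  | ι ξ => rw [projHom_ι, ← map_sub, sub_sub_cancel, map_smul]; exact ⟨α ξ • 1, by simp⟩
  | mul a b ha hb =>
    rw [map_mul, show a * b - projHom α v a * projHom α v b
      = (a - projHom α v a) * b + projHom α v a * (b - projHom α v b) by ring]
    exact dvd_add (ha.mul_right _) (hb.mul_left _)
  | add a b ha hb => rw [map_add, add_sub_add_comm]; exact dvd_add ha hb

theorem ι_dvd_iff {α : Module.Dual ℂ V} {v : V} (hα : α v = 1) (f : SymmetricAlgebra ℂ V) :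
    SymmetricAlgebra.ι ℂ V v ∣ f ↔ projHom α v f = 0 := by
  constructor
  · rintro ⟨g, rfl⟩
    rw [map_mul, projHom_ι, hα, one_smul, sub_self, map_zero, zero_mul]
  · intro h
    simpa [h] using dvd_sub_projHom α v f

/-- The derivative `D(x)` recovers `x(v)` from the image of `v`, and linear forms separate points.
-/
theorem ι_injective : Function.Injective (SymmetricAlgebra.ι ℂ V) := by
  rw [← LinearMap.ker_eq_bot, LinearMap.ker_eq_bot']
  intro v hv
  rw [← Module.forall_dual_apply_eq_zero_iff ℂ]
  intro x
  have h := dirDeriv_ι x v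
  rw [hv, map_zero] at h
  exact (SymmetricAlgebra.algebraMap_eq_zero_iff _ _).1 h.symm

/-- The ideal generated by `v` is the kernel of `projHom α v`, an endomorphism of a domain. -/
theorem prime_ι {α : Module.Dual ℂ V} {v : V} (hα : α v = 1) :
    Prime (SymmetricAlgebra.ι ℂ V v) := by
  refine ⟨?_, ?_, ?_⟩
  · intro h
    have : v = 0 := ι_injective (by rw [h, map_zero])
    simp [this] at hα
  · intro h
    have := h.map (SymmetricAlgebra.algebraMapInv (R := ℂ) (M := V))
    rw [SymmetricAlgebra.algebraMapInv_ι] at this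
    exact not_isUnit_zero this
  · intro a b
    rw [ι_dvd_iff hα, ι_dvd_iff hα, ι_dvd_iff hα, map_mul]
    exact mul_eq_zero.1

/-! ### Partial derivatives, the Hermitian form `⟨ḡ, g⟩` and degrees, in a basis -/

section Coordinates

open SymmetricAlgebra

variable {n : Type*} [Fintype n] [DecidableEq n] (b : Module.Basis n ℂ V)

theorem equiv_dirDeriv (i : n) (g : SymmetricAlgebra ℂ V) :
    equivMvPolynomial b (dirDeriv (b.coord i) g)
      = MvPolynomial.pderiv i (equivMvPolynomial b g) := by
  induction g using SymmetricAlgebra.induction with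
  | algebraMap r =>
    rw [dirDeriv_algebraMap, map_zero, AlgEquiv.commutes, MvPolynomial.algebraMap_eq,
      MvPolynomial.pderiv_C]
  | ι v =>
    rw [dirDeriv_ι, AlgEquiv.commutes]
    conv_rhs => rw [← b.sum_repr v]
    simp only [map_sum, map_smul, equivMvPolynomial_ι_apply, MvPolynomial.pderiv_X,
      Derivation.map_smul]
    simp [Pi.single_apply, MvPolynomial.algebraMap_eq, MvPolynomial.smul_eq_C_mul]
  | mul a b ha hb =>
    rw [dirDeriv_mul, map_add, map_mul, map_mul, map_mul, MvPolynomial.pderiv_mul, ha, hb]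
  | add a b ha hb => simp only [map_add, ha, hb]

theorem algebraMapInv_eq_coeff (g : SymmetricAlgebra ℂ V) :
    algebraMapInv g = MvPolynomial.coeff 0 (equivMvPolynomial b g) := by
  have : (algebraMapInv (R := ℂ) (M := V))
      = (MvPolynomial.aeval (fun _ : n => (0 : ℂ))).comp
        (equivMvPolynomial b : SymmetricAlgebra ℂ V →ₐ[ℂ] MvPolynomial n ℂ) := by
    refine algHom_ext (b.ext fun i => ?_)
    simp [algebraMapInv_ι]
  rw [this]
  simp [MvPolynomial.constantCoeff_eq]

theorem pairing_mul_ι (f : SymmetricAlgebra ℂ (Module.Dual ℂ V)) (x : Module.Dual ℂ V)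
    (g : SymmetricAlgebra ℂ V) : pairing (f * ι ℂ _ x) g = pairing f (dirDeriv x g) := by
  rw [pairing, map_mul, Module.End.mul_apply, diffOp_ι, pairing]

/-- Differentiating along a monomial and evaluating at `0` extracts one Taylor coefficient, so
monomials in dual bases are orthogonal; the induction strips off one variable at a time. -/
theorem pairing_monomial (m : n →₀ ℕ) (g : SymmetricAlgebra ℂ V) :
    pairing ((equivMvPolynomial b.dualBasis).symm (MvPolynomial.monomial m 1)) g
      = (∏ i, (m i).factorial : ℕ) * MvPolynomial.coeff m (equivMvPolynomial b g) := by
  induction hd : m.degree generalizing m g with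
  | zero =>
    rw [Finsupp.degree_eq_zero_iff] at hd
    subst hd
    simp [pairing, algebraMapInv_eq_coeff b, ← MvPolynomial.C_apply]
  | succ d ih =>
    obtain ⟨i, hi⟩ : ∃ i, m i ≠ 0 := by
      by_contra! H
      rw [show m = 0 from Finsupp.ext H] at hd
      simp at hd
    obtain ⟨m', rfl⟩ : ∃ m', m = m' + Finsupp.single i 1 :=
      ⟨m - Finsupp.single i 1, (tsub_add_cancel_of_le
        (Finsupp.single_le_iff.2 (Nat.one_le_iff_ne_zero.2 hi))).symm⟩
    have h1 : MvPolynomial.monomial (m' + Finsupp.single i 1) (1 : ℂ)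
        = MvPolynomial.monomial m' 1 * MvPolynomial.X i := by
      rw [MvPolynomial.X, MvPolynomial.monomial_mul, mul_one]
    rw [h1, map_mul, equivMvPolynomial_symm_X, pairing_mul_ι, ih _ _ (by simpa using hd),
      b.coe_dualBasis, equiv_dirDeriv, MvPolynomial.coeff_pderiv]
    have h2 : ∏ j, ((m' + Finsupp.single i 1 : n →₀ ℕ) j).factorial
        = (m' i + 1) * ∏ j, (m' j).factorial := by
      rw [← Finset.mul_prod_erase _ _ (Finset.mem_univ i),
        ← Finset.mul_prod_erase _ (fun j => (m' j).factorial) (Finset.mem_univ i),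
        Finset.prod_congr rfl (g := fun j => (m' j).factorial) (fun j hj => by
          simp [(Finset.ne_of_mem_erase hj).symm])]
      simp [Nat.factorial_succ, mul_assoc]
    rw [h2]
    push_cast
    ring

/-- The conjugate-linear isomorphism `S(V) → S(V*)` sending the vectors of a basis to those of the
dual basis. -/
def conjEquiv : SymmetricAlgebra ℂ V ≃+* SymmetricAlgebra ℂ (Module.Dual ℂ V) :=
  ((equivMvPolynomial b).toRingEquiv.trans (MvPolynomial.mapEquiv n (starRingAut (R := ℂ)))).trans
    (equivMvPolynomial b.dualBasis).symm.toRingEquiv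

theorem conjEquiv_apply (g : SymmetricAlgebra ℂ V) :
    conjEquiv b g = (equivMvPolynomial b.dualBasis).symm
      (MvPolynomial.map (starRingEnd ℂ) (equivMvPolynomial b g)) := rfl

theorem conjEquiv_algebraMap (z : ℂ) :
    conjEquiv b (algebraMap ℂ _ z) = algebraMap ℂ _ (starRingEnd ℂ z) := by
  rw [conjEquiv_apply, AlgEquiv.commutes, MvPolynomial.algebraMap_eq, MvPolynomial.map_C,
    ← MvPolynomial.algebraMap_eq, AlgEquiv.commutes]

theorem conjEquiv_smul (z : ℂ) (g : SymmetricAlgebra ℂ V) :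
    conjEquiv b (z • g) = starRingEnd ℂ z • conjEquiv b g := by
  rw [Algebra.smul_def, map_mul, conjEquiv_algebraMap, ← Algebra.smul_def]

theorem conjEquiv_ι (v : V) :
    conjEquiv b (ι ℂ V v) = ι ℂ _ (∑ i, starRingEnd ℂ (b.repr v i) • b.coord i) := by
  rw [conjEquiv_apply]
  conv_lhs => rw [← b.sum_repr v]
  simp only [map_sum, map_smul, equivMvPolynomial_ι_apply, MvPolynomial.smul_eq_C_mul, map_mul,
    MvPolynomial.map_C, MvPolynomial.map_X, equivMvPolynomial_symm_X, b.coe_dualBasis]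
  refine Finset.sum_congr rfl fun i _ => ?_
  rw [← MvPolynomial.algebraMap_eq, AlgEquiv.commutes, ← Algebra.smul_def]

theorem algebraMapInv_conjEquiv (g : SymmetricAlgebra ℂ V) :
    algebraMapInv (conjEquiv b g) = starRingEnd ℂ (algebraMapInv g) := by
  rw [algebraMapInv_eq_coeff b.dualBasis, algebraMapInv_eq_coeff b, conjEquiv_apply,
    AlgEquiv.apply_symm_apply, MvPolynomial.coeff_map]

theorem pairing_smul_left (z : ℂ) (f : SymmetricAlgebra ℂ (Module.Dual ℂ V))
    (g : SymmetricAlgebra ℂ V) : pairing (z • f) g = z * pairing f g := by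
  simp [pairing]

theorem pairing_smul_right (z : ℂ) (f : SymmetricAlgebra ℂ (Module.Dual ℂ V))
    (g : SymmetricAlgebra ℂ V) : pairing f (z • g) = z * pairing f g := by
  simp [pairing]

/-- In coordinates `⟨ḡ, g⟩ = ∑ m! |g_m|²`, a positive definite form. -/
theorem eq_zero_of_pairing_conjEquiv {g : SymmetricAlgebra ℂ V}
    (hg : pairing (conjEquiv b g) g = 0) : g = 0 := by
  set p := equivMvPolynomial b g with hp
  have h1 : pairing (conjEquiv b g) g = ∑ m ∈ p.support,
      ((∏ i, (m i).factorial : ℕ) * Complex.normSq (MvPolynomial.coeff m p) : ℝ) := by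
    have h2 : MvPolynomial.map (starRingEnd ℂ) p = ∑ m ∈ p.support,
        starRingEnd ℂ (MvPolynomial.coeff m p) • MvPolynomial.monomial m (1 : ℂ) := by
      conv_lhs => rw [p.as_sum]
      simp only [map_sum, MvPolynomial.map_monomial, MvPolynomial.smul_monomial, smul_eq_mul,
        mul_one]
    have h3 : ∀ f, pairing f g = ((algebraMapInv (R := ℂ) (M := V)).toLinearMap ∘ₗ
        (LinearMap.applyₗ g) ∘ₗ (diffOp V).toLinearMap) f := fun _ => rfl
    rw [conjEquiv_apply, ← hp, h2, map_sum, h3, map_sum, Complex.ofReal_sum]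
    refine Finset.sum_congr rfl fun m _ => ?_
    rw [← h3, map_smul, pairing_smul_left, pairing_monomial, ← hp, mul_left_comm,
      Complex.ofReal_mul, Complex.normSq_eq_conj_mul_self, Complex.ofReal_natCast]
  rw [h1, Complex.ofReal_eq_zero, Finset.sum_eq_zero_iff_of_nonneg
    (fun m _ => mul_nonneg (Nat.cast_nonneg _) (Complex.normSq_nonneg _))] at hg
  have h4 : p = 0 := by
    rw [← MvPolynomial.support_eq_empty, Finset.eq_empty_iff_forall_notMem]
    intro m hm
    rcases mul_eq_zero.1 (hg m hm) with h | h
    · rw [Nat.cast_eq_zero, Finset.prod_eq_zero_iff] at h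
      obtain ⟨i, _, hi⟩ := h
      exact Nat.factorial_ne_zero _ hi
    · exact MvPolynomial.mem_support_iff.1 hm (Complex.normSq_eq_zero.1 h)
  exact (map_eq_zero_iff _ (equivMvPolynomial b).injective).1 h4

/-- The elements of `S(V)` of degree less than `d`. -/
def degLT (d : ℕ) : Submodule ℂ (SymmetricAlgebra ℂ V) where
  carrier := {g | ∀ m : n →₀ ℕ, d ≤ m.degree → MvPolynomial.coeff m (equivMvPolynomial b g) = 0}
  zero_mem' m _ := by simp
  add_mem' h1 h2 m hm := by simp [h1 m hm, h2 m hm]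
  smul_mem' z g hg m hm := by simp [hg m hm]

theorem degLT_mono {d e : ℕ} (hde : d ≤ e) : degLT b d ≤ degLT b e :=
  fun _ hg m hm => hg m (hde.trans hm)

theorem dirDeriv_mem_degLT (x : Module.Dual ℂ V) {d : ℕ} {g : SymmetricAlgebra ℂ V}
    (hg : g ∈ degLT b (d + 1)) : dirDeriv x g ∈ degLT b d := by
  have hx : dirDeriv x = ∑ i, x (b i) • dirDeriv (b.coord i) := by
    conv_lhs => rw [← b.sum_dual_apply_smul_coord x]
    change derivLin _ = _
    rw [map_sum]
    simp only [map_smul]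
    rfl
  rw [hx, LinearMap.sum_apply]
  refine Submodule.sum_mem _ fun i _ => Submodule.smul_mem _ _ fun m hm => ?_
  rw [equiv_dirDeriv, MvPolynomial.coeff_pderiv, hg _ (by simpa using hm), zero_mul]

/-- Each `D(x)` lowers the degree, so only the constant term of `f` survives in top degree. For
products this is `AC - ac = (A - a)(C - c) + a(C - c) + c(A - a)`, where `a`, `c` are the constant
terms of the operators `A`, `C`. -/
theorem diffOp_sub_mem_degLT (f : SymmetricAlgebra ℂ (Module.Dual ℂ V)) {d : ℕ}
    {g : SymmetricAlgebra ℂ V} (hg : g ∈ degLT b (d + 1)) :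
    diffOp V f g - algebraMapInv f • g ∈ degLT b d := by
  induction f using SymmetricAlgebra.induction generalizing d g with
  | algebraMap r => simp [algebraMap_leftInverse _ r]
  | ι x => simpa [algebraMapInv_ι] using dirDeriv_mem_degLT b x hg
  | mul a c ha hc =>
    have h1 : diffOp V (a * c) g - algebraMapInv (a * c) • g
        = (diffOp V a (diffOp V c g - algebraMapInv c • g)
          - algebraMapInv a • (diffOp V c g - algebraMapInv c • g))
          + algebraMapInv a • (diffOp V c g - algebraMapInv c • g)
          + algebraMapInv c • (diffOp V a g - algebraMapInv a • g) := by
      simp only [map_mul, Module.End.mul_apply, map_sub, map_smul]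
      module
    rw [h1]
    exact add_mem (add_mem (ha (degLT_mono b d.le_succ (hc hg))) (Submodule.smul_mem _ _ (hc hg)))
      (Submodule.smul_mem _ _ (ha hg))
  | add a c ha hc =>
    rw [map_add, map_add, LinearMap.add_apply, add_smul, add_sub_add_comm]
    exact add_mem (ha hg) (hc hg)

/-- An operator `D(f)` without constant term does not map `g` to a nonzero multiple of `g`. -/
theorem diffOp_eq_zero_of_dvd [FiniteDimensional ℂ V] {f : SymmetricAlgebra ℂ (Module.Dual ℂ V)}
    (hf : algebraMapInv f = 0) {g : SymmetricAlgebra ℂ V} (hg : g ∣ diffOp V f g) :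
    diffOp V f g = 0 := by
  classical
  obtain ⟨q, hq⟩ := hg
  by_contra hne
  let b := Module.finBasis ℂ V
  let E := equivMvPolynomial b
  have hgq : E g ≠ 0 ∧ E q ≠ 0 := by
    rw [hq] at hne
    simpa using hne
  have h1 : g ∈ degLT b ((E g).totalDegree + 1) := fun m hm => by
    by_contra h
    have := MvPolynomial.le_totalDegree (MvPolynomial.mem_support_iff.2 h)
    change m.degree ≤ (E g).totalDegree at this
    omega
  -- `D(f)(g)` now has degree below that of `g`, whereas a nonzero multiple `g q` has degree `deg g
  -- + deg q`.
  have h2 := diffOp_sub_mem_degLT b f h1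
  rw [hf, zero_smul, sub_zero] at h2
  have h3 : (E (diffOp V f g)) ≠ 0 := by simpa using hne
  obtain ⟨m, hm, hm'⟩ := Finset.exists_mem_eq_sup _ (MvPolynomial.support_nonempty.2 h3)
    (fun s : _ →₀ ℕ => s.sum fun _ e => e)
  have h4 : (E (diffOp V f g)).totalDegree = m.degree := hm'
  have h5 : m.degree < (E g).totalDegree := by
    by_contra h
    exact MvPolynomial.mem_support_iff.1 hm (h2 m (not_lt.1 h))
  rw [hq, map_mul, MvPolynomial.totalDegree_mul_of_isDomain hgq.1 hgq.2] at h4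
  omega

end Coordinates

end Sym

/-! ### An invariant Hermitian form -/

section Unitary

variable {h : Type*} [AddCommGroup h] [Module ℂ h] [FiniteDimensional ℂ h]
  (W : Subgroup (h ≃ₗ[ℂ] h))

/-- A basis of `h` that is orthonormal for a `W`-invariant inner product. -/
def IsUnitaryBasis {n : Type*} [Fintype n] (b : Module.Basis n ℂ h) : Prop :=
  ∀ (w : W) (u v : h), ∑ i, starRingEnd ℂ (b.repr (w • u) i) * b.repr (w • v) i
    = ∑ i, starRingEnd ℂ (b.repr u i) * b.repr v i

/-- Weyl's trick: average the standard Hermitian form over `W` and take an orthonormal basis. -/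
theorem exists_isUnitaryBasis [Finite W] :
    ∃ b : Module.Basis (Fin (Module.finrank ℂ h)) ℂ h, IsUnitaryBasis W b := by
  have := Fintype.ofFinite W
  let b₀ := Module.finBasis ℂ h
  let core : InnerProductSpace.Core ℂ h :=
    { inner := fun u v => ∑ w : W, ∑ i, starRingEnd ℂ (b₀.repr (w • u) i) * b₀.repr (w • v) i
      conj_inner_symm := fun u v => by simp [map_sum, mul_comm]
      re_inner_nonneg := fun u => by
        change 0 ≤ (∑ w : W, ∑ i, starRingEnd ℂ (b₀.repr (w • u) i) * b₀.repr (w • u) i).re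
        simp only [← Complex.normSq_eq_conj_mul_self, Complex.re_sum, Complex.ofReal_re]
        exact Finset.sum_nonneg fun _ _ => Finset.sum_nonneg fun _ _ => Complex.normSq_nonneg _
      add_left := fun u v x => by simp [add_mul, Finset.sum_add_distrib]
      smul_left := fun u v z => by
        simp [smul_comm _ z, mul_assoc, Finset.mul_sum]
      definite := fun u hu => by
        change ∑ w : W, ∑ i, starRingEnd ℂ (b₀.repr (w • u) i) * b₀.repr (w • u) i = 0 at hu
        simp only [← Complex.normSq_eq_conj_mul_self, ← Complex.ofReal_sum,
          Complex.ofReal_eq_zero] at hu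
        rw [Finset.sum_eq_zero_iff_of_nonneg fun _ _ =>
          Finset.sum_nonneg fun _ _ => Complex.normSq_nonneg _] at hu
        have h1 := hu 1 (Finset.mem_univ _)
        rw [Finset.sum_eq_zero_iff_of_nonneg fun _ _ => Complex.normSq_nonneg _] at h1
        refine b₀.repr.injective (Finsupp.ext fun i => ?_)
        simpa using h1 i (Finset.mem_univ _) }
  let _ : NormedAddCommGroup h := core.toNormedAddCommGroup
  let _ : InnerProductSpace ℂ h := InnerProductSpace.ofCore core.toCore
  let b := stdOrthonormalBasis ℂ h
  have hb : ∀ u v : h, ∑ i, starRingEnd ℂ (b.toBasis.repr u i) * b.toBasis.repr v i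
      = inner ℂ u v := by
    intro u v
    rw [← b.repr.inner_map_map, PiLp.inner_apply]
    simp [mul_comm]
  refine ⟨b.toBasis, fun w u v => ?_⟩
  rw [hb, hb]
  change ∑ w' : W, ∑ i, starRingEnd ℂ (b₀.repr (w' • w • u) i) * b₀.repr (w' • w • v) i
    = ∑ w' : W, ∑ i, starRingEnd ℂ (b₀.repr (w' • u) i) * b₀.repr (w' • v) i
  simp only [smul_smul]
  exact Fintype.sum_equiv (Equiv.mulRight w) _ _ fun _ => rfl

variable {W}

/-- In a unitary basis the complex conjugate of the matrix of `w` is its inverse transpose, which is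
the matrix of `w` on the dual space. -/
theorem conjEquiv_smul_group {n : Type*} [Fintype n] [DecidableEq n] {b : Module.Basis n ℂ h}
    (hb : IsUnitaryBasis W b) (w : W) (g : SymmetricAlgebra ℂ h) :
    conjEquiv b (w • g) = w • conjEquiv b g := by
  induction g using SymmetricAlgebra.induction with
  | algebraMap r => rw [smul_algebraMap, conjEquiv_algebraMap, smul_algebraMap]
  | ι v =>
    rw [sym_smul_ι, conjEquiv_ι, conjEquiv_ι, sym_smul_ι]
    congr 1
    ext u
    have := hb w v (w⁻¹ • u)
    rw [smul_inv_smul] at this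
    simpa using this
  | mul a c ha hc => rw [smul_mul', map_mul, map_mul, smul_mul', ha, hc]
  | add a c ha hc => rw [smul_add, map_add, map_add, smul_add, ha, hc]

end Unitary

/-! ### Pseudo-reflections and hyperplanes -/

section Reflections

variable {h : Type*} [AddCommGroup h] [Module ℂ h] {W : Subgroup (h ≃ₗ[ℂ] h)}

theorem mem_fixedSpace {s : h ≃ₗ[ℂ] h} {y : h} : y ∈ fixedSpace s ↔ s y = y := by
  rw [fixedSpace, LinearMap.mem_ker, LinearMap.sub_apply, sub_eq_zero]; rfl

theorem Refl.mem_stab (s : Refl W) : s.1 ∈ s.hyp.stab := fun _ hy => mem_fixedSpace.1 hy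

theorem Refl.smul_ne (s : Refl W) : ∃ y : h, s.1 • y ≠ y := by
  by_contra! H
  exact s.2.1 (LinearEquiv.ext H)

theorem fixedSpace_conj (w s : W) :
    fixedSpace ((w * s * w⁻¹ : W) : h ≃ₗ[ℂ] h)
      = (fixedSpace (s : h ≃ₗ[ℂ] h)).map ((w : h ≃ₗ[ℂ] h) : h →ₗ[ℂ] h) := by
  ext y
  rw [Submodule.mem_map_equiv, mem_fixedSpace, mem_fixedSpace]
  change (w * s * w⁻¹) • y = y ↔ s • w⁻¹ • y = w⁻¹ • y
  rw [mul_smul, mul_smul, smul_eq_iff_eq_inv_smul]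

theorem isPseudoReflection_conj (w : W) {s : W} (hs : IsPseudoReflection (s : h ≃ₗ[ℂ] h)) :
    IsPseudoReflection ((w * s * w⁻¹ : W) : h ≃ₗ[ℂ] h) := by
  refine ⟨?_, ?_, ?_⟩
  · intro h1
    have h2 : w * s * w⁻¹ = 1 := Subtype.ext h1
    rw [conj_eq_one_iff] at h2
    exact hs.1 (congrArg Subtype.val h2)
  · rw [Submonoid.isOfFinOrder_coe]
    have := Submonoid.isOfFinOrder_coe.1 hs.2.1
    rw [← orderOf_pos_iff] at this ⊢
    rwa [show w * s * w⁻¹ = MulAut.conj w s from rfl, MulEquiv.orderOf_eq]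
  · rw [fixedSpace_conj, LinearEquiv.finrank_map_eq]
    exact hs.2.2

/-- The conjugate of a pseudo-reflection. -/
def Refl.conj (w : W) (s : Refl W) : Refl W := ⟨w * s.1 * w⁻¹, isPseudoReflection_conj w s.2⟩

/-- The image of a reflection hyperplane under an element of `W`. -/
def Hyperplane.image (w : W) (H : Hyperplane W) : Hyperplane W :=
  ⟨H.1.map ((w : h ≃ₗ[ℂ] h) : h →ₗ[ℂ] h), by
    obtain ⟨s, hs⟩ := H.2
    exact ⟨s.conj w, by rw [← hs]; exact fixedSpace_conj w s.1⟩⟩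

theorem Refl.hyp_conj (w : W) (s : Refl W) : (s.conj w).hyp = s.hyp.image w :=
  Subtype.ext (fixedSpace_conj w s.1)

theorem Hyperplane.mem_image {w : W} {H : Hyperplane W} {y : h} :
    y ∈ (H.image w).1 ↔ w⁻¹ • y ∈ H.1 := Submodule.mem_map_equiv (e := (w : h ≃ₗ[ℂ] h)) H.1

theorem Hyperplane.image_image (a b : W) (H : Hyperplane W) :
    (H.image b).image a = H.image (a * b) := by
  ext y
  simp [Hyperplane.mem_image, mul_smul]

theorem Hyperplane.image_one (H : Hyperplane W) : H.image 1 = H := by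
  ext y
  simp [Hyperplane.mem_image]

/-- The permutation of the reflection hyperplanes induced by an element of `W`. -/
def Hyperplane.perm (w : W) : Equiv.Perm (Hyperplane W) where
  toFun H := H.image w
  invFun H := H.image w⁻¹
  left_inv H := by dsimp only; rw [image_image, inv_mul_cancel, image_one]
  right_inv H := by dsimp only; rw [image_image, mul_inv_cancel, image_one]

theorem Hyperplane.conj_mem_stab {H : Hyperplane W} {u : W} (hu : u ∈ H.stab) (w : W) :
    w * u * w⁻¹ ∈ (H.image w).stab := by
  intro y hy
  rw [mul_smul, mul_smul, hu _ (mem_image.1 hy), smul_inv_smul]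

theorem Hyperplane.order_image (w : W) (H : Hyperplane W) : (H.image w).order = H.order := by
  have key : ∀ u ∈ (H.image w).stab, w⁻¹ * u * w ∈ H.stab := fun u hu => by
    have := conj_mem_stab hu w⁻¹
    rwa [image_image, inv_mul_cancel, image_one, inv_inv] at this
  exact (Nat.card_congr ⟨fun u => ⟨w * u * w⁻¹, conj_mem_stab u.2 w⟩,
    fun u => ⟨w⁻¹ * u * w, key u u.2⟩, fun u => Subtype.ext (by simp [mul_assoc]),
    fun u => Subtype.ext (by simp [mul_assoc])⟩).symm

theorem Hyperplane.image_eq_of_mem_stab {H : Hyperplane W} {w : W} (hw : w ∈ H.stab) :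
    H.image w = H := by
  ext y
  rw [mem_image]
  constructor
  · intro hy
    have := hw _ hy
    rw [smul_inv_smul] at this
    rwa [this]
  · intro hy
    rwa [inv_smul_eq_iff.2 (hw y hy).symm]

instance [Finite W] : Finite (Hyperplane W) :=
  Finite.of_surjective (fun s : Refl W => s.hyp) fun H => by
    obtain ⟨s, hs⟩ := H.2
    exact ⟨s, Subtype.ext hs⟩

variable (R : Roots W)

namespace Roots

/-- The eigenvalue of an element of `W_H` on `v_H`. -/
def eigenval (H : Hyperplane W) (w : W) : ℂ := R.α H (w • R.v H)

variable {R}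

theorem sub_mem (H : Hyperplane W) (y : h) : y - R.α H y • R.v H ∈ H.1 := by
  rw [← R.ker_α, LinearMap.mem_ker, map_sub, map_smul, R.α_v, smul_eq_mul, mul_one, sub_self]

theorem α_eq_zero_iff {H : Hyperplane W} {y : h} : R.α H y = 0 ↔ y ∈ H.1 := by
  rw [← R.ker_α]; rfl

theorem v_ne_zero (H : Hyperplane W) : R.v H ≠ 0 := by
  intro h0
  have := R.α_v H
  simp [h0] at this

theorem smul_v_eq {H : Hyperplane W} {w : W} (hw : w ∈ H.stab) :
    w • R.v H = R.eigenval H w • R.v H := by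
  obtain ⟨t, ht⟩ := Submodule.mem_span_singleton.1 (R.smul_v H w hw)
  rw [eigenval, ← ht, map_smul, R.α_v, smul_eq_mul, mul_one]

/-- Split `y` along `h = H ⊕ ℂ v_H`. Thus an element of `W_H` is determined by its eigenvalue, and
all computations with reflections go through this formula. -/
theorem stab_smul {H : Hyperplane W} {w : W} (hw : w ∈ H.stab) (y : h) :
    w • y = y - ((1 - R.eigenval H w) * R.α H y) • R.v H := by
  have h1 := hw _ (sub_mem (R := R) H y)
  rw [smul_sub, smul_comm w (R.α H y), smul_v_eq hw, sub_eq_iff_eq_add] at h1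
  rw [h1]
  module

theorem eigenval_ne_one (s : Refl W) : R.eigenval s.hyp s.1 ≠ 1 := by
  intro h1
  obtain ⟨y, hy⟩ := s.smul_ne
  apply hy
  rw [stab_smul s.mem_stab, h1]
  simp

theorem detInv_eq [FiniteDimensional ℂ h] {H : Hyperplane W} {w : W} (hw : w ∈ H.stab) :
    (detInv W w : ℂ) = (R.eigenval H w)⁻¹ := by
  -- Here `transvection` is just `y ↦ y + α(y) u`, with `α(u) = 0` not required; its determinant is
  -- `1 + α(u)`, which is the eigenvalue.
  have h1 : ((w : h ≃ₗ[ℂ] h) : h →ₗ[ℂ] h)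
      = LinearMap.transvection (R.α H) ((R.eigenval H w - 1) • R.v H) := by
    ext y
    change w • y = _
    rw [stab_smul hw, LinearMap.transvection.apply]
    module
  change (((LinearEquiv.det (w : h ≃ₗ[ℂ] h))⁻¹ : ℂˣ) : ℂ) = _
  rw [Units.val_inv_eq_inv_val, LinearEquiv.coe_det, h1, LinearMap.transvection.det, map_smul,
    R.α_v]
  simp

theorem eigenval_ne_zero [FiniteDimensional ℂ h] {H : Hyperplane W} {w : W} (hw : w ∈ H.stab) :
    R.eigenval H w ≠ 0 := by
  intro h0
  have := detInv_eq (R := R) hw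
  rw [h0, inv_zero] at this
  exact (detInv W w).ne_zero this

/-- For a reflection `s` with hyperplane `H`, the image of `1 - w s w⁻¹` lies in the line of
`v_{wH}`, and this operator multiplies `w v_H` by the nonzero number `1 - λ`, with `λ` the
eigenvalue of `s`. -/
theorem smul_v_mem (w : W) (H : Hyperplane W) :
    ∃ t : ℂ, w • R.v H = t • R.v (H.image w) := by
  obtain ⟨s, hs⟩ := H.2
  obtain rfl : s.hyp = H := Subtype.ext hs
  have h1 := stab_smul (R := R) (Hyperplane.conj_mem_stab s.mem_stab w) (w • R.v s.hyp)
  rw [mul_smul, mul_smul, inv_smul_smul, smul_v_eq s.mem_stab, smul_comm w] at h1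
  have h2 : (1 - R.eigenval s.hyp s.1) • w • R.v s.hyp
      = ((1 - R.eigenval (s.hyp.image w) (w * s.1 * w⁻¹)) *
        R.α (s.hyp.image w) (w • R.v s.hyp)) • R.v (s.hyp.image w) := by
    rw [sub_smul, one_smul, h1]; abel
  have h3 : 1 - R.eigenval s.hyp s.1 ≠ 0 := sub_ne_zero.2 (eigenval_ne_one s).symm
  exact ⟨_, by rw [← inv_smul_smul₀ h3 (w • R.v s.hyp), h2, smul_smul]⟩

/-- The tensor `α_H ⊗ v_H` does not depend on the choice of `v_H`, hence is equivariant although the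
chosen roots are not. Equivariance of the Dunkl operators comes from this. -/
theorem α_image_smul_v (w : W) (H : Hyperplane W) (y : h) :
    R.α (H.image w) (w • y) • R.v (H.image w) = R.α H y • w • R.v H := by
  obtain ⟨t, ht⟩ := smul_v_mem (R := R) w H
  have h1 : R.α (H.image w) (w • (y - R.α H y • R.v H)) = 0 := by
    rw [α_eq_zero_iff, Hyperplane.mem_image, inv_smul_smul]
    exact sub_mem H y
  rw [smul_sub, smul_comm w, map_sub, sub_eq_zero] at h1
  rw [h1, ht, map_smul, map_smul, R.α_v, smul_eq_mul, smul_eq_mul, mul_one, smul_smul]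

theorem α_smul_eq [FiniteDimensional ℂ h] {H : Hyperplane W} {w : W} (hw : w ∈ H.stab) :
    w • R.α H = (R.eigenval H w)⁻¹ • R.α H := by
  ext y
  rw [dual_smul_apply, LinearMap.smul_apply]
  have h1 := congrArg (R.α H) (stab_smul (R := R) hw (w⁻¹ • y))
  rw [smul_inv_smul, map_sub, (R.α H).map_smul, R.α_v] at h1
  rw [h1, smul_eq_mul, smul_eq_mul, eq_inv_mul_iff_mul_eq₀ (eigenval_ne_zero hw)]
  ring

theorem smul_dual_eq {H : Hyperplane W} {w : W} (hw : w ∈ H.stab) (x : Module.Dual ℂ h) :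
    w • x = x - ((1 - R.eigenval H w⁻¹) * x (R.v H)) • R.α H := by
  ext y
  rw [dual_smul_apply, stab_smul (R := R) (inv_mem hw)]
  simp only [map_sub, map_smul, LinearMap.sub_apply, LinearMap.smul_apply, smul_eq_mul]
  ring

end Roots

end Reflections

/-! ### Semi-invariants and the Jacobian -/

section Jacobian

variable {h : Type*} [AddCommGroup h] [Module ℂ h] [FiniteDimensional ℂ h]
  {W : Subgroup (h ≃ₗ[ℂ] h)} {R : Roots W}

open SymmetricAlgebra

/-- Every `w ∈ W_H` moves `y` by a multiple of `v_H`, so `W_H` acts trivially modulo `v_H`. -/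
theorem projHom_smul {H : Hyperplane W} {w : W} (hw : w ∈ H.stab) (f : SymmetricAlgebra ℂ h) :
    projHom (R.α H) (R.v H) (w • f) = projHom (R.α H) (R.v H) f := by
  induction f using SymmetricAlgebra.induction with
  | algebraMap r => rw [smul_algebraMap]
  | ι y =>
    rw [sym_smul_ι, projHom_ι, projHom_ι]
    congr 1
    rw [Roots.stab_smul (R := R) hw y, map_sub, map_smul, R.α_v]
    module
  | mul a b ha hb => rw [smul_mul', map_mul, ha, hb, map_mul]
  | add a b ha hb => rw [smul_add, map_add, ha, hb, map_add]

theorem Roots.prime_v (H : Hyperplane W) : Prime (ι ℂ h (R.v H)) := prime_ι (R.α_v H)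

theorem smul_finset_prod {V I : Type*} [AddCommGroup V] [Module ℂ V] [DistribMulAction W V]
    [SMulCommClass W ℂ V] (w : W) (t : Finset I) (f : I → SymmetricAlgebra ℂ V) :
    w • ∏ i ∈ t, f i = ∏ i ∈ t, w • f i := map_prod (symMap w) f t

theorem eq_one_of_smul_eq_self {a : SymmetricAlgebra ℂ h} (ha : a ≠ 0) {z : ℂ} (h1 : z • a = a) :
    z = 1 := by
  rw [← sub_eq_zero]
  refine (smul_eq_zero.1 (?_ : (z - 1) • a = 0)).resolve_right ha
  rw [sub_smul, one_smul, h1, sub_self]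

variable [Finite W]

instance : UniqueFactorizationMonoid (SymmetricAlgebra ℂ h) :=
  (equivMvPolynomial (Module.finBasis ℂ h)).symm.toMulEquiv.uniqueFactorizationMonoid inferInstance

/-- Roots of distinct hyperplanes are not proportional. -/
theorem Roots.eq_of_v_dvd {H K : Hyperplane W} (hd : ι ℂ h (R.v H) ∣ ι ℂ h (R.v K)) : H = K := by
  obtain ⟨b, hb⟩ := exists_isUnitaryBasis W
  let B : h → Module.Dual ℂ h := fun u => ∑ i, starRingEnd ℂ (b.repr u i) • b.coord i
  have hB : ∀ u v : h, B u v = ∑ i, starRingEnd ℂ (b.repr u i) * b.repr v i := by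
    intro u v; simp [B]
  have hB0 : ∀ u : h, B u u = 0 → u = 0 := by
    intro u hu
    rw [hB] at hu
    simp only [← Complex.normSq_eq_conj_mul_self, ← Complex.ofReal_sum,
      Complex.ofReal_eq_zero] at hu
    rw [Finset.sum_eq_zero_iff_of_nonneg fun _ _ => Complex.normSq_nonneg _] at hu
    refine b.repr.injective (Finsupp.ext fun i => ?_)
    simpa using hu i (Finset.mem_univ _)
  -- `v_H` is orthogonal to `H` for the invariant form `B`, since a reflection fixes `H` and scales
  -- `v_H` by a number other than `1`. So the line of `v_H` determines `H`.
  have horth : ∀ (H : Hyperplane W) (y : h), B (R.v H) y = B (R.v H) (R.v H) * R.α H y := by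
    intro H y
    have h1 : ∀ u ∈ H.1, B (R.v H) u = 0 := by
      intro u hu
      obtain ⟨s, hs⟩ := H.2
      obtain rfl : s.hyp = H := Subtype.ext hs
      have h2 : B (s.1 • R.v s.hyp) (s.1 • u) = B (R.v s.hyp) u := by
        rw [hB, hB]; exact hb _ _ _
      rw [s.mem_stab u hu, smul_v_eq s.mem_stab] at h2
      have h3 : B (R.eigenval s.hyp s.1 • R.v s.hyp) u
          = starRingEnd ℂ (R.eigenval s.hyp s.1) * B (R.v s.hyp) u := by
        rw [hB, hB, Finset.mul_sum]
        simp [mul_assoc]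
      rw [h3] at h2
      by_contra hne
      have h4 := mul_right_cancel₀ hne (h2.trans (one_mul _).symm)
      exact eigenval_ne_one (R := R) s
        ((map_eq_one_iff (starRingEnd ℂ) (RingHom.injective _)).1 h4)
    have h5 := h1 _ (sub_mem (R := R) H y)
    rw [map_sub, map_smul, sub_eq_zero] at h5
    rw [h5, smul_eq_mul, mul_comm]
  rw [ι_dvd_iff (R.α_v H), projHom_ι] at hd
  have hK : R.v K = R.α H (R.v K) • R.v H :=
    sub_eq_zero.1 (ι_injective (hd.trans (map_zero _).symm))
  set t := R.α H (R.v K)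
  have ht : t ≠ 0 := by
    intro h0
    rw [h0, zero_smul] at hK
    exact v_ne_zero K hK
  ext y
  rw [← α_eq_zero_iff (R := R), ← α_eq_zero_iff (R := R)]
  have h6 : B (R.v K) y = starRingEnd ℂ t * B (R.v H) y := by
    rw [hK, hB, hB, Finset.mul_sum]
    simp [mul_assoc]
  rw [horth K, horth H] at h6
  have hv : ∀ H, B (R.v H) (R.v H) ≠ 0 := fun H h0 => v_ne_zero H (hB0 _ h0)
  constructor
  · intro h0
    rw [h0, mul_zero, mul_zero] at h6
    exact (mul_eq_zero.1 h6).resolve_left (hv K)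
  · intro h0
    rw [h0, mul_zero, ← mul_assoc] at h6
    exact (mul_eq_zero.1 h6.symm).resolve_left
      (mul_ne_zero ((map_ne_zero _).2 ht) (hv H))

theorem Hyperplane.order_pos (H : Hyperplane W) : 0 < H.order := Nat.card_pos

theorem jacobian_eq [Fintype (Hyperplane W)] :
    jacobian R = ∏ H : Hyperplane W, ι ℂ h (R.v H) ^ (H.order - 1) :=
  finprod_eq_prod_of_fintype _

theorem jacobian_ne_zero : jacobian R ≠ 0 := by
  have := Fintype.ofFinite (Hyperplane W)
  rw [jacobian_eq, Finset.prod_ne_zero_iff]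
  exact fun H _ => pow_ne_zero _ (R.prime_v H).ne_zero

theorem Roots.eigenval_injOn (H : Hyperplane W) {u w : W} (hu : u ∈ H.stab) (hw : w ∈ H.stab)
    (huw : R.eigenval H u = R.eigenval H w) : u = w := by
  apply Subtype.ext
  ext y
  change u • y = w • y
  rw [stab_smul hu, stab_smul hw, huw]

/-- If `p = v_H^k q` with `v_H ∤ q`, comparing `w p` with `det⁻¹(w) p` modulo `v_H` gives `λ^k =
λ⁻¹` for the eigenvalue `λ` of each `w ∈ W_H`. These `e_H` distinct numbers are then roots of unity
of order dividing `k + 1`, so `e_H ≤ k + 1`. -/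
theorem pow_dvd_of_semiinvariant {p : SymmetricAlgebra ℂ h}
    (hp : ∀ w : W, w • p = (detInv W w : ℂ) • p) (H : Hyperplane W) :
    ι ℂ h (R.v H) ^ (H.order - 1) ∣ p := by
  suffices ∀ k ≤ H.order - 1, ι ℂ h (R.v H) ^ k ∣ p from this _ le_rfl
  intro k
  induction k with
  | zero => simp
  | succ k ih =>
    intro hk
    obtain ⟨q, rfl⟩ := ih (by omega)
    rw [pow_succ]
    refine mul_dvd_mul_left _ ?_
    by_contra hq
    rw [ι_dvd_iff (R.α_v H)] at hq
    have key : ∀ w ∈ H.stab, R.eigenval H w ^ (k + 1) = 1 := by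
      intro w hw
      have h1 := hp w
      have hl := Roots.eigenval_ne_zero (R := R) hw
      rw [Roots.detInv_eq (R := R) hw, smul_mul', smul_pow', sym_smul_ι, Roots.smul_v_eq hw,
        map_smul,
        smul_pow, smul_mul_assoc, ← mul_smul_comm, ← mul_smul_comm] at h1
      have h2 := mul_left_cancel₀ (pow_ne_zero _ (R.prime_v H).ne_zero) h1
      have h3 : R.eigenval H w ^ k • projHom (R.α H) (R.v H) (w • q)
          = (R.eigenval H w)⁻¹ • projHom (R.α H) (R.v H) q := by
        rw [← map_smul, ← map_smul, h2]
      rw [projHom_smul hw, eq_inv_smul_iff₀ hl, smul_smul, ← pow_succ'] at h3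
      exact eq_one_of_smul_eq_self hq h3
    have := Fintype.ofFinite H.stab
    have hcard : Finset.card (Finset.univ : Finset H.stab)
        ≤ (Polynomial.nthRoots (k + 1) (1 : ℂ)).toFinset.card := by
      refine Finset.card_le_card_of_injOn (fun w => R.eigenval H w.1) ?_ ?_
      · intro w _
        simpa [Polynomial.mem_nthRoots] using key w w.2
      · intro u _ w _ huw
        exact Subtype.ext (Roots.eigenval_injOn H u.2 w.2 huw)
    have h4 := (hcard.trans (Multiset.toFinset_card_le _)).trans (Polynomial.card_nthRoots _ _)
    rw [Finset.card_univ, ← Nat.card_eq_fintype_card] at h4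
    change H.order ≤ _ at h4
    omega

theorem jacobian_dvd_of_semiinvariant {p : SymmetricAlgebra ℂ h}
    (hp : ∀ w : W, w • p = (detInv W w : ℂ) • p) : jacobian R ∣ p := by
  have := Fintype.ofFinite (Hyperplane W)
  rw [jacobian_eq]
  refine Finset.prod_dvd_of_isRelPrime (fun H _ K _ hHK => ?_) fun H _ =>
    pow_dvd_of_semiinvariant hp H
  refine IsRelPrime.pow ?_
  exact (R.prime_v H).irreducible.isRelPrime_iff_not_dvd.2 fun hd => hHK (R.eq_of_v_dvd hd)

/-- The reflection permutes the factors belonging to the other hyperplanes up to scalars, and scales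
`v_H^(e_H - 1)` by `λ^(e_H - 1) = λ⁻¹ = det⁻¹`. -/
theorem Refl.smul_jacobian (s : Refl W) :
    s.1 • jacobian R = (detInv W s.1 : ℂ) • jacobian R := by
  classical
  have := Fintype.ofFinite (Hyperplane W)
  set H := s.hyp
  have hs : s.1 ∈ H.stab := s.mem_stab
  have hsH : H.image s.1 = H := Hyperplane.image_eq_of_mem_stab hs
  rw [jacobian_eq, ← Finset.mul_prod_erase _ _ (Finset.mem_univ H)]
  set J := ∏ K ∈ Finset.univ.erase H, ι ℂ h (R.v K) ^ (K.order - 1) with hJ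
  choose t ht using fun K => R.smul_v_mem s.1 K
  have h1 : s.1 • J = (∏ K ∈ Finset.univ.erase H, t K ^ (K.order - 1)) • J := by
    have h2 : s.1 • J = ∏ K ∈ Finset.univ.erase H,
        t K ^ (K.order - 1) • ι ℂ h (R.v (K.image s.1)) ^ ((K.image s.1).order - 1) := by
      rw [hJ, smul_finset_prod]
      refine Finset.prod_congr rfl fun K _ => ?_
      rw [smul_pow', sym_smul_ι, ht, map_smul, smul_pow, Hyperplane.order_image]
    rw [h2, Finset.prod_smul, hJ]
    congr 1
    refine Finset.prod_bijective _ (Hyperplane.perm s.1).bijective ?_ fun _ _ => rfl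
    intro K
    rw [Finset.mem_erase, Finset.mem_erase, ← hsH]
    simp only [Finset.mem_univ, and_true]
    rw [hsH]
    conv_rhs => rw [← hsH]
    exact (Hyperplane.perm s.1).injective.ne_iff.symm
  -- The scalar is read off modulo `v_H`, where `s` acts trivially and the remaining product `J` is
  -- nonzero.
  have h3 : ∏ K ∈ Finset.univ.erase H, t K ^ (K.order - 1) = 1 := by
    have h4 : ¬ ι ℂ h (R.v H) ∣ J := by
      rw [hJ, (R.prime_v H).dvd_finsetProd_iff]
      rintro ⟨K, hK, hd⟩
      exact (Finset.mem_erase.1 hK).1 (R.eq_of_v_dvd ((R.prime_v H).dvd_of_dvd_pow hd)).symm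
    rw [ι_dvd_iff (R.α_v H)] at h4
    refine eq_one_of_smul_eq_self h4 ?_
    rw [← map_smul, ← h1, projHom_smul hs]
  have h5 : R.eigenval H s.1 ^ (H.order - 1) = (detInv W s.1 : ℂ) := by
    have h6 : (⟨s.1, hs⟩ : H.stab) ^ H.order = 1 := pow_card_eq_one'
    have h7 : s.1 ^ H.order = 1 := congrArg Subtype.val h6
    have h8 := congrArg (fun u => ((detInv W u : ℂˣ) : ℂ)) h7
    simp only [map_pow, map_one, Units.val_pow_eq_pow_val, Units.val_one] at h8
    rw [Roots.detInv_eq (R := R) hs, inv_pow, inv_eq_one] at h8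
    rw [Roots.detInv_eq (R := R) hs]
    exact eq_inv_of_mul_eq_one_left (by rw [← pow_succ, Nat.sub_add_cancel H.order_pos, h8])
  rw [smul_mul', h1, h3, one_smul, smul_pow', sym_smul_ι, Roots.smul_v_eq hs, map_smul, smul_pow,
    smul_mul_assoc, h5]

theorem smul_jacobian (hW : IsComplexReflectionGroup W) (w : W) :
    w • jacobian R = (detInv W w : ℂ) • jacobian R := by
  have hcl : ∀ u ∈ Subgroup.closure {s | s ∈ W ∧ IsPseudoReflection s}, u ∈ W := by
    rw [hW.2]; exact fun _ => id
  suffices ∀ (u) (hu : u ∈ Subgroup.closure {s | s ∈ W ∧ IsPseudoReflection s}),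
      (⟨u, hcl u hu⟩ : W) • jacobian R = (detInv W ⟨u, hcl u hu⟩ : ℂ) • jacobian R from
    this w (by rw [hW.2]; exact w.2)
  intro u hu
  induction hu using Subgroup.closure_induction with
  | mem s hs => exact Refl.smul_jacobian ⟨⟨s, hs.1⟩, hs.2⟩
  | one =>
    change (1 : W) • jacobian R = (detInv W 1 : ℂ) • jacobian R
    simp
  | mul a b ha hb iha ihb =>
    change ((⟨a, hcl a ha⟩ : W) * ⟨b, hcl b hb⟩) • jacobian R
      = (detInv W (⟨a, hcl a ha⟩ * ⟨b, hcl b hb⟩) : ℂ) • jacobian R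
    rw [mul_smul, ihb, smul_comm, iha, map_mul, Units.val_mul, mul_comm, mul_smul]
  | inv a ha iha =>
    change (⟨a, hcl a ha⟩ : W)⁻¹ • jacobian R = (detInv W (⟨a, hcl a ha⟩)⁻¹ : ℂ) • jacobian R
    rw [inv_smul_eq_iff, map_inv, smul_comm, iha, smul_smul, Units.inv_mul, one_smul]

/-- `D(f)(J)` has the same character as `J`, hence is a multiple of `J`; but `D(f)` lowers the
degree. -/
theorem diffOp_jacobian_of_invariant (hW : IsComplexReflectionGroup W)
    {f : SymmetricAlgebra ℂ (Module.Dual ℂ h)} (hf : ∀ w : W, w • f = f)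
    (hf0 : algebraMapInv f = 0) : diffOp h f (jacobian R) = 0 := by
  refine diffOp_eq_zero_of_dvd hf0 (jacobian_dvd_of_semiinvariant fun w => ?_)
  rw [smul_diffOp, hf, smul_jacobian hW, map_smul]

theorem diffOp_jacobian_of_mem (hW : IsComplexReflectionGroup W)
    {f : SymmetricAlgebra ℂ (Module.Dual ℂ h)} (hf : f ∈ coinvIdeal W (Module.Dual ℂ h)) :
    diffOp h f (jacobian R) = 0 := by
  refine Submodule.span_induction (p := fun f _ => diffOp h f (jacobian R) = 0) ?_ ?_ ?_ ?_ hf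
  · exact fun f hf => diffOp_jacobian_of_invariant hW hf.1 hf.2
  · simp
  · intro f g _ _ h1 h2
    rw [map_add, LinearMap.add_apply, h1, h2, add_zero]
  · intro a f _ h1
    rw [smul_eq_mul, map_mul, Module.End.mul_apply, h1, map_zero]

end Jacobian

/-! ### Coinvariant algebras are finite-dimensional -/

section Finite

open SymmetricAlgebra

variable {h : Type*} [AddCommGroup h] [Module ℂ h] {W : Subgroup (h ≃ₗ[ℂ] h)} [Finite W]
  {V : Type*} [AddCommGroup V] [Module ℂ V] [DistribMulAction W V] [SMulCommClass W ℂ V]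

/-- `v` is a root of `∏ (X - w v)`, whose coefficients below the leading one are invariants without
constant term; modulo the ideal the polynomial becomes `X^|W|`. -/
theorem ι_pow_mem_coinvIdeal (v : V) : ι ℂ V v ^ Nat.card W ∈ coinvIdeal W V := by
  classical
  have := Fintype.ofFinite W
  let P : Polynomial (SymmetricAlgebra ℂ V) :=
    ∏ w : W, (Polynomial.X - Polynomial.C (w • ι ℂ V v))
  have hmonic : P.Monic := Polynomial.monic_prod_X_sub_C _ _
  have hdeg : P.natDegree = Nat.card W := by
    rw [Polynomial.natDegree_finsetProd_X_sub_C_eq_card, Nat.card_eq_fintype_card,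
      Finset.card_univ]
  have heval : P.eval (ι ℂ V v) = 0 := by
    rw [Polynomial.eval_prod]
    exact Finset.prod_eq_zero (Finset.mem_univ 1) (by simp)
  have hcoeff : ∀ k < Nat.card W, P.coeff k ∈ coinvIdeal W V := by
    intro k hk
    refine Ideal.subset_span ⟨fun g => ?_, ?_⟩
    · have h1 : P.map (symMap (V := V) g).toRingHom = P := by
        rw [Polynomial.map_prod]
        refine Fintype.prod_equiv (Equiv.mulLeft g) _ _ fun w => ?_
        rw [Polynomial.map_sub, Polynomial.map_X, Polynomial.map_C]
        change _ - Polynomial.C (g • w • ι ℂ V v) = _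
        rw [smul_smul]; rfl
      conv_rhs => rw [← h1]
      rw [Polynomial.coeff_map]; rfl
    · have h1 : P.map ((algebraMapInv : SymmetricAlgebra ℂ V →ₐ[ℂ] ℂ) :
          SymmetricAlgebra ℂ V →+* ℂ) = Polynomial.X ^ Nat.card W := by
        rw [Polynomial.map_prod, Nat.card_eq_fintype_card, ← Finset.card_univ,
          ← Finset.prod_const]
        refine Finset.prod_congr rfl fun w _ => ?_
        rw [Polynomial.map_sub, Polynomial.map_X, Polynomial.map_C]
        simp [algebraMapInv_ι]
      have h2 := congrArg (fun p => Polynomial.coeff p k) h1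
      simp only [Polynomial.coeff_map, Polynomial.coeff_X_pow, if_neg hk.ne] at h2
      exact h2
  let π := Ideal.Quotient.mk (coinvIdeal W V)
  have hmap : P.map π = Polynomial.X ^ Nat.card W := by
    ext k
    rw [Polynomial.coeff_map, Polynomial.coeff_X_pow]
    rcases lt_trichotomy k (Nat.card W) with hk | hk | hk
    · rw [if_neg hk.ne]; exact Ideal.Quotient.eq_zero_iff_mem.2 (hcoeff k hk)
    · rw [if_pos hk, hk, ← hdeg, hmonic.coeff_natDegree, map_one]
    · rw [if_neg hk.ne', Polynomial.coeff_eq_zero_of_natDegree_lt (hdeg ▸ hk), map_zero]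
  rw [← Ideal.Quotient.eq_zero_iff_mem]
  have h3 : (P.map π).eval (π (ι ℂ V v)) = 0 := by
    rw [Polynomial.eval_map_apply, heval, map_zero]
  rw [hmap] at h3
  rw [map_pow]
  simpa using h3

theorem sub_algebraMapInv_mem_radical (f : SymmetricAlgebra ℂ V) :
    f - algebraMap ℂ _ (algebraMapInv f) ∈ (coinvIdeal W V).radical := by
  induction f using SymmetricAlgebra.induction with
  | algebraMap r => rw [algebraMap_leftInverse _ r, sub_self]; exact zero_mem _
  | ι v => rw [algebraMapInv_ι, map_zero, sub_zero]; exact ⟨_, ι_pow_mem_coinvIdeal v⟩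
  | mul a b ha hb =>
    rw [map_mul, map_mul, show ∀ a b a' b' : SymmetricAlgebra ℂ V, a * b - a' * b'
      = b * (a - a') + a' * (b - b') by intros; ring]
    exact add_mem (Ideal.mul_mem_left _ _ ha) (Ideal.mul_mem_left _ _ hb)
  | add a b ha hb => rw [map_add, map_add, add_sub_add_comm]; exact add_mem ha hb

variable (V) in
/-- The ideal of the elements of `S(V)` without constant term. -/
def augIdeal : Ideal (SymmetricAlgebra ℂ V) :=
  RingHom.ker (algebraMapInv : SymmetricAlgebra ℂ V →ₐ[ℂ] ℂ)

theorem mem_augIdeal {f : SymmetricAlgebra ℂ V} : f ∈ augIdeal V ↔ algebraMapInv f = 0 :=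
  Iff.rfl

variable [FiniteDimensional ℂ V]

instance : Algebra.FiniteType ℂ (SymmetricAlgebra ℂ V) :=
  Algebra.FiniteType.equiv inferInstance (equivMvPolynomial (Module.finBasis ℂ V)).symm

variable (W V) in
-- By noetherianity a power of the radical lies in the ideal. This bounds the descending induction
-- in Steinberg's theorem and gives the `h`-nilpotency needed for costandard modules.
theorem exists_augIdeal_pow_le : ∃ m : ℕ, augIdeal V ^ m ≤ coinvIdeal W V := by
  have : IsNoetherianRing (SymmetricAlgebra ℂ V) := Algebra.FiniteType.isNoetherianRing ℂ _
  obtain ⟨m, hm⟩ := Ideal.exists_radical_pow_le_of_fg (coinvIdeal W V)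
    (IsNoetherian.noetherian _)
  refine ⟨m, (Ideal.pow_right_mono ?_ m).trans hm⟩
  intro f hf
  have := sub_algebraMapInv_mem_radical (W := W) f
  rwa [mem_augIdeal.1 hf, map_zero, sub_zero] at this

/-- The algebra is finitely generated by nilpotent elements, hence integral and finite. -/
instance : Module.Finite ℂ (Coinv W V) := by
  have : Algebra.IsIntegral ℂ (Coinv W V) := ⟨fun x => by
    obtain ⟨f, rfl⟩ := Ideal.Quotient.mk_surjective x
    induction f using SymmetricAlgebra.induction with
    | algebraMap r => exact isIntegral_algebraMap (R := ℂ) (A := Coinv W V) (x := r)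
    | ι v =>
      refine IsIntegral.of_pow (n := Nat.card W) Nat.card_pos ?_
      rw [← map_pow, Ideal.Quotient.eq_zero_iff_mem.2 (ι_pow_mem_coinvIdeal v)]
      exact isIntegral_zero
    | mul a b ha hb => rw [map_mul]; exact ha.mul hb
    | add a b ha hb => rw [map_add]; exact ha.add hb⟩
  exact Algebra.IsIntegral.finite

end Finite

/-! ### Divided differences -/

section DividedDifference

open SymmetricAlgebra

variable {h : Type*} [AddCommGroup h] [Module ℂ h] {W : Subgroup (h ≃ₗ[ℂ] h)} (R : Roots W)

/-- The linear form `x ↦ (1 - s) x / x(v_s)`, a multiple of `α_s`. -/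
def Roots.coroot (s : Refl W) : Module.Dual ℂ h := (1 - R.eigenval s.hyp s.1⁻¹) • R.α s.hyp

theorem Roots.smul_dual (s : Refl W) (x : Module.Dual ℂ h) :
    s.1 • x = x - x (R.v s.hyp) • R.coroot s := by
  rw [smul_dual_eq (R := R) s.mem_stab, coroot, smul_smul, mul_comm]

theorem Roots.coroot_ne_zero (s : Refl W) : R.coroot s ≠ 0 := by
  intro h0
  obtain ⟨y, hy⟩ := s.smul_ne
  apply hy
  rw [← sub_eq_zero, ← Module.forall_dual_apply_eq_zero_iff ℂ]
  intro x
  have h1 := congrArg (fun x : Module.Dual ℂ h => x (s.1 • y)) (R.smul_dual s x)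
  simp only [dual_smul_apply, inv_smul_smul, h0, smul_zero, sub_zero] at h1
  rw [map_sub, h1, sub_self]

theorem ι_coroot_ne_zero (s : Refl W) : ι ℂ _ (R.coroot s) ≠ 0 := fun h0 =>
  R.coroot_ne_zero s (ι_injective (h0.trans (map_zero _).symm))

theorem ι_coroot_dvd (s : Refl W) (p : SymmetricAlgebra ℂ (Module.Dual ℂ h)) :
    ι ℂ _ (R.coroot s) ∣ p - s.1 • p := by
  induction p using SymmetricAlgebra.induction with
  | algebraMap r => rw [smul_algebraMap, sub_self]; exact dvd_zero _
  | ι x =>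
    rw [sym_smul_ι, ← map_sub, R.smul_dual, sub_sub_cancel, map_smul, Algebra.smul_def]
    exact dvd_mul_left _ _
  | mul a b ha hb =>
    rw [smul_mul', show ∀ a b a' b' : SymmetricAlgebra ℂ (Module.Dual ℂ h), a * b - a' * b'
      = a * (b - b') + (a - a') * b' by intros; ring]
    exact dvd_add (hb.mul_left _) (ha.mul_right _)
  | add a b ha hb => rw [smul_add, add_sub_add_comm]; exact dvd_add ha hb

/-- The divided difference `T_s`, with `T_s(x) = x(v_s)` and `T_s(pq) = p T_s(q) + T_s(p) s(q)`. -/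
def divDiff (s : Refl W) :
    SymmetricAlgebra ℂ (Module.Dual ℂ h) →ₗ[ℂ] SymmetricAlgebra ℂ (Module.Dual ℂ h) where
  toFun p := (ι_coroot_dvd R s p).choose
  map_add' p q := by
    apply mul_left_cancel₀ (ι_coroot_ne_zero R s)
    rw [mul_add, ← (ι_coroot_dvd R s _).choose_spec, ← (ι_coroot_dvd R s _).choose_spec,
      ← (ι_coroot_dvd R s _).choose_spec, smul_add, add_sub_add_comm]
  map_smul' z p := by
    apply mul_left_cancel₀ (ι_coroot_ne_zero R s)
    rw [RingHom.id_apply, mul_smul_comm, ← (ι_coroot_dvd R s _).choose_spec,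
      ← (ι_coroot_dvd R s _).choose_spec, smul_comm, smul_sub]

theorem coroot_mul_divDiff (s : Refl W) (p : SymmetricAlgebra ℂ (Module.Dual ℂ h)) :
    ι ℂ _ (R.coroot s) * divDiff R s p = p - s.1 • p := (ι_coroot_dvd R s p).choose_spec.symm

theorem divDiff_of_smul_eq (s : Refl W) {p : SymmetricAlgebra ℂ (Module.Dual ℂ h)}
    (hp : s.1 • p = p) : divDiff R s p = 0 := by
  apply mul_left_cancel₀ (ι_coroot_ne_zero R s)
  rw [coroot_mul_divDiff, hp, sub_self, mul_zero]

@[simp] theorem divDiff_algebraMap (s : Refl W) (z : ℂ) :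
    divDiff R s (algebraMap ℂ _ z) = 0 := divDiff_of_smul_eq R s (smul_algebraMap _ _)

theorem divDiff_mul (s : Refl W) (p q : SymmetricAlgebra ℂ (Module.Dual ℂ h)) :
    divDiff R s (p * q) = p * divDiff R s q + divDiff R s p * s.1 • q := by
  apply mul_left_cancel₀ (ι_coroot_ne_zero R s)
  rw [coroot_mul_divDiff, mul_add, mul_left_comm, coroot_mul_divDiff, ← mul_assoc,
    coroot_mul_divDiff, smul_mul']
  ring

theorem divDiff_ι (s : Refl W) (x : Module.Dual ℂ h) :
    divDiff R s (ι ℂ _ x) = algebraMap ℂ _ (x (R.v s.hyp)) := by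
  apply mul_left_cancel₀ (ι_coroot_ne_zero R s)
  rw [coroot_mul_divDiff, sym_smul_ι, ← map_sub, R.smul_dual, sub_sub_cancel, map_smul,
    Algebra.smul_def, mul_comm]

/-- `T_s` depends on the choice of `v_s`, but `α_s ⊗ T_s` does not; the vector `y` only serves to
evaluate `α_s`. The twisted Leibniz rule reduces the claim to linear forms, where it is
`Roots.α_image_smul_v`. -/
theorem smul_divDiff (w : W) (s : Refl W) (y : h)
    (p : SymmetricAlgebra ℂ (Module.Dual ℂ h)) :
    R.α (s.conj w).hyp (w • y) • divDiff R (s.conj w) (w • p)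
      = R.α s.hyp y • w • divDiff R s p := by
  induction p using SymmetricAlgebra.induction with
  | algebraMap r => simp [smul_algebraMap]
  | ι x =>
    rw [sym_smul_ι, divDiff_ι, divDiff_ι, smul_algebraMap, Algebra.smul_def, Algebra.smul_def,
      ← map_mul, ← map_mul, ← smul_eq_mul, ← smul_eq_mul]
    congr 1
    rw [← map_smul, ← map_smul, Refl.hyp_conj, Roots.α_image_smul_v, dual_smul_apply,
      smul_comm w⁻¹ (R.α s.hyp y), inv_smul_smul]
  | mul a b ha hb =>
    have h1 : (s.conj w).1 • w • b = w • s.1 • b := by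
      rw [smul_smul, smul_smul]
      congr 1
      simp [Refl.conj]
    rw [smul_mul', divDiff_mul, divDiff_mul, h1, smul_add, smul_add, smul_mul', smul_mul',
      ← mul_smul_comm, hb, ← smul_mul_assoc _ (divDiff R (s.conj w) (w • a)), ha, smul_add]
    congr 1
    · rw [mul_smul_comm]
    · rw [← smul_mul_assoc]
  | add a b ha hb => rw [smul_add, map_add, map_add, smul_add, smul_add, smul_add, ha, hb]

/-- `T_s` kills invariants, so the twisted Leibniz rule keeps every term in the ideal. -/
theorem divDiff_mem_coinvIdeal (s : Refl W) {p : SymmetricAlgebra ℂ (Module.Dual ℂ h)}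
    (hp : p ∈ coinvIdeal W (Module.Dual ℂ h)) :
    divDiff R s p ∈ coinvIdeal W (Module.Dual ℂ h) := by
  refine Submodule.span_induction
    (p := fun p _ => divDiff R s p ∈ coinvIdeal W (Module.Dual ℂ h)) ?_ ?_ ?_ ?_ hp
  · intro p hp
    rw [divDiff_of_smul_eq R s (hp.1 s.1)]
    exact zero_mem _
  · rw [map_zero]; exact zero_mem _
  · intro p q _ _ h1 h2
    rw [map_add]; exact add_mem h1 h2
  · intro a p hp h1
    rw [smul_eq_mul, divDiff_mul]
    exact add_mem (Ideal.mul_mem_left _ _ h1)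
      (Ideal.mul_mem_left _ _ (smul_mem_coinvIdeal W _ _ hp))

end DividedDifference

/-! ### Steinberg's theorem and harmonic polynomials -/

section Steinberg

open SymmetricAlgebra

variable {h : Type*} [AddCommGroup h] [Module ℂ h] [FiniteDimensional ℂ h]
  {W : Subgroup (h ≃ₗ[ℂ] h)} [Finite W] {R : Roots W}

theorem star_detInv (w : W) : starRingEnd ℂ (detInv W w : ℂ) = (detInv W w : ℂ)⁻¹ := by
  have h1 : w ^ Nat.card W = 1 := pow_card_eq_one'
  have h2 : (detInv W w : ℂ) ^ Nat.card W = 1 := by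
    rw [← Units.val_pow_eq_pow_val, ← map_pow, h1, map_one, Units.val_one]
  rw [Complex.inv_def, Complex.normSq_eq_norm_sq,
    Complex.norm_eq_one_of_pow_eq_one h2 Nat.card_pos.ne']
  simp

/-- Applying `T_s` to `α_s f` puts `α_s T_s(f) + s f` in the ideal. Since `α_s T_s(f)` is `f - s f`
up to the factor `k = 1 - det⁻¹(s)`, multiplying by `k` gives the claim. -/
theorem detInv_smul_sub_mem_of_reflection (s : Refl W)
    {f : SymmetricAlgebra ℂ (Module.Dual ℂ h)}
    (hf : ι ℂ _ (R.α s.hyp) * f ∈ coinvIdeal W (Module.Dual ℂ h)) :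
    (detInv W s.1 : ℂ) • s.1 • f - f ∈ coinvIdeal W (Module.Dual ℂ h) := by
  have h1 := divDiff_mem_coinvIdeal R s hf
  rw [divDiff_mul, divDiff_ι, R.α_v, map_one, one_mul] at h1
  set k := 1 - R.eigenval s.hyp s.1⁻¹ with hk
  have h2 : k • (ι ℂ _ (R.α s.hyp) * divDiff R s f) = f - s.1 • f := by
    rw [← coroot_mul_divDiff R, Roots.coroot, map_smul, smul_mul_assoc]
  have h3 : 1 - k = (detInv W s.1 : ℂ) := by
    have h4 := congrArg (fun x : Module.Dual ℂ h => x (R.v s.hyp)) (R.smul_dual s (R.α s.hyp))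
    rw [Roots.α_smul_eq s.mem_stab, ← Roots.detInv_eq s.mem_stab, Roots.coroot, ← hk] at h4
    simpa [R.α_v] using h4.symm
  have h5 : (detInv W s.1 : ℂ) • s.1 • f - f
      = -(k • (ι ℂ _ (R.α s.hyp) * divDiff R s f + s.1 • f)) := by
    rw [smul_add, h2, ← h3]
    generalize s.1 • f = g
    module
  rw [h5, Algebra.smul_def]
  exact neg_mem (Ideal.mul_mem_left _ _ h1)

theorem smul_mem_coinvIdeal_of_mem {V : Type*} [AddCommGroup V] [Module ℂ V]
    [DistribMulAction W V] [SMulCommClass W ℂ V] (z : ℂ) {f : SymmetricAlgebra ℂ V}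
    (hf : f ∈ coinvIdeal W V) : z • f ∈ coinvIdeal W V := by
  rw [Algebra.smul_def]; exact Ideal.mul_mem_left _ _ hf

/-- The socle of `S(h*)_W` has character `det`: the condition holds for reflections and passes to
products and inverses because the ideal is `W`-stable. -/
theorem detInv_smul_sub_mem (R : Roots W) (hW : IsComplexReflectionGroup W)
    {f : SymmetricAlgebra ℂ (Module.Dual ℂ h)}
    (hf : ∀ x, ι ℂ _ x * f ∈ coinvIdeal W (Module.Dual ℂ h)) (w : W) :
    (detInv W w : ℂ) • w • f - f ∈ coinvIdeal W (Module.Dual ℂ h) := by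
  have hcl : ∀ u ∈ Subgroup.closure {s | s ∈ W ∧ IsPseudoReflection s}, u ∈ W := by
    rw [hW.2]; exact fun _ => id
  suffices ∀ (u) (hu : u ∈ Subgroup.closure {s | s ∈ W ∧ IsPseudoReflection s}),
      (detInv W ⟨u, hcl u hu⟩ : ℂ) • (⟨u, hcl u hu⟩ : W) • f - f
        ∈ coinvIdeal W (Module.Dual ℂ h) from this w (by rw [hW.2]; exact w.2)
  intro u hu
  induction hu using Subgroup.closure_induction with
  | mem s hs =>
    exact detInv_smul_sub_mem_of_reflection (R := R) ⟨⟨s, hs.1⟩, hs.2⟩ (hf _)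
  | one =>
    change (detInv W 1 : ℂ) • (1 : W) • f - f ∈ _
    simp
  | mul a b ha hb iha ihb =>
    set u : W := ⟨a, hcl a ha⟩
    set v : W := ⟨b, hcl b hb⟩
    change (detInv W (u * v) : ℂ) • (u * v) • f - f ∈ _
    have h1 := smul_mem_coinvIdeal_of_mem (detInv W u : ℂ) (smul_mem_coinvIdeal W _ u ihb)
    have h2 : (detInv W (u * v) : ℂ) • (u * v) • f - f
        = (detInv W u : ℂ) • u • ((detInv W v : ℂ) • v • f - f)
          + ((detInv W u : ℂ) • u • f - f) := by
      rw [smul_sub, smul_sub, map_mul, Units.val_mul, mul_smul, mul_smul u,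
        smul_comm u (detInv W v : ℂ)]
      abel
    rw [h2]
    exact add_mem h1 iha
  | inv a ha iha =>
    set u : W := ⟨a, hcl a ha⟩
    change (detInv W u⁻¹ : ℂ) • u⁻¹ • f - f ∈ _
    have h1 := smul_mem_coinvIdeal_of_mem (detInv W u⁻¹ : ℂ) (smul_mem_coinvIdeal W _ u⁻¹ iha)
    have h2 : (detInv W u⁻¹ : ℂ) • u⁻¹ • f - f
        = -((detInv W u⁻¹ : ℂ) • u⁻¹ • ((detInv W u : ℂ) • u • f - f)) := by
      rw [smul_sub, smul_sub, smul_comm u⁻¹ (detInv W u : ℂ), inv_smul_smul, smul_smul, map_inv,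
        Units.inv_mul, one_smul]
      abel
    rw [h2]
    exact neg_mem h1

theorem pairing_conjEquiv_jacobian_ne_zero {n : Type*} [Fintype n] [DecidableEq n]
    (b : Module.Basis n ℂ h) : pairing (conjEquiv b (jacobian R)) (jacobian R) ≠ 0 :=
  fun h0 => jacobian_ne_zero (eq_zero_of_pairing_conjEquiv b h0)

/-- A `det`-semi-invariant that kills the Jacobian lies in the ideal of coinvariants. -/
theorem mem_coinvIdeal_of_semiinvariant (hW : IsComplexReflectionGroup W)
    {f : SymmetricAlgebra ℂ (Module.Dual ℂ h)}
    (hf : ∀ w : W, w • f = (detInv W w : ℂ)⁻¹ • f) (hfJ : diffOp h f (jacobian R) = 0) :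
    f ∈ coinvIdeal W (Module.Dual ℂ h) := by
  obtain ⟨b, hb⟩ := exists_isUnitaryBasis W
  obtain ⟨p, rfl⟩ := (conjEquiv b).surjective f
  -- Conjugation turns the character `det` on `S(h*)` into `det⁻¹` on `S(h)`, where divisibility by
  -- `J` applies.
  have hp : ∀ w : W, w • p = (detInv W w : ℂ) • p := fun w => by
    apply (conjEquiv b).injective
    rw [conjEquiv_smul_group hb, hf, conjEquiv_smul, star_detInv]
  obtain ⟨q, rfl⟩ := jacobian_dvd_of_semiinvariant (R := R) hp
  have hq : ∀ w : W, w • q = q := fun w => by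
    have h1 := hp w
    rw [smul_mul', smul_jacobian hW, smul_mul_assoc] at h1
    have h2 := (smul_right_injective _ (detInv W w).ne_zero) h1
    exact mul_left_cancel₀ jacobian_ne_zero h2
  set q₀ := algebraMapInv (conjEquiv b q)
  have hmem : conjEquiv b q - algebraMap ℂ _ q₀ ∈ coinvIdeal W (Module.Dual ℂ h) := by
    refine Ideal.subset_span ⟨fun w => ?_, ?_⟩
    · rw [smul_sub, smul_algebraMap, ← conjEquiv_smul_group hb, hq]
    · rw [map_sub, algebraMap_leftInverse _ q₀, sub_self]
  -- Modulo the ideal, which kills `J`, the element `J̄ q̄` is `q₀ J̄`; so `q₀ D(J̄)(J) = 0`, while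
  -- `⟨J̄, J⟩ ≠ 0`.
  have hq₀ : q₀ = 0 := by
    have h1 := diffOp_jacobian_of_mem (R := R) hW
      (Ideal.mul_mem_left _ (conjEquiv b (jacobian R)) hmem)
    rw [mul_sub, map_sub, ← map_mul, LinearMap.sub_apply, hfJ, zero_sub, neg_eq_zero, mul_comm,
      ← Algebra.smul_def, map_smul, LinearMap.smul_apply] at h1
    refine (smul_eq_zero.1 h1).resolve_right fun h0 => ?_
    refine pairing_conjEquiv_jacobian_ne_zero (R := R) b ?_
    rw [pairing, h0, map_zero]
  rw [hq₀, map_zero, sub_zero] at hmem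
  rw [map_mul]
  exact Ideal.mul_mem_left _ _ hmem

/-- **Steinberg's theorem**: the annihilator of the Jacobian is the ideal of coinvariants. -/
theorem diffOp_jacobian_eq_zero_iff (hW : IsComplexReflectionGroup W)
    {f : SymmetricAlgebra ℂ (Module.Dual ℂ h)} :
    diffOp h f (jacobian R) = 0 ↔ f ∈ coinvIdeal W (Module.Dual ℂ h) := by
  refine ⟨fun hf => ?_, diffOp_jacobian_of_mem hW⟩
  have := Fintype.ofFinite W
  obtain ⟨m, hm⟩ := exists_augIdeal_pow_le W (Module.Dual ℂ h)
  -- Descending induction on the power of the augmentation ideal containing `f`: the `m`-th power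
  -- lies in the coinvariant ideal, and multiplying `f` by `x ∈ h*` moves one power deeper while
  -- still killing `J`.
  suffices ∀ j ≤ m, ∀ f ∈ augIdeal (Module.Dual ℂ h) ^ (m - j),
      diffOp h f (jacobian R) = 0 → f ∈ coinvIdeal W (Module.Dual ℂ h) from
    this m le_rfl f (by simp) hf
  intro j
  induction j with
  | zero => exact fun _ f hf _ => hm hf
  | succ j ih =>
    intro hj f hf hfJ
    have hx : ∀ x, ι ℂ _ x * f ∈ coinvIdeal W (Module.Dual ℂ h) := by
      intro x
      refine ih (by omega) _ ?_ (by rw [map_mul, Module.End.mul_apply, hfJ, map_zero])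
      rw [show m - j = m - (j + 1) + 1 by omega, pow_succ']
      exact Ideal.mul_mem_mul (mem_augIdeal.2 (algebraMapInv_ι _)) hf
    -- `f'` is a `det`-semi-invariant and is congruent to `|W| f`, as all its summands are congruent
    -- to `f`.
    set f' := ∑ w : W, (detInv W w : ℂ) • w • f with hf'
    have h1 : f' - (Fintype.card W : ℂ) • f ∈ coinvIdeal W (Module.Dual ℂ h) := by
      have : f' - (Fintype.card W : ℂ) • f = ∑ w : W, ((detInv W w : ℂ) • w • f - f) := by
        rw [Finset.sum_sub_distrib, hf', Finset.sum_const, Finset.card_univ, Nat.cast_smul_eq_nsmul]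
      rw [this]
      exact sum_mem fun w _ => detInv_smul_sub_mem R hW hx w
    have h2 : f' ∈ coinvIdeal W (Module.Dual ℂ h) := by
      refine mem_coinvIdeal_of_semiinvariant (R := R) hW (fun u => ?_) ?_
      · rw [hf', Finset.smul_sum, Finset.smul_sum]
        refine Fintype.sum_equiv (Equiv.mulLeft u) _ _ fun w => ?_
        rw [Equiv.coe_mulLeft, map_mul, Units.val_mul, mul_smul, inv_smul_smul₀
          (detInv W u).ne_zero, smul_comm u, mul_smul]
      · have h3 := diffOp_jacobian_of_mem (R := R) hW h1
        rwa [map_sub, map_smul, LinearMap.sub_apply, LinearMap.smul_apply, hfJ, smul_zero,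
          sub_zero] at h3
    have h3 := smul_mem_coinvIdeal_of_mem (Fintype.card W : ℂ)⁻¹ (sub_mem h2 h1)
    rwa [sub_sub_cancel, inv_smul_smul₀ (Nat.cast_ne_zero.2 Fintype.card_ne_zero)] at h3

theorem eq_zero_of_pairing {g : SymmetricAlgebra ℂ h} (hg : ∀ f, pairing f g = 0) : g = 0 :=
  eq_zero_of_pairing_conjEquiv (Module.finBasis ℂ h) (hg _)

theorem pairing_mul (a b : SymmetricAlgebra ℂ (Module.Dual ℂ h)) (g : SymmetricAlgebra ℂ h) :
    pairing (a * b) g = pairing a (diffOp h b g) := by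
  rw [pairing, map_mul]; rfl

theorem coinvIdeal_map_conjEquiv {n : Type*} [Fintype n] [DecidableEq n]
    {b : Module.Basis n ℂ h} (hb : IsUnitaryBasis W b) :
    coinvIdeal W (Module.Dual ℂ h) = (coinvIdeal W h).map (conjEquiv b) := by
  rw [coinvIdeal, coinvIdeal, Ideal.map_span]
  congr 1
  ext f
  constructor
  · rintro ⟨h1, h2⟩
    obtain ⟨g, rfl⟩ := (conjEquiv b).surjective f
    refine ⟨g, ⟨fun w => (conjEquiv b).injective ?_, ?_⟩, rfl⟩
    · rw [conjEquiv_smul_group hb, h1]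
    · rw [algebraMapInv_conjEquiv] at h2
      exact (map_eq_zero _).1 h2
  · rintro ⟨g, ⟨h1, h2⟩, rfl⟩
    refine ⟨fun w => ?_, ?_⟩
    · change w • conjEquiv b g = conjEquiv b g
      rw [← conjEquiv_smul_group hb, h1]
    · change algebraMapInv (conjEquiv b g) = 0
      rw [algebraMapInv_conjEquiv, h2, map_zero]

variable (W) in
-- Conjugation in a unitary basis matches the two ideals; it is conjugate-linear, which still
-- preserves dimension.
theorem finrank_coinv_dual :
    Module.finrank ℂ (Coinv W (Module.Dual ℂ h)) = Module.finrank ℂ (Coinv W h) := by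
  obtain ⟨b, hb⟩ := exists_isUnitaryBasis W
  let e := Ideal.quotientEquiv _ _ (conjEquiv b) (coinvIdeal_map_conjEquiv hb)
  have h1 : Module.rank ℂ (Coinv W h) = Module.rank ℂ (Coinv W (Module.Dual ℂ h)) := by
    refine rank_eq_of_equiv_equiv (starRingEnd ℂ) e.toAddEquiv
      (starRingAut (R := ℂ)).bijective fun z x => ?_
    obtain ⟨g, rfl⟩ := Ideal.Quotient.mk_surjective x
    change Ideal.Quotient.mk _ (conjEquiv b (z • g)) = _ • Ideal.Quotient.mk _ (conjEquiv b g)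
    rw [conjEquiv_smul]
    rfl
  exact congrArg Cardinal.toNat h1.symm

variable (W) in
/-- The map `Har → S(h)_W`. -/
def harToCoinv : Har W →ₗ[ℂ] Coinv W h :=
  (Ideal.Quotient.mkₐ ℂ (coinvIdeal W h)).toLinearMap ∘ₗ (Har W).subtype

/-- If a harmonic `g` lies in the ideal of `S(h)`, then `ḡ` lies in that of `S(h*)`, so `⟨ḡ, g⟩ =
0`. -/
theorem harToCoinv_injective : Function.Injective (harToCoinv W) := by
  rw [← LinearMap.ker_eq_bot, LinearMap.ker_eq_bot']
  intro g hg
  obtain ⟨b, hb⟩ := exists_isUnitaryBasis W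
  have h1 : conjEquiv b g.1 ∈ coinvIdeal W (Module.Dual ℂ h) := by
    rw [coinvIdeal_map_conjEquiv hb]
    exact Ideal.mem_map_of_mem _ (Ideal.Quotient.eq_zero_iff_mem.1 hg)
  exact Subtype.ext (eq_zero_of_pairing_conjEquiv b (g.2 _ h1))

variable (R) in
/-- The map `S(h*)_W → Har`, `f ↦ D(f)(J)`. -/
def coinvToHar (hW : IsComplexReflectionGroup W) : Coinv W (Module.Dual ℂ h) →ₗ[ℂ] Har W :=
  ((coinvIdeal W (Module.Dual ℂ h)).restrictScalars ℂ).liftQ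
    (LinearMap.codRestrict (Har W) (LinearMap.applyₗ (jacobian R) ∘ₗ (diffOp h).toLinearMap)
      fun f a ha => by
        change pairing a (diffOp h f (jacobian R)) = 0
        rw [← pairing_mul, mul_comm, pairing_mul, diffOp_jacobian_of_mem hW ha, pairing, map_zero,
          map_zero])
    fun f hf => Subtype.ext (diffOp_jacobian_of_mem hW hf)

theorem coinvToHar_injective (hW : IsComplexReflectionGroup W) :
    Function.Injective (coinvToHar R hW) := by
  rw [← LinearMap.ker_eq_bot, LinearMap.ker_eq_bot']
  intro x hx
  obtain ⟨f, rfl⟩ := Ideal.Quotient.mk_surjective x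
  exact Ideal.Quotient.eq_zero_iff_mem.2
    ((diffOp_jacobian_eq_zero_iff hW).1 (congrArg Subtype.val hx))

instance : Module.Finite ℂ (Har W) :=
  Module.Finite.of_injective (harToCoinv W) harToCoinv_injective

/-- `Har` embeds in `S(h)_W` and contains a copy of `S(h*)_W` by `f ↦ D(f)(J)`; the outer dimensions
agree. -/
theorem finrank_har (R : Roots W) (hW : IsComplexReflectionGroup W) :
    Module.finrank ℂ (Har W) = Module.finrank ℂ (Coinv W h) := by
  refine le_antisymm (LinearMap.finrank_le_finrank_of_injective harToCoinv_injective) ?_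
  rw [← finrank_coinv_dual]
  exact LinearMap.finrank_le_finrank_of_injective (coinvToHar_injective (R := R) hW)

/-- The isomorphism `Har ≃ S(h)_W`. -/
def harEquiv (R : Roots W) (hW : IsComplexReflectionGroup W) : Har W ≃ₗ[ℂ] Coinv W h :=
  LinearEquiv.ofBijective (harToCoinv W) ⟨harToCoinv_injective,
    (LinearMap.injective_iff_surjective_of_finrank_eq_finrank (finrank_har R hW)).1
      harToCoinv_injective⟩

theorem harEquiv_apply (hW : IsComplexReflectionGroup W) (g : Har W) :
    harEquiv R hW g = Ideal.Quotient.mk (coinvIdeal W h) g.1 := rfl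

variable (R) in
/-- The bilinear form `(a, b) ↦ ⟨a b, J⟩` on `S(h*)_W`. -/
def coinvForm (hW : IsComplexReflectionGroup W) :
    Coinv W (Module.Dual ℂ h) →ₗ[ℂ] Module.Dual ℂ (Coinv W (Module.Dual ℂ h)) :=
  LinearMap.compr₂ (LinearMap.mul ℂ (Coinv W (Module.Dual ℂ h)))
    (algebraMapInv.toLinearMap ∘ₗ (Har W).subtype ∘ₗ coinvToHar R hW)

theorem coinvForm_mk (hW : IsComplexReflectionGroup W)
    (a b : SymmetricAlgebra ℂ (Module.Dual ℂ h)) :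
    coinvForm R hW (Ideal.Quotient.mk _ a) (Ideal.Quotient.mk _ b)
      = pairing (a * b) (jacobian R) := rfl

/-- If `⟨ab, J⟩ = 0` for all `b`, then `D(a)(J)` pairs to zero with everything, hence vanishes, and
Steinberg's theorem applies. -/
theorem coinvForm_injective (hW : IsComplexReflectionGroup W) :
    Function.Injective (coinvForm R hW) := by
  rw [← LinearMap.ker_eq_bot, LinearMap.ker_eq_bot']
  intro x hx
  obtain ⟨a, rfl⟩ := Ideal.Quotient.mk_surjective x
  refine Ideal.Quotient.eq_zero_iff_mem.2 ((diffOp_jacobian_eq_zero_iff (R := R) hW).1 ?_)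
  refine eq_zero_of_pairing fun b => ?_
  rw [← pairing_mul, mul_comm, ← coinvForm_mk hW, hx]
  rfl

variable (R) in
/-- The isomorphism of `S(h*)_W` with its dual space. -/
def coinvDualEquiv (hW : IsComplexReflectionGroup W) :
    Coinv W (Module.Dual ℂ h) ≃ₗ[ℂ] Module.Dual ℂ (Coinv W (Module.Dual ℂ h)) :=
  LinearEquiv.ofBijective (coinvForm R hW) ⟨coinvForm_injective hW,
    (LinearMap.injective_iff_surjective_of_finrank_eq_finrank
      Subspace.dual_finrank_eq.symm).1 (coinvForm_injective hW)⟩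

/-- The twist compensates exactly for the character `det⁻¹` of `J`. -/
theorem coinvForm_smul (hW : IsComplexReflectionGroup W) (w : W)
    (a b : Coinv W (Module.Dual ℂ h)) :
    coinvForm R hW (twist (coinvRep W (Module.Dual ℂ h)) (detInv W) w a)
        (coinvRep W (Module.Dual ℂ h) w b)
      = coinvForm R hW a b := by
  obtain ⟨a, rfl⟩ := Ideal.Quotient.mk_surjective a
  obtain ⟨b, rfl⟩ := Ideal.Quotient.mk_surjective b
  have h1 : twist (coinvRep W (Module.Dual ℂ h)) (detInv W) w (Ideal.Quotient.mk _ a)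
      = Ideal.Quotient.mk _ ((detInv W w : ℂ) • w • a) := rfl
  rw [h1, coinvRep_mk, coinvForm_mk, coinvForm_mk, smul_mul_assoc, ← smul_mul',
    pairing_smul_left, ← pairing_smul_right, ← smul_jacobian hW, pairing_smul]

end Steinberg

/-! ### Dunkl operators -/

section Dunkl

open SymmetricAlgebra TensorProduct

variable {h : Type*} [AddCommGroup h] [Module ℂ h] {W : Subgroup (h ≃ₗ[ℂ] h)}
  {N : Type*} [AddCommGroup N] [Module ℂ N]

theorem smul_dirDeriv_eval (w : W) (ξ : h) (p : SymmetricAlgebra ℂ (Module.Dual ℂ h)) :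
    w • dirDeriv (Module.Dual.eval ℂ h ξ) p
      = dirDeriv (Module.Dual.eval ℂ h (w • ξ)) (w • p) := by
  induction p using SymmetricAlgebra.induction with
  | algebraMap r => rw [smul_algebraMap, dirDeriv_algebraMap, dirDeriv_algebraMap, smul_zero]
  | ι x => rw [sym_smul_ι, dirDeriv_ι, dirDeriv_ι, smul_algebraMap]; simp
  | mul a b ha hb =>
    rw [dirDeriv_mul, smul_mul', dirDeriv_mul, smul_add, smul_mul', smul_mul', ha, hb]
  | add a b ha hb => rw [map_add, smul_add, ha, hb, smul_add, map_add]

variable (N) in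
/-- Multiplication by `x ∈ h*` on `S(h*) ⊗ N`. -/
def mulOp : Module.Dual ℂ h →ₗ[ℂ] Module.End ℂ (SymmetricAlgebra ℂ (Module.Dual ℂ h) ⊗[ℂ] N) :=
  LinearMap.rTensorHom N ∘ₗ LinearMap.mul ℂ _ ∘ₗ ι ℂ (Module.Dual ℂ h)

@[simp] theorem mulOp_tmul (x : Module.Dual ℂ h) (p : SymmetricAlgebra ℂ (Module.Dual ℂ h))
    (n : N) : mulOp N x (p ⊗ₜ n) = (ι ℂ _ x * p) ⊗ₜ n := rfl

/-- The diagonal action of `W` on `S(h*) ⊗ N`. -/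
def diagRep (σ : Representation ℂ W N) :
    W →* Module.End ℂ (SymmetricAlgebra ℂ (Module.Dual ℂ h) ⊗[ℂ] N) :=
  (symRep W (Module.Dual ℂ h)).tprod σ

@[simp] theorem diagRep_tmul (σ : Representation ℂ W N) (w : W)
    (p : SymmetricAlgebra ℂ (Module.Dual ℂ h)) (n : N) :
    diagRep σ w (p ⊗ₜ n) = (w • p) ⊗ₜ σ w n := rfl

variable [Fintype (Refl W)] (R : Roots W) (c : Refl W → ℂ)
  (η : h →ₗ[ℂ] Module.End ℂ N) (σ : Representation ℂ W N)

/-- The Dunkl operators on `S(h*) ⊗ N`. -/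
def dunkl : h →ₗ[ℂ] Module.End ℂ (SymmetricAlgebra ℂ (Module.Dual ℂ h) ⊗[ℂ] N) :=
  LinearMap.lTensorHom _ ∘ₗ η + LinearMap.rTensorHom N ∘ₗ derivLin ∘ₗ Module.Dual.eval ℂ h
    + ∑ s : Refl W, (c s • R.α s.hyp).smulRight (TensorProduct.map (divDiff R s) (σ s.1))

theorem dunkl_tmul (ξ : h) (p : SymmetricAlgebra ℂ (Module.Dual ℂ h)) (n : N) :
    dunkl R c η σ ξ (p ⊗ₜ n) = p ⊗ₜ η ξ n + dirDeriv (Module.Dual.eval ℂ h ξ) p ⊗ₜ n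
      + ∑ s : Refl W, (c s * R.α s.hyp ξ) • (divDiff R s p ⊗ₜ σ s.1 n) := by
  simp only [dunkl, LinearMap.add_apply, LinearMap.sum_apply, LinearMap.smulRight_apply,
    LinearMap.smul_apply, smul_eq_mul, TensorProduct.map_tmul]
  rfl

theorem dunkl_algebraMap_tmul (ξ : h) (z : ℂ) (n : N) :
    dunkl R c η σ ξ (algebraMap ℂ _ z ⊗ₜ n) = algebraMap ℂ _ z ⊗ₜ η ξ n := by
  simp [dunkl_tmul]

/-- The derivative contributes `x(ξ)` by the Leibniz rule, and each `T_s` contributes `x(v_s) s` by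
its twisted version. -/
theorem dunkl_mulOp (ξ : h) (x : Module.Dual ℂ h) :
    dunkl R c η σ ξ * mulOp N x = mulOp N x * dunkl R c η σ ξ
      + (x ξ • 1 + ∑ s : Refl W, (c s * R.α s.hyp ξ * x (R.v s.hyp)) • diagRep σ s.1) := by
  refine TensorProduct.ext' fun p n => ?_
  simp only [Module.End.mul_apply, LinearMap.add_apply, LinearMap.sum_apply, LinearMap.smul_apply,
    Module.End.one_apply, mulOp_tmul, diagRep_tmul, dunkl_tmul, map_add, map_sum, map_smul,
    dirDeriv_mul, dirDeriv_ι, divDiff_mul, divDiff_ι, TensorProduct.add_tmul, smul_add,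
    Finset.sum_add_distrib]
  rw [Module.Dual.eval_apply, ← Algebra.smul_def, ← TensorProduct.smul_tmul']
  simp only [← Algebra.smul_def, ← TensorProduct.smul_tmul', smul_smul]
  abel

theorem diagRep_mulOp (w : W) (x : Module.Dual ℂ h) :
    diagRep σ w * mulOp N x = mulOp N (w • x) * diagRep σ w := by
  refine TensorProduct.ext' fun p n => ?_
  simp [smul_mul']

/-- By the Jacobi identity `[[a, b], x] = [a, T] - [b, S]`, and both terms equal `Z`. -/
theorem commutator_comm {A : Type*} [Ring A] [Algebra ℂ A] {a b x S T Z : A} {y z : ℂ}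
    (ha : a * x = x * a + (y • 1 + S)) (hb : b * x = x * b + (z • 1 + T))
    (haT : a * T = T * a + Z) (hbS : b * S = S * b + Z) :
    (a * b - b * a) * x = x * (a * b - b * a) := by
  have h1 : (a * b - b * a) * x = a * (b * x) - b * (a * x) := by noncomm_ring
  rw [h1, ha, hb]
  simp only [mul_add]
  rw [← mul_assoc a x b, ← mul_assoc b x a, ha, hb, haT, hbS]
  simp only [add_mul, mul_smul_comm, smul_mul_assoc, mul_one, one_mul, mul_sub, mul_assoc]
  abel

theorem mul_smul_eq_of_commutator {A : Type*} [Ring A] [Algebra ℂ A] {d y z : A} {k : ℂ}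
    (hd : d * y = y * d - k • (z * d)) (r : ℂ) :
    y * (r • d) = (r • d) * y + (r * k) • (z * d) := by
  rw [smul_mul_assoc, hd, smul_sub, smul_smul, mul_smul_comm, sub_add_cancel]

variable {c η σ}

/-- Conjugation by `w` permutes the reflections and preserves `c`; the terms are matched by
`smul_divDiff`. -/
theorem diagRep_dunkl (hc : ∀ s t : Refl W, IsConj s.1 t.1 → c s = c t)
    (hση : ∀ (w : W) (ξ : h), σ w * η ξ = η (w • ξ) * σ w) (w : W) (ξ : h) :
    diagRep σ w * dunkl R c η σ ξ = dunkl R c η σ (w • ξ) * diagRep σ w := by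
  refine TensorProduct.ext' fun p n => ?_
  have h1 : ∀ (w : W) (ξ : h) (n : N), σ w (η ξ n) = η (w • ξ) (σ w n) := fun w ξ n =>
    LinearMap.congr_fun (hση w ξ) n
  have h2 : ∀ u v : W, ∀ n : N, σ u (σ v n) = σ (u * v) n := fun u v n => by
    rw [map_mul]; rfl
  simp only [Module.End.mul_apply, diagRep_tmul, dunkl_tmul, map_add, map_sum, map_smul, h1,
    smul_dirDeriv_eval]
  congr 1
  refine Fintype.sum_bijective (Refl.conj w) ?_ _ _ fun s => ?_
  · refine Function.bijective_iff_has_inverse.2 ⟨Refl.conj w⁻¹, fun s => ?_, fun s => ?_⟩ <;>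
    exact Subtype.ext (by simp [Refl.conj, mul_assoc])
  · have h3 : c (s.conj w) = c s := (hc _ _ (isConj_iff.2 ⟨w, rfl⟩)).symm
    have h4 : w * s.1 = (s.conj w).1 * w := by simp [Refl.conj]
    rw [h3, mul_smul, mul_smul, h2, h2, h4]
    congr 1
    rw [TensorProduct.smul_tmul', TensorProduct.smul_tmul', smul_divDiff]

/-- The commutator of two Dunkl operators commutes with multiplication by `h*`, so it suffices that
it vanishes on `1 ⊗ N`, where the operators reduce to the commuting `η`. -/
theorem dunkl_comm (hη : ∀ ξ₁ ξ₂ : h, η ξ₁ * η ξ₂ = η ξ₂ * η ξ₁)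
    (hc : ∀ s t : Refl W, IsConj s.1 t.1 → c s = c t)
    (hση : ∀ (w : W) (ξ : h), σ w * η ξ = η (w • ξ) * σ w) (ξ₁ ξ₂ : h) :
    dunkl R c η σ ξ₁ * dunkl R c η σ ξ₂ = dunkl R c η σ ξ₂ * dunkl R c η σ ξ₁ := by
  set Y := dunkl R c η σ with hY
  have key : ∀ x, (Y ξ₁ * Y ξ₂ - Y ξ₂ * Y ξ₁) * mulOp N x
      = mulOp N x * (Y ξ₁ * Y ξ₂ - Y ξ₂ * Y ξ₁) := by
    intro x
    have hS : ∀ ξ ξ' : h, Y ξ * ∑ s : Refl W, (c s * R.α s.hyp ξ' * x (R.v s.hyp)) • diagRep σ s.1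
        = (∑ s : Refl W, (c s * R.α s.hyp ξ' * x (R.v s.hyp)) • diagRep σ s.1) * Y ξ
          + ∑ s : Refl W, ((c s * R.α s.hyp ξ' * x (R.v s.hyp))
            * ((1 - R.eigenval s.hyp s.1) * R.α s.hyp ξ)) • (Y (R.v s.hyp) * diagRep σ s.1) := by
      intro ξ ξ'
      rw [Finset.mul_sum, Finset.sum_mul, ← Finset.sum_add_distrib]
      refine Finset.sum_congr rfl fun s _ => ?_
      have h1 : diagRep σ s.1 * Y ξ = Y ξ * diagRep σ s.1
          - ((1 - R.eigenval s.hyp s.1) * R.α s.hyp ξ) • (Y (R.v s.hyp) * diagRep σ s.1) := by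
        rw [hY, diagRep_dunkl R hc hση, Roots.stab_smul (R := R) s.mem_stab ξ, map_sub, map_smul,
          sub_mul (dunkl R c η σ ξ), smul_mul_assoc]
      exact mul_smul_eq_of_commutator
        (A := Module.End ℂ (SymmetricAlgebra ℂ (Module.Dual ℂ h) ⊗[ℂ] N)) h1 _
    have h1 := dunkl_mulOp R c η σ ξ₁ x
    have h2 := dunkl_mulOp R c η σ ξ₂ x
    have hS1 := hS ξ₁ ξ₂
    have hS2 := hS ξ₂ ξ₁
    rw [← hY] at h1 h2
    -- The error term contains `ξ₁` and `ξ₂` only through `α_s(ξ₁) α_s(ξ₂)`; this symmetry is the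
    -- hypothesis of `commutator_comm`.
    have hsymm : ∑ s : Refl W, ((c s * R.α s.hyp ξ₂ * x (R.v s.hyp))
            * ((1 - R.eigenval s.hyp s.1) * R.α s.hyp ξ₁)) • (Y (R.v s.hyp) * diagRep σ s.1)
        = ∑ s : Refl W, ((c s * R.α s.hyp ξ₁ * x (R.v s.hyp))
            * ((1 - R.eigenval s.hyp s.1) * R.α s.hyp ξ₂)) • (Y (R.v s.hyp) * diagRep σ s.1) := by
      refine Finset.sum_congr rfl fun s _ => ?_
      congr 1
      ring
    rw [hsymm] at hS1
    exact commutator_comm (A := Module.End ℂ (SymmetricAlgebra ℂ (Module.Dual ℂ h) ⊗[ℂ] N))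
      h1 h2 hS1 hS2
  rw [← sub_eq_zero]
  refine TensorProduct.ext' fun p n => ?_
  rw [LinearMap.zero_apply]
  induction p using sym_induction_mul_ι with
  | scalar z =>
    rw [LinearMap.sub_apply, Module.End.mul_apply, Module.End.mul_apply, hY,
      dunkl_algebraMap_tmul, dunkl_algebraMap_tmul, dunkl_algebraMap_tmul, dunkl_algebraMap_tmul,
      ← Module.End.mul_apply, hη, Module.End.mul_apply, sub_self]
  | add a b ha hb => rw [TensorProduct.add_tmul, map_add, ha, hb, add_zero]
  | mul a v ha =>
    have h1 := LinearMap.congr_fun (key v) (a ⊗ₜ n)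
    rw [Module.End.mul_apply, Module.End.mul_apply, mulOp_tmul, ha, map_zero] at h1
    rw [mul_comm]
    exact h1

theorem mulOp_comm (x₁ x₂ : Module.Dual ℂ h) :
    mulOp N x₁ * mulOp N x₂ = mulOp N x₂ * mulOp N x₁ := by
  refine TensorProduct.ext' fun p n => ?_
  simp only [Module.End.mul_apply, mulOp_tmul, mul_left_comm]

theorem tensor_lift_smul (hc : ∀ s t : Refl W, IsConj s.1 t.1 → c s = c t)
    (hση : ∀ (w : W) (ξ : h), σ w * η ξ = η (w • ξ) * σ w) (w : W)
    (t : TensorAlgebra ℂ (h × Module.Dual ℂ h)) :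
    TensorAlgebra.lift ℂ ((dunkl R c η σ).coprod (mulOp N)) (w • t) * diagRep σ w
      = diagRep σ w * TensorAlgebra.lift ℂ ((dunkl R c η σ).coprod (mulOp N)) t := by
  induction t using TensorAlgebra.induction with
  | algebraMap r => rw [smul_algebraMap, AlgHom.commutes]; exact Algebra.commutes _ _
  | ι v =>
    rw [tensor_smul_ι, TensorAlgebra.lift_ι_apply, TensorAlgebra.lift_ι_apply,
      LinearMap.coprod_apply, LinearMap.coprod_apply, mul_add, diagRep_dunkl R hc hση,
      diagRep_mulOp, add_mul]
    rfl
  | mul a b ha hb =>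
    rw [smul_mul', map_mul, mul_assoc, hb, ← mul_assoc, ha, map_mul, mul_assoc]
  | add a b ha hb => rw [smul_add, map_add, add_mul, ha, hb, map_add, mul_add]

/-- The action of `T(h ⊕ h*) ⋊ W` on `S(h*) ⊗ N` by Dunkl operators. -/
def tensorDunkl (hc : ∀ s t : Refl W, IsConj s.1 t.1 → c s = c t)
    (hση : ∀ (w : W) (ξ : h), σ w * η ξ = η (w • ξ) * σ w) :
    TSmash W →ₐ[ℂ] Module.End ℂ (SymmetricAlgebra ℂ (Module.Dual ℂ h) ⊗[ℂ] N) :=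
  SkewMonoidAlgebra.liftNCAlgHom (TensorAlgebra.lift ℂ ((dunkl R c η σ).coprod (mulOp N)))
    (diagRep σ) (tensor_lift_smul R hc hση _ _)

theorem tensorDunkl_single (hc : ∀ s t : Refl W, IsConj s.1 t.1 → c s = c t)
    (hση : ∀ (w : W) (ξ : h), σ w * η ξ = η (w • ξ) * σ w) (w : W)
    (t : TensorAlgebra ℂ (h × Module.Dual ℂ h)) :
    tensorDunkl R hc hση (SkewMonoidAlgebra.single w t)
      = TensorAlgebra.lift ℂ ((dunkl R c η σ).coprod (mulOp N)) t * diagRep σ w :=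
  SkewMonoidAlgebra.liftNC_single _ _ _ _

theorem tensorDunkl_tY (hc : ∀ s t : Refl W, IsConj s.1 t.1 → c s = c t)
    (hση : ∀ (w : W) (ξ : h), σ w * η ξ = η (w • ξ) * σ w) (ξ : h) :
    tensorDunkl R hc hση (tY ξ) = dunkl R c η σ ξ := by
  rw [tY, tensorDunkl_single, TensorAlgebra.lift_ι_apply, map_one, mul_one,
    LinearMap.coprod_apply, map_zero, add_zero]

theorem tensorDunkl_tX (hc : ∀ s t : Refl W, IsConj s.1 t.1 → c s = c t)
    (hση : ∀ (w : W) (ξ : h), σ w * η ξ = η (w • ξ) * σ w) (x : Module.Dual ℂ h) :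
    tensorDunkl R hc hση (tX x) = mulOp N x := by
  rw [tX, tensorDunkl_single, TensorAlgebra.lift_ι_apply, map_one, mul_one,
    LinearMap.coprod_apply, map_zero, zero_add]

theorem tensorDunkl_tW (hc : ∀ s t : Refl W, IsConj s.1 t.1 → c s = c t)
    (hση : ∀ (w : W) (ξ : h), σ w * η ξ = η (w • ξ) * σ w) (w : W) :
    tensorDunkl R hc hση (tW w) = diagRep σ w := by
  rw [tW, tensorDunkl_single, map_one, one_mul]

theorem tensorDunkl_rel (hη : ∀ ξ₁ ξ₂ : h, η ξ₁ * η ξ₂ = η ξ₂ * η ξ₁)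
    (hc : ∀ s t : Refl W, IsConj s.1 t.1 → c s = c t)
    (hση : ∀ (w : W) (ξ : h), σ w * η ξ = η (w • ξ) * σ w) ⦃a b : TSmash W⦄
    (hab : Rel R c a b) : tensorDunkl R hc hση a = tensorDunkl R hc hση b := by
  induction hab with
  | yy ξ₁ ξ₂ =>
    rw [map_sub, map_mul, map_mul, map_zero, tensorDunkl_tY, tensorDunkl_tY,
      dunkl_comm R hη hc hση, sub_self]
  | xx x₁ x₂ =>
    rw [map_sub, map_mul, map_mul, map_zero, tensorDunkl_tX, tensorDunkl_tX, mulOp_comm, sub_self]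
  | yx ξ x =>
    rw [map_sub, map_mul, map_mul, tensorDunkl_tY, tensorDunkl_tX]
    refine (sub_eq_of_eq_add' (dunkl_mulOp R c η σ ξ x)).trans ?_
    rw [finsum_eq_sum_of_fintype, map_add, map_sum, AlgHom.commutes,
      Algebra.algebraMap_eq_smul_one]
    simp only [map_smul, tensorDunkl_tW]

/-- The action of `H_c` on `S(h*) ⊗ N` by Dunkl operators. -/
def dunklRep (hη : ∀ ξ₁ ξ₂ : h, η ξ₁ * η ξ₂ = η ξ₂ * η ξ₁)
    (hc : ∀ s t : Refl W, IsConj s.1 t.1 → c s = c t)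
    (hση : ∀ (w : W) (ξ : h), σ w * η ξ = η (w • ξ) * σ w) :
    RCA R c →ₐ[ℂ] Module.End ℂ (SymmetricAlgebra ℂ (Module.Dual ℂ h) ⊗[ℂ] N) :=
  RingQuot.liftAlgHom ℂ ⟨tensorDunkl R hc hση, tensorDunkl_rel R hη hc hση⟩

section

variable (hη : ∀ ξ₁ ξ₂ : h, η ξ₁ * η ξ₂ = η ξ₂ * η ξ₁)
  (hc : ∀ s t : Refl W, IsConj s.1 t.1 → c s = c t)
  (hση : ∀ (w : W) (ξ : h), σ w * η ξ = η (w • ξ) * σ w)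

theorem dunklRep_toRCA (t : TSmash W) :
    dunklRep R hη hc hση (toRCA R c t) = tensorDunkl R hc hση t :=
  RingQuot.liftAlgHom_mkAlgHom_apply ℂ _ _ _

theorem dunklRep_wHom (w : W) : dunklRep R hη hc hση (wHom R c w) = diagRep σ w :=
  (dunklRep_toRCA R hη hc hση _).trans (tensorDunkl_tW R hc hση w)

theorem dunklRep_yLin (ξ : h) : dunklRep R hη hc hση (yLin R c ξ) = dunkl R c η σ ξ :=
  (dunklRep_toRCA R hη hc hση _).trans (tensorDunkl_tY R hc hση ξ)

theorem dunklRep_xLin (x : Module.Dual ℂ h) :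
    dunklRep R hη hc hση (xLin R c x) = mulOp N x :=
  (dunklRep_toRCA R hη hc hση _).trans (tensorDunkl_tX R hc hση x)

theorem dunklRep_symX (p q : SymmetricAlgebra ℂ (Module.Dual ℂ h)) (n : N) :
    dunklRep R hη hc hση (symX R c p) (q ⊗ₜ n) = (p * q) ⊗ₜ n := by
  induction p using SymmetricAlgebra.induction generalizing q with
  | algebraMap r =>
    rw [AlgHom.commutes, AlgHom.commutes, Module.algebraMap_end_apply, ← Algebra.smul_def]; rfl
  | ι x => rw [symX, symLift_ι, dunklRep_xLin, mulOp_tmul]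
  | mul a b ha hb => rw [map_mul, map_mul, Module.End.mul_apply, hb, ha, mul_assoc]
  | add a b ha hb =>
    rw [map_add, map_add, LinearMap.add_apply, ha, hb, add_mul, TensorProduct.add_tmul]

theorem dunklRep_yLin_one_tmul (ξ : h) (n : N) :
    dunklRep R hη hc hση (yLin R c ξ) (1 ⊗ₜ n) = 1 ⊗ₜ η ξ n := by
  rw [dunklRep_yLin, ← map_one (algebraMap ℂ _), dunkl_algebraMap_tmul]

end

end Dunkl

/-! ### Homomorphisms from standard to costandard modules -/

section Adjunction

open SymmetricAlgebra TensorProduct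

variable {h : Type*} [AddCommGroup h] [Module ℂ h] {W : Subgroup (h ≃ₗ[ℂ] h)}
  (R : Roots W) (c : Refl W → ℂ)

theorem smashX_single (w : W) (p : SymmetricAlgebra ℂ (Module.Dual ℂ h)) :
    smashX R c (SkewMonoidAlgebra.single w p) = symX R c p * wHom R c w :=
  SkewMonoidAlgebra.liftNC_single _ _ _ _

theorem smashY_single (w : W) (g : SymmetricAlgebra ℂ h) :
    smashY R c (SkewMonoidAlgebra.single w g) = symY R c g * wHom R c w :=
  SkewMonoidAlgebra.liftNC_single _ _ _ _

theorem coinvAction_single (w : W) (g : SymmetricAlgebra ℂ h) (m : Coinv W h) :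
    coinvAction W h (SkewMonoidAlgebra.single w g) m
      = Ideal.Quotient.mk _ g * coinvRep W h w m :=
  smashAction_single _ _ w g m

theorem coinvTwistAction_single (w : W) (p : SymmetricAlgebra ℂ (Module.Dual ℂ h))
    (m : Coinv W (Module.Dual ℂ h)) :
    coinvTwistAction W (Module.Dual ℂ h) (detInv W) (SkewMonoidAlgebra.single w p) m
      = Ideal.Quotient.mk _ p * twist (coinvRep W (Module.Dual ℂ h)) (detInv W) w m :=
  smashAction_single _ _ w p m

section Uniqueness

variable {M : Type*} [AddCommGroup M] [Module ℂ M]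
  (τ : Smash W (Module.Dual ℂ h) →ₐ[ℂ] Module.End ℂ M)

/-- An element of `Hom_{S(h*) ⋊ W}(H_c, M)` is determined by its values on `S(h)`. -/
theorem Coind.eq_zero {f : Coind R c τ} (hf : ∀ g, f.1 (symY R c g) = 0) : f = 0 := by
  -- The functionals vanishing on `S(h)` are shown to be stable under `H_c`; evaluating `a • f` at
  -- `1` then gives `f(a) = 0`. Stability need only be checked on generators.
  suffices H : ∀ (a : RCA R c) (f : Coind R c τ), (∀ g, f.1 (symY R c g) = 0) →
      ∀ g, (a • f).1 (symY R c g) = 0 by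
    refine Subtype.ext (LinearMap.ext fun a => ?_)
    have := H a f hf 1
    rwa [Coind.smul_apply, map_one, one_mul] at this
  intro a
  have hw : ∀ (w : W) (f : Coind R c τ), (∀ g, f.1 (symY R c g) = 0) →
      ∀ g, f.1 (symY R c g * wHom R c w) = 0 := by
    intro w f hf g
    have h1 : symY R c g * wHom R c w
        = smashX R c (SkewMonoidAlgebra.single w 1) * symY R c (w⁻¹ • g) := by
      rw [smashX_single, map_one, one_mul, ← symY_smul, smul_inv_smul]
    rw [h1, f.2, hf, map_zero]
  induction a using RCA.induction with
  | scalar z =>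
    intro f hf g
    rw [Coind.smul_apply, ← Algebra.commutes, ← Algebra.smul_def, map_smul, hf, smul_zero]
  | y ξ =>
    intro f hf g
    have h1 : symY R c g * yLin R c ξ = symY R c (g * ι ℂ h ξ) := by
      rw [map_mul, symY, symLift_ι]
    rw [Coind.smul_apply, h1, hf]
  | x u =>
    intro f hf g
    rw [Coind.smul_apply]
    induction g using sym_induction_mul_ι generalizing f with
    | scalar z =>
      have h1 : symY R c (algebraMap ℂ _ z) * xLin R c u
          = smashX R c (SkewMonoidAlgebra.single 1 (ι ℂ _ u)) * symY R c (algebraMap ℂ _ z) := by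
        rw [smashX_single, map_one, mul_one, symX, symLift_ι, AlgHom.commutes]
        exact Algebra.commutes _ _
      rw [h1, f.2, hf, map_zero]
    | add a b ha hb => rw [map_add, add_mul, map_add, ha f hf, hb f hf, add_zero]
    | mul a v ha =>
      have h1 : ∀ ξ, symY R c (ι ℂ h ξ) = yLin R c ξ := fun ξ => by rw [symY, symLift_ι]
      rw [map_mul (symY R c), h1, mul_assoc, yLin_xLin, mul_add, map_add, ← mul_assoc]
      -- Moving `x` to the left past the last factor `v` of `g` leaves this term, which is a value
      -- of `v • f`. That functional also vanishes on `S(h)`, which is why `f` is generalized in the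
      -- induction.
      have h2 : f.1 (symY R c a * xLin R c u * yLin R c v) = 0 := by
        rw [← Coind.smul_apply]
        refine ha _ fun g => ?_
        rw [Coind.smul_apply, ← h1, ← map_mul, hf]
      rw [h2, zero_add, map_add, AlgHom.commutes, mul_add, map_add, ← Algebra.commutes,
        ← Algebra.smul_def, map_smul, hf, smul_zero, zero_add]
      refine finsum_induction (fun t => f.1 (symY R c a * toRCA R c t) = 0) ?_ ?_ ?_
      · rw [map_zero, mul_zero, map_zero]
      · intro s t hs ht
        rw [map_add, mul_add, map_add, hs, ht, add_zero]
      · intro s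
        rw [map_smul, mul_smul_comm, map_smul]
        exact (congrArg _ (hw s.1 f hf a)).trans (smul_zero _)
  | w g => exact hw g
  | add a b ha hb =>
    intro f hf g
    rw [add_smul]
    change (a • f).1 (symY R c g) + (b • f).1 (symY R c g) = 0
    rw [ha f hf, hb f hf, add_zero]
  | mul a b ha hb =>
    intro f hf g
    rw [mul_smul]
    exact ha _ (hb f hf) g

end Uniqueness

section Generator

variable {M : Type*} [AddCommGroup M] [Module ℂ M] (τ : Smash W h →ₐ[ℂ] Module.End ℂ M)

theorem Std.smul_mk (a b : RCA R c) (m : M) :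
    a • Std.mk R c τ b m = Std.mk R c τ (a * b) m := rfl

theorem Std.mk_mul_smashY (a : RCA R c) (b : Smash W h) (m : M) :
    Std.mk R c τ (a * smashY R c b) m = Std.mk R c τ a (τ b m) :=
  (Submodule.Quotient.eq _).2 (Submodule.subset_span ⟨a, b, m, rfl⟩)

theorem Std.induction {p : Std R c τ → Prop} (zero : p 0) (mk : ∀ a m, p (Std.mk R c τ a m))
    (add : ∀ u v, p u → p v → p (u + v)) (u : Std R c τ) : p u := by
  obtain ⟨t, rfl⟩ := Submodule.Quotient.mk_surjective _ u
  induction t using TensorProduct.induction_on with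
  | zero => exact zero
  | tmul a m => exact mk a m
  | add s t hs ht => exact add _ _ hs ht

end Generator

theorem coinvRep_one (w : W) : coinvRep W h w 1 = 1 := by
  rw [← map_one (Ideal.Quotient.mk _), coinvRep_mk, smul_one]

theorem DeltaCoinv.symY_smul_gen (g : SymmetricAlgebra ℂ h) :
    symY R c g • DeltaCoinv.gen R c
      = Std.mk R c (coinvAction W h) 1 (Ideal.Quotient.mk _ g) := by
  have h1 := Std.mk_mul_smashY R c (coinvAction W h) 1 (SkewMonoidAlgebra.single 1 g) 1
  rw [smashY_single, coinvAction_single, map_one, mul_one, coinvRep_one, mul_one,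
    one_mul] at h1
  rw [← h1, DeltaCoinv.gen, Std.smul_mk, mul_one]

theorem DeltaCoinv.wHom_smul_gen (w : W) :
    wHom R c w • DeltaCoinv.gen R c = DeltaCoinv.gen R c := by
  have h1 := Std.mk_mul_smashY R c (coinvAction W h) 1 (SkewMonoidAlgebra.single w 1) 1
  rw [smashY_single, coinvAction_single, map_one, one_mul, coinvRep_one, map_one,
    one_mul, one_mul] at h1
  rw [DeltaCoinv.gen, Std.smul_mk, mul_one, h1]

variable {R c}

/-- The map `g ↦ F(1 ⊗ 1)(g)` on `S(h)`. -/
def genValue (F : DeltaCoinv R c →ₗ[RCA R c] NablaCoinv R c) :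
    SymmetricAlgebra ℂ h →ₗ[ℂ] Coinv W (Module.Dual ℂ h) :=
  (F (DeltaCoinv.gen R c)).1.1 ∘ₗ (symY R c).toLinearMap

variable (F : DeltaCoinv R c →ₗ[RCA R c] NablaCoinv R c)

theorem genValue_apply (g : SymmetricAlgebra ℂ h) :
    genValue F g = NablaCoinv.eval R c (F (DeltaCoinv.gen R c)) (symY R c g) := rfl

theorem eval_smul (n : NablaCoinv R c) (a b : RCA R c) :
    NablaCoinv.eval R c (a • n) b = NablaCoinv.eval R c n (b * a) := rfl

theorem genValue_of_mem {g : SymmetricAlgebra ℂ h} (hg : g ∈ coinvIdeal W h) :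
    genValue F g = 0 := by
  rw [genValue_apply, ← one_mul (symY R c g), ← eval_smul, ← map_smul,
    DeltaCoinv.symY_smul_gen, Ideal.Quotient.eq_zero_iff_mem.2 hg]
  have h1 : Std.mk R c (coinvAction W h) 1 0 = 0 :=
    congrArg (Submodule.Quotient.mk (p := stdRel R c (coinvAction W h))) (tmul_zero _ 1)
  rw [h1, map_zero]
  rfl

/-- The generator is fixed by `W`, so `w` may be inserted on the right of `S(h)` at no cost; moved
to the left, it acts on the values. -/
theorem genValue_smul (w : W) (g : SymmetricAlgebra ℂ h) :
    genValue F (w • g)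
      = twist (coinvRep W (Module.Dual ℂ h)) (detInv W) w (genValue F g) := by
  have h1 : symY R c (w • g) * wHom R c w
      = smashX R c (SkewMonoidAlgebra.single w 1) * symY R c g := by
    rw [smashX_single, map_one, one_mul, symY_smul]
  rw [genValue_apply, ← DeltaCoinv.wHom_smul_gen R c w, map_smul, eval_smul, h1]
  refine ((F (DeltaCoinv.gen R c)).1.2 _ _).trans ?_
  rw [coinvTwistAction_single, map_one, one_mul]
  rfl

/-- The standard module is generated by `1 ⊗ 1`. -/
theorem DeltaCoinv.hom_ext {N : Type*} [AddCommMonoid N] [Module (RCA R c) N]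
    {F G : DeltaCoinv R c →ₗ[RCA R c] N}
    (hFG : F (DeltaCoinv.gen R c) = G (DeltaCoinv.gen R c)) : F = G := by
  refine LinearMap.ext fun u => ?_
  refine Std.induction R c _ (p := fun u => F u = G u) (F.map_zero.trans G.map_zero.symm)
    (fun a m => ?_) (fun u v hu hv => ?_) u
  · obtain ⟨g, rfl⟩ := Ideal.Quotient.mk_surjective m
    have h2 : Std.mk R c (coinvAction W h) a (Ideal.Quotient.mk _ g)
        = (a * symY R c g) • DeltaCoinv.gen R c := by
      rw [mul_smul, DeltaCoinv.symY_smul_gen, Std.smul_mk, mul_one]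
    rw [h2, F.map_smul, G.map_smul, hFG]
  · exact (F.map_add u v).trans ((congrArg₂ (· + ·) hu hv).trans (G.map_add u v).symm)

theorem genValue_injective :
    Function.Injective (genValue : (DeltaCoinv R c →ₗ[RCA R c] NablaCoinv R c) → _) :=
  fun _ _ hFG => DeltaCoinv.hom_ext (Subtype.ext (sub_eq_zero.1 (Coind.eq_zero R c _ fun g =>
    sub_eq_zero.2 (LinearMap.congr_fun hFG g))))

end Adjunction

/-! ### Construction of homomorphisms by Dunkl operators and adjunction -/

section Existence

open SymmetricAlgebra TensorProduct

variable {h : Type*} [AddCommGroup h] [Module ℂ h] {W : Subgroup (h ≃ₗ[ℂ] h)}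
  (R : Roots W) {c : Refl W → ℂ}

section Universal

variable {M N : Type*} [AddCommGroup M] [Module ℂ M] {τ : Smash W h →ₐ[ℂ] Module.End ℂ M}
  [AddCommGroup N] [Module ℂ N] [Module (RCA R c) N] [IsScalarTower ℂ (RCA R c) N]
  [SMulCommClass (RCA R c) ℂ N]

/-- The universal property of `H_c ⊗_{S(h) ⋊ W} M`. -/
def Std.lift (t : M →ₗ[ℂ] N) (ht : ∀ b m, smashY R c b • t m = t (τ b m)) :
    Std R c τ →ₗ[RCA R c] N :=
  (stdRel R c τ).liftQ
    (AlgebraTensorModule.lift (LinearMap.toSpanSingleton (RCA R c) (M →ₗ[ℂ] N) t)) (by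
      refine Submodule.span_le.2 ?_
      rintro _ ⟨a, b, m, rfl⟩
      change _ = _
      rw [map_sub, AlgebraTensorModule.lift_tmul, AlgebraTensorModule.lift_tmul, sub_eq_zero]
      change (a * smashY R c b) • t m = a • t (τ b m)
      rw [mul_smul, ht])

theorem Std.lift_mk (t : M →ₗ[ℂ] N) (ht : ∀ b m, smashY R c b • t m = t (τ b m)) (a : RCA R c)
    (m : M) : Std.lift R t ht (Std.mk R c τ a m) = a • t m := rfl

/-- The universal property of `H_c ⊗_{S(h) ⋊ W} M`, for maps to a submodule. -/
def Std.liftTo (P : Submodule (RCA R c) N) (t : M →ₗ[ℂ] N) (htP : ∀ m, t m ∈ P)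
    (ht : ∀ b m, smashY R c b • t m = t (τ b m)) : Std R c τ →ₗ[RCA R c] P :=
  (Std.lift R t ht).codRestrict P
    (Std.induction R c τ (by rw [map_zero]; exact zero_mem _)
      (fun a m => by rw [Std.lift_mk]; exact P.smul_mem a (htP m))
      (fun u v hu hv => by rw [map_add]; exact add_mem hu hv))

end Universal

section CoindMaps

variable {E M : Type*} [AddCommGroup E] [Module ℂ E] [AddCommGroup M] [Module ℂ M]
  {τ : Smash W (Module.Dual ℂ h) →ₐ[ℂ] Module.End ℂ M} {R}
  (ρ : RCA R c →ₐ[ℂ] Module.End ℂ E) (ψ : E →ₗ[ℂ] M)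

/-- The map `E → Hom_{S(h*) ⋊ W}(H_c, M)` corresponding by adjunction to an
`S(h*) ⋊ W`-equivariant map `E → M` on an `H_c`-module `E`. -/
def toCoind (hψ : ∀ b u, ψ (ρ (smashX R c b) u) = τ b (ψ u)) : E →ₗ[ℂ] Coind R c τ where
  toFun u := ⟨ψ ∘ₗ LinearMap.applyₗ u ∘ₗ ρ.toLinearMap, fun b a => by
    change ψ (ρ (smashX R c b * a) u) = τ b (ψ (ρ a u))
    rw [map_mul, Module.End.mul_apply, hψ]⟩
  map_add' u v := by
    refine Subtype.ext (LinearMap.ext fun a => ?_)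
    change ψ (ρ a (u + v)) = ψ (ρ a u) + ψ (ρ a v)
    rw [map_add, map_add]
  map_smul' z u := by
    refine Subtype.ext (LinearMap.ext fun a => ?_)
    change ψ (ρ a (z • u)) = z • ψ (ρ a u)
    rw [map_smul, map_smul]

variable {ρ ψ} (hψ : ∀ b u, ψ (ρ (smashX R c b) u) = τ b (ψ u))

theorem smul_toCoind (a : RCA R c) (u : E) : a • toCoind ρ ψ hψ u = toCoind ρ ψ hψ (ρ a u) := by
  refine Subtype.ext (LinearMap.ext fun b => ?_)
  change ψ (ρ (b * a) u) = ψ (ρ b (ρ a u))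
  rw [map_mul, Module.End.mul_apply]

theorem toCoind_mem_locNil {r : ℕ} {u : E}
    (hu : ∀ l : List h, l.length = r → ρ (l.map (yLin R c)).prod u = 0) :
    toCoind ρ ψ hψ u ∈ locNil R c (Coind R c τ) :=
  ⟨r, fun l hl => by rw [smul_toCoind, hu l hl, map_zero]⟩

/-- An `S(h) ⋊ W`-equivariant map `M' → Hom_{S(h*) ⋊ W}(H_c, M)` with `h`-nilpotent values
extends to a homomorphism of `H_c`-modules from the standard to the costandard module. -/
def Std.toCostd {M' : Type*} [AddCommGroup M'] [Module ℂ M']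
    {τ' : Smash W h →ₐ[ℂ] Module.End ℂ M'} (t : M' →ₗ[ℂ] Coind R c τ)
    (htP : ∀ m, t m ∈ locNil R c (Coind R c τ)) (ht : ∀ b m, smashY R c b • t m = t (τ' b m)) :
    Std R c τ' →ₗ[RCA R c] Costd R c τ :=
  Std.liftTo R (Costd R c τ) t htP ht

end CoindMaps

/-- The linear maps of multiplication by the elements of `h` on the coinvariant algebra. -/
def coinvMul : h →ₗ[ℂ] Module.End ℂ (Coinv W h) :=
  LinearMap.mul ℂ (Coinv W h) ∘ₗ (Ideal.Quotient.mkₐ ℂ (coinvIdeal W h)).toLinearMap ∘ₗ ι ℂ h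

theorem coinvMul_apply (ξ : h) (m : Coinv W h) :
    coinvMul ξ m = Ideal.Quotient.mk _ (ι ℂ h ξ) * m := rfl

theorem coinvMul_comm (ξ₁ ξ₂ : h) :
    coinvMul (W := W) ξ₁ * coinvMul (W := W) ξ₂ = coinvMul (W := W) ξ₂ * coinvMul (W := W) ξ₁ :=
  LinearMap.ext fun m => mul_left_comm (Ideal.Quotient.mk (coinvIdeal W h) (ι ℂ h ξ₁)) _ m

theorem coinvRep_mul_coinvMul (w : W) (ξ : h) :
    coinvRep W h w * coinvMul (W := W) ξ = coinvMul (W := W) (w • ξ) * coinvRep W h w := by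
  refine LinearMap.ext fun m => ?_
  have := coinvRep_smul W h w (ι ℂ h ξ) m
  rwa [sym_smul_ι] at this

theorem prod_map_yLin (l : List h) :
    (l.map (yLin R c)).prod = symY R c (l.map (ι ℂ h)).prod := by
  rw [map_list_prod, List.map_map]
  congr 2
  funext ξ
  rw [Function.comp_apply, symY, symLift_ι]

theorem prod_map_ι_mem (l : List h) : (l.map (ι ℂ h)).prod ∈ augIdeal h ^ l.length := by
  induction l with
  | nil =>
    rw [List.map_nil, List.prod_nil, List.length_nil, pow_zero]
    exact Ideal.one_eq_top (R := SymmetricAlgebra ℂ h) ▸ trivial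
  | cons ξ l ih =>
    rw [List.map_cons, List.prod_cons, List.length_cons, pow_succ']
    exact Ideal.mul_mem_mul (mem_augIdeal.2 (algebraMapInv_ι _)) ih

variable [Fintype (Refl W)] (hc : ∀ s t : Refl W, IsConj s.1 t.1 → c s = c t)

/-- The standard module of `S(h)_W`, realised on `S(h*) ⊗ S(h)_W` by Dunkl operators. -/
def coinvDunkl : RCA R c →ₐ[ℂ]
    Module.End ℂ (SymmetricAlgebra ℂ (Module.Dual ℂ h) ⊗[ℂ] Coinv W h) :=
  dunklRep R coinvMul_comm hc coinvRep_mul_coinvMul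

/-- The derivative and the divided differences vanish on constants, so on `1 ⊗ S(h)_W` only
multiplication in the second factor remains. -/
theorem coinvDunkl_symY (g : SymmetricAlgebra ℂ h) (m : Coinv W h) :
    coinvDunkl R hc (symY R c g) (1 ⊗ₜ m) = 1 ⊗ₜ (Ideal.Quotient.mk _ g * m) := by
  induction g using SymmetricAlgebra.induction generalizing m with
  | algebraMap r =>
    rw [AlgHom.commutes, AlgHom.commutes, Module.algebraMap_end_apply, ← TensorProduct.tmul_smul]
    exact congrArg _ (Algebra.smul_def r m)
  | ι ξ => rw [symY, symLift_ι, coinvDunkl, dunklRep_yLin_one_tmul, coinvMul_apply]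
  | mul a b ha hb => rw [map_mul, map_mul, Module.End.mul_apply, hb, ha, map_mul, mul_assoc]
  | add a b ha hb =>
    rw [map_add, map_add, LinearMap.add_apply, ha, hb, map_add, add_mul, tmul_add]

theorem coinvDunkl_smashY (b : Smash W h) (m : Coinv W h) :
    coinvDunkl R hc (smashY R c b) (1 ⊗ₜ m) = 1 ⊗ₜ coinvAction W h b m := by
  induction b using SkewMonoidAlgebra.induction_on with
  | zero => rw [map_zero, map_zero, map_zero]; exact (tmul_zero _ _).symm
  | add a b ha hb =>
    rw [map_add, map_add, LinearMap.add_apply, ha, hb, map_add, LinearMap.add_apply, tmul_add]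
  | single w g =>
    rw [smashY_single, map_mul, Module.End.mul_apply, coinvAction_single,
      ← coinvDunkl_symY R hc]
    congr 1
    rw [coinvDunkl, dunklRep_wHom, diagRep_tmul, smul_one]

variable {φ : Coinv W h →ₗ[ℂ] Coinv W (Module.Dual ℂ h)}

/-- The extension of a linear map `S(h)_W → S(h*)_W` to an `S(h*)`-linear map. -/
def extendCoinv (φ : Coinv W h →ₗ[ℂ] Coinv W (Module.Dual ℂ h)) :
    SymmetricAlgebra ℂ (Module.Dual ℂ h) ⊗[ℂ] Coinv W h →ₗ[ℂ] Coinv W (Module.Dual ℂ h) :=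
  TensorProduct.lift ((LinearMap.mul ℂ _).compl₁₂
    (Ideal.Quotient.mkₐ ℂ (coinvIdeal W (Module.Dual ℂ h))).toLinearMap φ)

theorem extendCoinv_tmul (p : SymmetricAlgebra ℂ (Module.Dual ℂ h)) (m : Coinv W h) :
    extendCoinv φ (p ⊗ₜ m) = Ideal.Quotient.mk _ p * φ m := rfl

theorem twist_mk_mul (χ : W →* ℂˣ) (w : W) (q : SymmetricAlgebra ℂ (Module.Dual ℂ h))
    (n : Coinv W (Module.Dual ℂ h)) :
    twist (coinvRep W (Module.Dual ℂ h)) χ w (Ideal.Quotient.mk _ q * n)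
      = Ideal.Quotient.mk _ (w • q) * twist (coinvRep W (Module.Dual ℂ h)) χ w n :=
  (congrArg ((χ w : ℂ) • ·) (coinvRep_smul W (Module.Dual ℂ h) w q n)).trans
    (mul_smul_comm (χ w : ℂ) (Ideal.Quotient.mk (coinvIdeal W (Module.Dual ℂ h)) (w • q))
      (coinvRep W (Module.Dual ℂ h) w n)).symm

theorem extendCoinv_smashX (hφ : ∀ (w : W) (m : Coinv W h), φ (coinvRep W h w m)
      = twist (coinvRep W (Module.Dual ℂ h)) (detInv W) w (φ m)) (b : Smash W (Module.Dual ℂ h))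
    (u : SymmetricAlgebra ℂ (Module.Dual ℂ h) ⊗[ℂ] Coinv W h) :
    extendCoinv φ (coinvDunkl R hc (smashX R c b) u)
      = coinvTwistAction W (Module.Dual ℂ h) (detInv W) b (extendCoinv φ u) := by
  induction u using TensorProduct.induction_on with
  | zero => simp only [map_zero]
  | add u v hu hv => simp only [map_add, hu, hv]
  | tmul q m =>
    induction b using SkewMonoidAlgebra.induction_on with
    | zero => simp only [map_zero, LinearMap.zero_apply]
    | add a b ha hb => simp only [map_add, LinearMap.add_apply, ha, hb]
    | single w p =>
      rw [smashX_single, map_mul, Module.End.mul_apply, coinvTwistAction_single, coinvDunkl,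
        dunklRep_wHom, diagRep_tmul, dunklRep_symX, extendCoinv_tmul, extendCoinv_tmul, hφ,
        twist_mk_mul, map_mul, mul_assoc]

variable [Finite W] [FiniteDimensional ℂ h]

theorem exists_coinvDunkl_prod_eq_zero : ∃ r : ℕ, ∀ (m : Coinv W h) (l : List h), l.length = r →
    coinvDunkl R hc (l.map (yLin R c)).prod (1 ⊗ₜ m) = 0 := by
  obtain ⟨r, hr⟩ := exists_augIdeal_pow_le W h
  refine ⟨r, fun m l hl => ?_⟩
  have h1 := Ideal.Quotient.eq_zero_iff_mem.2 (hr (hl ▸ prod_map_ι_mem l))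
  rw [prod_map_yLin, coinvDunkl_symY, h1, zero_mul, tmul_zero]

variable (hφ : ∀ (w : W) (m : Coinv W h), φ (coinvRep W h w m)
  = twist (coinvRep W (Module.Dual ℂ h)) (detInv W) w (φ m))

/-- The map `m ↦ (a ↦ φ(a (1 ⊗ m)))` on `S(h)_W`. -/
def coinvToCoind :
    Coinv W h →ₗ[ℂ] Coind R c (coinvTwistAction W (Module.Dual ℂ h) (detInv W)) :=
  toCoind (coinvDunkl R hc) (extendCoinv φ) (extendCoinv_smashX R hc hφ) ∘ₗ
    TensorProduct.mk ℂ (SymmetricAlgebra ℂ (Module.Dual ℂ h)) (Coinv W h) 1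

theorem coinvToCoind_apply (m : Coinv W h) : coinvToCoind R hc hφ m
    = toCoind (coinvDunkl R hc) (extendCoinv φ) (extendCoinv_smashX R hc hφ) (1 ⊗ₜ m) := rfl

theorem coinvToCoind_mem (m : Coinv W h) : coinvToCoind R hc hφ m ∈ NablaCoinv R c := by
  obtain ⟨r, hr⟩ := exists_coinvDunkl_prod_eq_zero R hc
  exact toCoind_mem_locNil (extendCoinv_smashX R hc hφ) (hr m)

theorem smashY_smul_coinvToCoind (b : Smash W h) (m : Coinv W h) :
    smashY R c b • coinvToCoind R hc hφ m = coinvToCoind R hc hφ (coinvAction W h b m) := by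
  rw [coinvToCoind_apply, smul_toCoind, coinvDunkl_smashY, coinvToCoind_apply]

/-- The homomorphism `Δ_c(S(h)_W) → ∇_c(S(h*)_W ⊗ det⁻¹)` extending an equivariant map. -/
def ofEquivariant : DeltaCoinv R c →ₗ[RCA R c] NablaCoinv R c :=
  Std.toCostd (coinvToCoind R hc hφ) (coinvToCoind_mem R hc hφ)
    (smashY_smul_coinvToCoind R hc hφ)

theorem genValue_ofEquivariant (g : SymmetricAlgebra ℂ h) :
    genValue (ofEquivariant R hc hφ) g = φ (Ideal.Quotient.mk _ g) := by
  change extendCoinv φ (coinvDunkl R hc (symY R c g * 1) (1 ⊗ₜ 1)) = _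
  rw [mul_one, coinvDunkl_symY, extendCoinv_tmul, map_one, one_mul, mul_one]

end Existence

/-! ### Passage to maps from `S(h*)_W` to the dual of the harmonic polynomials -/

section Correspondence

open SymmetricAlgebra

variable {h : Type*} [AddCommGroup h] [Module ℂ h] {W : Subgroup (h ≃ₗ[ℂ] h)}
  (R : Roots W) {c : Refl W → ℂ}

theorem genValue_add (F G : DeltaCoinv R c →ₗ[RCA R c] NablaCoinv R c) :
    genValue (F + G) = genValue F + genValue G := rfl

variable [Finite W] [FiniteDimensional ℂ h]

/-- Every class modulo the coinvariant ideal has a harmonic representative, and `genValue` depends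
only on the class. -/
theorem genValue_eq_of_har (hW : IsComplexReflectionGroup W)
    {F G : DeltaCoinv R c →ₗ[RCA R c] NablaCoinv R c}
    (hFG : ∀ g : Har W, genValue F g.1 = genValue G g.1) : genValue F = genValue G := by
  refine LinearMap.ext fun g => ?_
  obtain ⟨g', hg'⟩ := (harEquiv R hW).surjective (Ideal.Quotient.mk _ g)
  have h1 := Ideal.Quotient.eq.1 (hg'.symm.trans (harEquiv_apply hW g'))
  have h2 : ∀ E : DeltaCoinv R c →ₗ[RCA R c] NablaCoinv R c, genValue E g = genValue E g'.1 :=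
    fun E => by rw [← sub_eq_zero, ← map_sub, genValue_of_mem E h1]
  rw [h2, h2, hFG]

variable (hW : IsComplexReflectionGroup W)

variable (c) in
/-- The map `F ↦ (b ↦ (g ↦ ⟨F(1 ⊗ 1)(g) b, J⟩))`. -/
def homToDual : (DeltaCoinv R c →ₗ[RCA R c] NablaCoinv R c) →ₗ[ℂ]
    Coinv W (Module.Dual ℂ h) →ₗ[ℂ] Module.Dual ℂ (Har W) where
  toFun F := (coinvForm R hW ∘ₗ genValue F ∘ₗ (Har W).subtype).flip
  map_add' F G := by
    refine LinearMap.ext₂ fun b g => ?_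
    simp only [LinearMap.flip_apply, LinearMap.comp_apply, LinearMap.add_apply, genValue_add,
      map_add]
  map_smul' z F := by
    exact LinearMap.ext₂ fun b g =>
      LinearMap.congr_fun ((coinvForm R hW).map_smul z (genValue F g.1)) b

theorem homToDual_coinvRep (F : DeltaCoinv R c →ₗ[RCA R c] NablaCoinv R c) (w : W)
    (b : Coinv W (Module.Dual ℂ h)) :
    homToDual R c hW F (coinvRep W (Module.Dual ℂ h) w b)
      = (harRep W).dual w (homToDual R c hW F b) := by
  refine LinearMap.ext fun g => ?_
  change coinvForm R hW (genValue F g.1) (coinvRep W (Module.Dual ℂ h) w b)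
    = coinvForm R hW (genValue F (w⁻¹ • g.1)) b
  rw [← coinvForm_smul hW w (genValue F (w⁻¹ • g.1)) b, ← genValue_smul, smul_inv_smul]

variable (c) in
/-- The map `homToDual`, with values in the `W`-equivariant maps. -/
def homToIntertwining : (DeltaCoinv R c →ₗ[RCA R c] NablaCoinv R c) →ₗ[ℂ]
    Representation.IntertwiningMap (coinvRep W (Module.Dual ℂ h)) (harRep W).dual where
  toFun F := (homToDual R c hW F).intertwiningMap_of_isIntertwiningMap _ _
    (homToDual_coinvRep R hW F)
  map_add' F G := Representation.IntertwiningMap.ext ((homToDual R c hW).map_add F G)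
  map_smul' z F := Representation.IntertwiningMap.ext ((homToDual R c hW).map_smul z F)

theorem homToIntertwining_apply (F : DeltaCoinv R c →ₗ[RCA R c] NablaCoinv R c)
    (b : Coinv W (Module.Dual ℂ h)) (g : Har W) :
    homToIntertwining R c hW F b g = coinvForm R hW (genValue F g.1) b := rfl

theorem homToIntertwining_injective : Function.Injective (homToIntertwining R c hW) := by
  intro F G hFG
  refine genValue_injective (genValue_eq_of_har R hW fun g => ?_)
  refine coinvForm_injective (R := R) hW (LinearMap.ext fun b => ?_)
  exact (homToIntertwining_apply R hW F b g).symm.trans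
    ((congrArg (fun T => T b g) hFG).trans (homToIntertwining_apply R hW G b g))

/-- The map `S(h)_W → S(h*)_W ⊗ det⁻¹` corresponding to a map `S(h*)_W → Har*`. -/
def coinvMapOfDual (T : Coinv W (Module.Dual ℂ h) →ₗ[ℂ] Module.Dual ℂ (Har W)) :
    Coinv W h →ₗ[ℂ] Coinv W (Module.Dual ℂ h) :=
  (coinvDualEquiv R hW).symm.toLinearMap ∘ₗ T.flip ∘ₗ (harEquiv R hW).symm.toLinearMap

theorem coinvForm_coinvMapOfDual (T : Coinv W (Module.Dual ℂ h) →ₗ[ℂ] Module.Dual ℂ (Har W))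
    (g : Har W) (b : Coinv W (Module.Dual ℂ h)) :
    coinvForm R hW (coinvMapOfDual R hW T (Ideal.Quotient.mk _ g.1)) b = T b g := by
  rw [← harEquiv_apply hW]
  change coinvDualEquiv R hW ((coinvDualEquiv R hW).symm
    (T.flip ((harEquiv R hW).symm (harEquiv R hW g)))) b = T b g
  rw [LinearEquiv.apply_symm_apply, LinearEquiv.symm_apply_apply, LinearMap.flip_apply]

/-- Both sides are tested against elements `w b'` under the nondegenerate invariant form, which
turns the claim into the equivariance of `T`. -/
theorem coinvMapOfDual_coinvRep
    (T : Representation.IntertwiningMap (coinvRep W (Module.Dual ℂ h)) (harRep W).dual)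
    (w : W) (m : Coinv W h) :
    coinvMapOfDual R hW T.toLinearMap (coinvRep W h w m)
      = twist (coinvRep W (Module.Dual ℂ h)) (detInv W) w
          (coinvMapOfDual R hW T.toLinearMap m) := by
  obtain ⟨g, rfl⟩ := (harEquiv R hW).surjective m
  refine coinvForm_injective (R := R) hW (LinearMap.ext fun b => ?_)
  obtain ⟨b, rfl⟩ : ∃ b', coinvRep W (Module.Dual ℂ h) w b' = b :=
    ⟨coinvRep W (Module.Dual ℂ h) w⁻¹ b, Representation.self_inv_apply _ _ _⟩
  rw [coinvForm_smul, harEquiv_apply, coinvRep_mk, coinvForm_coinvMapOfDual]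
  refine (coinvForm_coinvMapOfDual R hW T.toLinearMap (harRep W w g) _).trans ?_
  have h1 : T (coinvRep W (Module.Dual ℂ h) w b) (harRep W w g) = T b g := by
    rw [T.isIntertwining, Representation.dual_apply]
    change T b (harRep W w⁻¹ (harRep W w g)) = T b g
    rw [Representation.inv_self_apply]
  exact h1

theorem homToIntertwining_surjective (hc : ∀ s t : Refl W, IsConj s.1 t.1 → c s = c t) :
    Function.Surjective (homToIntertwining R c hW) := by
  intro T
  have : Fintype (Refl W) := Fintype.ofFinite _
  refine ⟨ofEquivariant R hc (coinvMapOfDual_coinvRep R hW T),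
    Representation.IntertwiningMap.ext (LinearMap.ext₂ fun b g => ?_)⟩
  refine (homToIntertwining_apply R hW _ b g).trans ?_
  rw [genValue_ofEquivariant, coinvForm_coinvMapOfDual]

end Correspondence

end

end Cherednik

theorem theoremA {h : Type*} [AddCommGroup h] [Module ℂ h] [FiniteDimensional ℂ h]
    (W : Subgroup (h ≃ₗ[ℂ] h)) (hW : Cherednik.IsComplexReflectionGroup W)
    (R : Cherednik.Roots W) (c : Cherednik.Refl W → ℂ)
    (hc : ∀ s t : Cherednik.Refl W, IsConj s.1 t.1 → c s = c t) :
    ∃ Φ : (Cherednik.DeltaCoinv R c →ₗ[Cherednik.RCA R c] Cherednik.NablaCoinv R c) ≃ₗ[ℂ]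
        Representation.IntertwiningMap (Cherednik.coinvRep W (Module.Dual ℂ h))
          (Cherednik.harRep W).dual,
      ∀ (F : Cherednik.DeltaCoinv R c →ₗ[Cherednik.RCA R c] Cherednik.NablaCoinv R c)
        (g : Cherednik.Har W) (a b : SymmetricAlgebra ℂ (Module.Dual ℂ h)),
        Ideal.Quotient.mk (Cherednik.coinvIdeal W (Module.Dual ℂ h)) a =
            Cherednik.NablaCoinv.eval R c (F (Cherednik.DeltaCoinv.gen R c))
              (Cherednik.symY R c g.1) →
        Φ F (Ideal.Quotient.mk (Cherednik.coinvIdeal W (Module.Dual ℂ h)) b) g =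
          Cherednik.pairing (a * b) (Cherednik.jacobian R) := by
  have : Finite W := hW.1
  refine ⟨LinearEquiv.ofBijective (Cherednik.homToIntertwining R c hW)
    ⟨Cherednik.homToIntertwining_injective R hW, Cherednik.homToIntertwining_surjective R hW hc⟩,
    fun F g a b hab => ?_⟩
  refine (Cherednik.homToIntertwining_apply R hW F _ g).trans ?_
  rw [Cherednik.genValue_apply, ← hab, Cherednik.coinvForm_mk]
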